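/- Let $(a_m)_{m\ge 1}$ be real numbers with $a_1\neq 0$, and let $L$ be an entire function with $L(z)=\sum_{m\ge1}a_m m^{-z}$ (absolutely convergent) in some right half-plane. Let $N>0$, let $J,K\ge 0$ be integers with $J+K\ge 1$, and let $\mu_1,\dots,\mu_J,\eta_1,\dots,\eta_K\in\mathbb{C}$. With $\Gamma_{\mathbb R}(s)=\pi^{-s/2}\Gamma(s/2)$ and $\Gamma_{\mathbb C}(s)=2(2\pi)^{-s}\Gamma(s)$, suppose that $$\Lambda(z)=N^{z/2}\prod_{j=1}^{J}\Gamma_{\mathbb R}(z+\mu_j)\prod_{k=1}^{K}\Gamma_{\mathbb C}(z+\eta_k)\,L(z)$$ extends to an entire function with $\Lambda(\bar z)=\overline{\Lambda(z)}$ and $\Lambda(z)=\Lambda(1-z)$. Suppose that $L$ is polynomially bounded in $\operatorname{Im} z$ on vertical strips: for all real $x_1\le x_2$ there are $C,A,Y>0$ with $|L(x+iy)|\le C|y|^{A}$ for $x_1\le x\le x_2$, $|y|\ge Y$. Put $F(z)=\Lambda(\tfrac12+z)$ and let $T_m(F;\cdot)$ be the Taylor polynomial of $F$ at $0$ of degree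 at most $m$. There is $\ell\ge\tfrac12$ such that $F$ has no zero on $[\ell,\infty)$. For every such $\ell$ and all sufficiently large $n$ there is exactly one $\lambda=\lambda(n)>\ell$ with $2-\frac{\lambda}{n}\frac{F'(\lambda)}{F(\lambda)}=0$. It satisfies $$\lambda(n)=\frac{4n}{J+2K}\left[W\!\left(\frac{2n}{\pi(J+2K)}\,N^{\frac1{J+2K}}\right)\right]^{-1}\left[1+O(n^{-1})\right],$$ where $W$ is the real branch, with $W\ge -1$, of the inverse of $W\mapsto We^{W}$. For large $n$, $F(\lambda z)$ has no zero in $|\operatorname{Re}z|>\tfrac12$; let $\phi_\lambda$ be the holomorphic function there with $e^{n\phi_\lambda(z)}=z^{2n}F(\lambda)/F(\lambda z)$, $\phi_\lambda(1)=0$ and $\phi_\lambda(-z)=\phi_\lambda(z)$. Elsewhere $F(\lambda z)e^{n\phi_\lambda(z)}$ stands for $z^{2n}F(\lambda)$. There is $\delta_0>0$ such that for all large $n$ there are an open set $B_{1,\delta_0}\ni 1$ in $\operatorname{Re}z>\tfrac12$ and a conformal bijection $w$ of $B_{1,\delta_0}$ onto $\{|w|<\delta_0\}$ with $w^2=\phi_\lambda$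 and $w(z)=-i\sqrt{|\phi_\lambda''(1)|/2}\,(z-1)(1+O(z-1))$; extend it by $w(-z)=w(z)$ to $B_{-1,\delta_0}=-B_{1,\delta_0}$. For $0<\delta<\delta_0$ let $B_\delta=\{z\in B_{1,\delta_0}\cup B_{-1,\delta_0}:|w(z)|<\delta\}$. Let $\chi$ be the characteristic function of $|\operatorname{Re}z|<1$, let $\operatorname{erfc}(s)=1-\frac{2}{\sqrt\pi}\int_0^s e^{-t^2}dt$, and let $$\mathcal H_0(z)=\frac{1}{\sqrt{2\pi|\phi_\lambda''(1)|}}\,\frac{2}{1-z^2}.$$ Then for every $\delta\in(0,\delta_0)$ and all sufficiently large $n$ there is a function $\mathcal E$ on $\mathbb{C}$ (depending on $n$) with $$T_{2n-2}(F;\lambda z)=T_{2n-1}(F;\lambda z)=\begin{cases}F(\lambda z)\left[\chi(z)-\dfrac{e^{n\phi_\lambda(z)}}{\sqrt n}\bigl(\mathcal H_0(z)+\mathcal E(z)\bigr)\right], & z\in\mathbb{C}\setminus B_\delta,\\[2ex] F(\lambda z)\left[\tfrac12\operatorname{erfc}\bigl(i\sqrt n\,w(z)\bigr)-\dfrac{e^{n\phi_\lambda(z)}}{\sqrt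 n}\,\mathcal E(z)\right], & z\in B_\delta.\end{cases}$$ Here $\mathcal E$ is bounded uniformly in $z$ and $n$, is analytic in $\mathbb{C}\setminus\bigl((\{|\operatorname{Re}z|=1\}\setminus B_\delta)\cup\partial B_\delta\bigr)$, and satisfies, uniformly in $z$ as $n\to\infty$, $$\mathcal E(z)=\begin{cases}O(n^{-1}), & z\in\mathbb{C}\setminus B_\delta,\\[1ex] \mathcal H_0(z)+\dfrac{1}{2i\sqrt\pi\,w(z)}+O(n^{-1}), & z\in B_\delta\setminus\{1,-1\},\end{cases}$$ with implied constants that may depend on $\delta$ and on the data $L,\Lambda$, but not on $z$ or $n$. -/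

import Mathlib

open Filter Topology Complex

namespace LTaylor

/-- The Taylor (Maclaurin) polynomial of degree at most `m` of `F`, evaluated at `z`. -/
noncomputable def taylorPoly (F : ℂ → ℂ) (m : ℕ) (z : ℂ) : ℂ :=
  ∑ k ∈ Finset.range (m + 1), iteratedDeriv k F 0 / (k.factorial : ℂ) * z ^ k

/-- The complementary error function `erfc s = 1 - (2/√π) ∫₀ˢ exp (-t²) dt` on `ℂ`; the integral
is taken along the segment from `0` to `s`. -/
noncomputable def erfc (s : ℂ) : ℂ :=
  1 - 2 / (Real.sqrt Real.pi : ℂ) * ∫ t in (0 : ℝ)..1, s * Complex.exp (-((t : ℂ) * s) ^ 2)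

/-- The principal real branch of the Lambert function: for `x ≥ -1/e`, `lambertW x` is the unique
`w ≥ -1` with `w * exp w = x`. -/
noncomputable def lambertW : ℝ → ℝ :=
  Function.invFunOn (fun w : ℝ => w * Real.exp w) (Set.Ici (-1))

/-- `x` is a point where `F` does not vanish and `2 - (x / n) (log F)'(x) = 0`. -/
def IsCriticalScale (F : ℂ → ℂ) (n : ℕ) (x : ℝ) : Prop :=
  F x ≠ 0 ∧ 2 - (x : ℂ) / n * (deriv F x / F x) = 0

/-- `φ` is the even branch of `2 log z + (1/n) log (F lam / F (lam z))` on `|Re z| > 1/2` that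
vanishes at `1`. The clauses force `F (lam z)` to be zero-free there and determine `φ` uniquely
on that region. -/
structure IsPhase (F : ℂ → ℂ) (n : ℕ) (lam : ℝ) (φ : ℂ → ℂ) : Prop where
  holo : DifferentiableOn ℂ φ {z : ℂ | 1 / 2 < |z.re|}
  even : ∀ z : ℂ, φ (-z) = φ z
  at_one : φ 1 = 0
  exp_eq : ∀ z : ℂ, 1 / 2 < |z.re| →
    F ((lam : ℂ) * z) ≠ 0 ∧
    Complex.exp ((n : ℂ) * φ z) = z ^ (2 * n) * F (lam : ℂ) / F ((lam : ℂ) * z)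

/-- `w` maps the neighbourhood `D` of `1` conformally onto the disk of radius `r` about `0`, with
`w² = φ` and `w z = -i √(|φ''(1)|/2) (z - 1) + O((z - 1)²)`; it is continued evenly to `-D`. -/
structure IsLocalCoord (φ w : ℂ → ℂ) (D : Set ℂ) (r : ℝ) : Prop where
  isOpen : IsOpen D
  one_mem : (1 : ℂ) ∈ D
  subset : D ⊆ {z : ℂ | 1 / 2 < z.re}
  holo : DifferentiableOn ℂ w D
  inj : Set.InjOn w D
  image : w '' D = Metric.ball 0 r
  sq_eq : ∀ z ∈ D, w z ^ 2 = φ z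
  branch : deriv w 1 = -Complex.I * (Real.sqrt (‖iteratedDeriv 2 φ 1‖ / 2) : ℂ)
  even : ∀ z ∈ D, w (-z) = w z

/-- `B_δ`: the union of the preimages in `D` and in `-D` of the disk of radius `δ` under `w`. -/
def localDisks (w : ℂ → ℂ) (D : Set ℂ) (δ : ℝ) : Set ℂ :=
  {z : ℂ | (z ∈ D ∨ -z ∈ D) ∧ ‖w z‖ < δ}

/-- `H₀ z = (2π |φ''(1)|)^(-1/2) * 2 / (1 - z²)`. -/
noncomputable def H0 (φ : ℂ → ℂ) (z : ℂ) : ℂ :=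
  1 / (Real.sqrt (2 * Real.pi * ‖iteratedDeriv 2 φ 1‖) : ℂ) * (2 / (1 - z ^ 2))

/-- The characteristic function of the strip `|Re z| < 1`. -/
noncomputable def chi : ℂ → ℂ := Set.indicator {z : ℂ | |z.re| < 1} (fun _ => 1)

/-- The uniform description of the polynomial value `T` at `z` with residual error `E`, with
`B = B_δ`. The factor `F (lam z) e^{n φ(z)}` is written as `z^{2n} F lam`, which is what it stands
for, also where `F (lam z) = 0`. -/
def Expansion (F : ℂ → ℂ) (n : ℕ) (lam : ℝ) (φ w : ℂ → ℂ) (B : Set ℂ) (E : ℂ → ℂ)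
    (T z : ℂ) : Prop :=
  (z ∉ B → T = F ((lam : ℂ) * z) * chi z
      - z ^ (2 * n) * F (lam : ℂ) / (Real.sqrt n : ℂ) * (H0 φ z + E z)) ∧
  (z ∈ B → T = F ((lam : ℂ) * z) * (1 / 2 * erfc (Complex.I * (Real.sqrt n : ℂ) * w z))
      - z ^ (2 * n) * F (lam : ℂ) / (Real.sqrt n : ℂ) * E z)

end LTaylor

/-! Put f(z) = F(λz)/F(λ), so that f(z) = z^{2n} e^{-nφ(z)} for Re z > 1/2. Since F is even and
decays on vertical strips (the Gamma factors beat the polynomial growth of L), Cauchy's formula may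
be taken over the two lines Re s = ±1, and truncating the geometric series of the kernel gives χ f -
T_{2n-1} = z^{2n} times the Cauchy transform of f(s)/s^{2n} (`pow_mul_lineTransform`). On Re s = 1
the density is e^{-nφ(s)}, and the equation for λ says precisely that φ'(1) = 0: the line passes
through a saddle point.

The phase is nearly universal. By a digamma estimate, F'/F is (d/2) log z + c + O(1/Re z) with d = J
+ 2K, so on the scale λ it varies by O(1) while its size tends to infinity. Hence φ'(z) is close to
2/z - 2, φ''(1) is real and close to -2, and everything holds on a disc about 1 independent of n
(`localPhase_of_hasDerivAt`). All estimates are proved for the class `Admissible C₀ n`, with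
constants depending only on C₀ and on distances, and this is the source of uniformity in n. The same
asymptotics make x F'(x)/F(x) increasing for large x, which gives the unique λ, and comparison with
the model equation x((d/2) log x + c) = 2n, solved by Lambert's function, gives its size.

Away from ±1 the saddle point method, after pairing y with -y, gives `H0` with error O(1/n), except
for a factor 1 + 1/dist(z, lines) (`exists_saddle_bound`). That factor is removed by continuation:
-T/z^{2n} is analytic across the lines, it differs from the transform inside the strip by f z^{-2n},
which is exponentially small near the lines and away from ±1, and a maximum principle on discs
centred on a line finishes (`exists_outer_inner_bound`).

Near 1, write φ = -v². The function √n (f z^{-2n} erfc(√n v)/2 - T z^{-2n}) is analytic near 1. On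
the curve |v| = δ the preceding estimate and the expansion of erfc identify it with `H0` + 1/(2√π
v), whose poles at 1 cancel, and the maximum principle carries this to the inside
(`exists_local_bound`). Evenness gives the neighbourhood of -1, and scaling back gives the theorem.
-/

namespace LTaylor

/-! ### The complementary error function and its asymptotics. -/

section ErrorFunction

open MeasureTheory Set

/-- A primitive on a ball of arbitrary radius suffices, since each contour used below lies in a
bounded convex set. -/
lemma exists_primitive_gaussian (R : ℝ) :
    ∃ g : ℂ → ℂ, ∀ z ∈ Metric.ball (0 : ℂ) R, HasDerivAt g (cexp (-z ^ 2)) z := by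
  have h : DifferentiableOn ℂ (fun z : ℂ => cexp (-z ^ 2)) (Metric.ball 0 R) := by
    apply Differentiable.differentiableOn; fun_prop
  exact h.isExactOn_ball

lemma integral_segment_gaussian {R : ℝ} {g : ℂ → ℂ}
    (hg : ∀ z ∈ Metric.ball (0 : ℂ) R, HasDerivAt g (cexp (-z ^ 2)) z) {a b : ℂ}
    (ha : a ∈ Metric.ball (0 : ℂ) R) (hb : a + b ∈ Metric.ball (0 : ℂ) R) :
    ∫ t in (0 : ℝ)..1, b * cexp (-(a + t * b) ^ 2) = g (a + b) - g a := by
  have hseg : ∀ t ∈ Icc (0 : ℝ) 1, a + t * b ∈ Metric.ball (0 : ℂ) R := by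
    intro t ht
    have := (convex_ball (0 : ℂ) R) ha hb (a := 1 - t) (b := t) (by linarith [ht.2]) ht.1 (by ring)
    convert this using 1
    simp only [real_smul, ofReal_sub, ofReal_one]
    ring
  have h := intervalIntegral.integral_eq_sub_of_hasDerivAt (a := (0 : ℝ)) (b := 1)
    (f := fun t : ℝ => g (a + t * b)) (f' := fun t : ℝ => b * cexp (-(a + t * b) ^ 2)) ?_ ?_
  · simpa using h
  · intro t ht
    rw [uIcc_of_le zero_le_one] at ht
    have h1 : HasDerivAt (fun t : ℝ => a + (t : ℂ) * b) b t := by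
      simpa using ((hasDerivAt_id t).ofReal_comp.mul_const b).const_add a
    have := (hg _ (hseg t ht)).comp t h1
    rw [mul_comm]
    exact this
  · apply Continuous.intervalIntegrable
    fun_prop

lemma erfc_eq_of_primitive {R : ℝ} {g : ℂ → ℂ}
    (hg : ∀ z ∈ Metric.ball (0 : ℂ) R, HasDerivAt g (cexp (-z ^ 2)) z) {s : ℂ}
    (hs : s ∈ Metric.ball (0 : ℂ) R) :
    erfc s = 1 - 2 / (Real.sqrt Real.pi : ℂ) * (g s - g 0) := by
  have h0 : (0 : ℂ) ∈ Metric.ball (0 : ℂ) R := by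
    simp only [Metric.mem_ball, dist_zero_right, norm_zero] at hs ⊢
    exact (norm_nonneg s).trans_lt hs
  have := integral_segment_gaussian hg h0 (b := s) (by simpa using hs)
  rw [erfc]
  simp only [zero_add] at this
  rw [this]

lemma differentiable_erfc : Differentiable ℂ erfc := by
  intro s
  obtain ⟨g, hg⟩ := exists_primitive_gaussian (‖s‖ + 1)
  have hs : s ∈ Metric.ball (0 : ℂ) (‖s‖ + 1) := by simp
  have : erfc =ᶠ[𝓝 s] fun s => 1 - 2 / (Real.sqrt Real.pi : ℂ) * (g s - g 0) := by
    filter_upwards [Metric.isOpen_ball.mem_nhds hs] with z hz using erfc_eq_of_primitive hg hz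
  rw [this.differentiableAt_iff]
  exact (((hg s hs).differentiableAt.sub_const _).const_mul _).const_sub _

lemma erfc_neg (s : ℂ) : erfc (-s) = 2 - erfc s := by
  have : ∫ t in (0 : ℝ)..1, -s * cexp (-((t : ℂ) * -s) ^ 2)
      = -∫ t in (0 : ℝ)..1, s * cexp (-((t : ℂ) * s) ^ 2) := by
    rw [← intervalIntegral.integral_neg]
    congr 1; ext t; rw [mul_neg, neg_sq, neg_mul]
  rw [erfc, erfc, this]; ring

lemma gaussian_integrableOn_Ioi : IntegrableOn (fun t : ℝ => Real.exp (-t ^ 2)) (Ioi 0) := by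
  simpa using (integrable_exp_neg_mul_sq one_pos).integrableOn

lemma integrableOn_shifted_gaussian (s : ℂ) :
    IntegrableOn (fun t : ℝ => cexp (-(s + t) ^ 2)) (Ioi 0) := by
  have h := (GaussianFourier.integrable_cexp_neg_mul_sq_add_real_mul_I (b := 1) (by simp) s.im)
  have h2 := h.comp_add_right s.re
  refine (h2.congr (ae_of_all _ fun t => ?_)).integrableOn
  simp only
  congr 1
  have : s = s.re + s.im * I := (re_add_im s).symm
  push_cast
  rw [neg_mul, one_mul]
  congr 2
  linear_combination -this

/-- The representation of `erfc` by an integral along a horizontal ray. -/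
lemma integral_shifted_gaussian (s : ℂ) :
    ∫ t in Ioi (0 : ℝ), cexp (-(s + t) ^ 2) = (Real.sqrt Real.pi : ℂ) / 2 * erfc s := by
  have hpi : (Real.sqrt Real.pi : ℂ) ≠ 0 := by
    exact_mod_cast (Real.sqrt_pos.2 Real.pi_pos).ne'
  have hT := intervalIntegral_tendsto_integral_Ioi (0 : ℝ) (integrableOn_shifted_gaussian s)
    tendsto_id
  have hG := intervalIntegral_tendsto_integral_Ioi (0 : ℝ) (integrableOn_shifted_gaussian 0)
    tendsto_id
  have hGv : ∫ t in Ioi (0 : ℝ), cexp (-((0 : ℂ) + t) ^ 2) = (Real.sqrt Real.pi : ℂ) / 2 := by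
    have := integral_gaussian_Ioi 1
    have h2 := congrArg (fun x : ℝ => (x : ℂ)) this
    rw [← integral_complex_ofReal, div_one] at h2
    push_cast at h2
    rw [← h2]
    congr 1; ext t; simp
  rw [hGv] at hG
  -- The far side of the parallelogram 0, s, s + T, T. On it Re (T + us)² ≥ (T - ‖s‖)² - ‖s‖², so
  -- its contribution vanishes in the limit.
  have hsmall : Tendsto (fun T : ℝ => ∫ u in (0 : ℝ)..1, s * cexp (-((T : ℂ) + u * s) ^ 2))
      atTop (𝓝 0) := by
    have hb : ∀ T : ℝ, ‖s‖ ≤ T → ‖∫ u in (0 : ℝ)..1, s * cexp (-((T : ℂ) + u * s) ^ 2)‖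
        ≤ ‖s‖ * Real.exp (‖s‖ ^ 2 - (T - ‖s‖) ^ 2) * |1 - 0| := by
      intro T hT
      apply intervalIntegral.norm_integral_le_of_norm_le_const
      intro u hu
      rw [uIoc_of_le zero_le_one] at hu
      rw [norm_mul, norm_exp]
      gcongr
      have e1 : |u * s.re| ≤ ‖s‖ := by
        rw [abs_mul, abs_of_pos hu.1]
        nlinarith [abs_re_le_norm s, hu.2, abs_nonneg s.re, hu.1]
      have e2 : |u * s.im| ≤ ‖s‖ := by
        rw [abs_mul, abs_of_pos hu.1]
        nlinarith [abs_im_le_norm s, hu.2, abs_nonneg s.im, hu.1]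
      have e3 : (u * s.im) ^ 2 ≤ ‖s‖ ^ 2 := sq_le_sq' (by linarith [abs_le.1 e2]) (abs_le.1 e2).2
      have e4 : (T - ‖s‖) ^ 2 ≤ (T + u * s.re) ^ 2 := by
        apply pow_le_pow_left₀ (by linarith); linarith [(abs_le.1 e1).1]
      simp only [neg_re, pow_two, mul_re, add_re, ofReal_re, ofReal_im, zero_mul, sub_zero,
        add_im, mul_im, zero_add, add_zero]
      nlinarith
    refine squeeze_zero_norm' (a := fun T : ℝ => ‖s‖ * Real.exp (‖s‖ ^ 2 - (T - ‖s‖) ^ 2) * |1 - 0|)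
      ?_ ?_
    · filter_upwards [eventually_ge_atTop ‖s‖] with T hT using hb T hT
    · have : Tendsto (fun T : ℝ => ‖s‖ ^ 2 - (T - ‖s‖) ^ 2) atTop atBot := by
        refine tendsto_atBot_mono' _ (f₁ := fun T : ℝ => -T + (‖s‖ ^ 2 + ‖s‖ + 1)) ?_ ?_
        · filter_upwards with T
          nlinarith [sq_nonneg (T - ‖s‖ - 1/2)]
        · exact tendsto_atBot_add_const_right _ _ tendsto_neg_atTop_atBot
      simpa using ((Real.tendsto_exp_atBot.comp this).const_mul ‖s‖)
  have hid : ∀ᶠ T : ℝ in atTop, ∫ t in (0 : ℝ)..T, cexp (-(s + t) ^ 2)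
      = (∫ t in (0 : ℝ)..T, cexp (-((0 : ℂ) + t) ^ 2))
        + (∫ u in (0 : ℝ)..1, s * cexp (-((T : ℂ) + u * s) ^ 2))
        - (Real.sqrt Real.pi : ℂ) / 2 * (1 - erfc s) := by
    filter_upwards [eventually_gt_atTop 0] with T hTpos
    obtain ⟨g, hg⟩ := exists_primitive_gaussian (‖s‖ + T + 1)
    have hs : s ∈ Metric.ball (0 : ℂ) (‖s‖ + T + 1) := by simp; linarith
    have h0 : (0 : ℂ) ∈ Metric.ball (0 : ℂ) (‖s‖ + T + 1) := by simp; positivity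
    have hTm : (T : ℂ) ∈ Metric.ball (0 : ℂ) (‖s‖ + T + 1) := by
      simp [abs_of_pos hTpos]; linarith [norm_nonneg s]
    have hsT : s + (T : ℂ) ∈ Metric.ball (0 : ℂ) (‖s‖ + T + 1) := by
      rw [mem_ball_zero_iff]
      refine (norm_add_le _ _).trans_lt ?_
      simp [abs_of_pos hTpos]
    have key : ∀ a : ℂ, a ∈ Metric.ball (0 : ℂ) (‖s‖ + T + 1) →
        a + T ∈ Metric.ball (0 : ℂ) (‖s‖ + T + 1) →
        ∫ t in (0 : ℝ)..T, cexp (-(a + t) ^ 2) = g (a + T) - g a := by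
      intro a h1 h2
      rw [← integral_segment_gaussian hg h1 h2]
      have := intervalIntegral.smul_integral_comp_mul_right (a := 0) (b := 1)
        (fun t : ℝ => cexp (-(a + t) ^ 2)) T
      rw [zero_mul, one_mul] at this
      rw [← this, ← intervalIntegral.integral_smul]
      congr 1; ext t; simp
    rw [key s hs hsT, key 0 h0 (by simpa using hTm),
      integral_segment_gaussian hg hTm (by rwa [add_comm (T : ℂ) s]), erfc_eq_of_primitive hg hs]
    field_simp
    rw [zero_add, add_comm (T : ℂ) s]; ring
  have hlim := ((hG.add hsmall).sub_const ((Real.sqrt Real.pi : ℂ) / 2 * (1 - erfc s)))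
  have := tendsto_nhds_unique hT (hlim.congr' (by
    filter_upwards [hid] with T hT using by simpa using hT.symm))
  rw [this]; ring

/-- Each integration by parts trades a factor 2s for a derivative of the amplitude. For Re s ≥ 0 the
exponential is only known to be bounded by 1, so convergence up to the imaginary axis comes from u
and u' alone. -/
lemma integral_by_parts_exp {s : ℂ} (hs : 0 ≤ s.re) {u u' : ℝ → ℝ}
    (hu : ∀ t, HasDerivAt u (u' t) t) (hi : IntegrableOn u (Ioi 0)) (hi' : IntegrableOn u' (Ioi 0))
    (hlim : Tendsto u atTop (𝓝 0)) :
    2 * s * ∫ t in Ioi (0 : ℝ), (u t : ℂ) * cexp (-(2 * s * t))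
      = u 0 + ∫ t in Ioi (0 : ℝ), (u' t : ℂ) * cexp (-(2 * s * t)) := by
  have hn : ∀ t ∈ Ioi (0 : ℝ), ‖cexp (-(2 * s * t))‖ ≤ 1 := by
    intro t ht
    rw [norm_exp, Real.exp_le_one_iff]
    have : (2 * s * (t : ℂ)).re = 2 * s.re * t := by simp
    rw [neg_re, this]
    have : (0 : ℝ) < t := ht
    have := mul_nonneg hs this.le
    linarith
  have hint : ∀ v : ℝ → ℝ, IntegrableOn v (Ioi 0) →
      IntegrableOn (fun t : ℝ => (v t : ℂ) * cexp (-(2 * s * t))) (Ioi 0) := by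
    intro v hv
    refine Integrable.mul_bdd (c := 1) hv.ofReal ?_ ?_
    · exact Continuous.aestronglyMeasurable (by fun_prop)
    · exact (ae_restrict_iff' measurableSet_Ioi).2 (ae_of_all _ hn)
  have hd : ∀ t : ℝ, HasDerivAt (fun t : ℝ => (u t : ℂ) * cexp (-(2 * s * t)))
      ((u' t : ℂ) * cexp (-(2 * s * t)) - 2 * s * ((u t : ℂ) * cexp (-(2 * s * t)))) t := by
    intro t
    have h1 : HasDerivAt (fun t : ℝ => cexp (-(2 * s * t))) (cexp (-(2 * s * t)) * (-(2 * s))) t := by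
      have : HasDerivAt (fun t : ℝ => -(2 * s * (t : ℂ))) (-(2 * s)) t := by
        simpa using ((hasDerivAt_id t).ofReal_comp.const_mul (2 * s)).fun_neg
      exact this.cexp
    refine ((hu t).ofReal_comp.fun_mul h1).congr_deriv ?_
    ring
  have hI := integral_Ioi_of_hasDerivAt_of_tendsto' (a := (0 : ℝ)) (m := 0) (fun t _ => hd t)
    ((hint u' hi').sub ((hint u hi).const_mul (2 * s))) ?_
  · rw [integral_sub (hint u' hi') ((hint u hi).const_mul (2 * s)), integral_const_mul] at hI
    simp only [ofReal_zero, mul_zero, neg_zero, Complex.exp_zero, mul_one, zero_sub] at hI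
    linear_combination -hI
  · refine squeeze_zero_norm' (a := fun t => ‖u t‖) ?_ (by simpa using hlim.norm)
    filter_upwards [eventually_gt_atTop 0] with t ht
    rw [norm_mul, norm_real]
    exact mul_le_of_le_one_right (norm_nonneg _) (hn t ht)

lemma integrableOn_pow_mul_gaussian (k : ℕ) :
    IntegrableOn (fun t : ℝ => t ^ k * Real.exp (-t ^ 2)) (Ioi 0) := by
  have := integrable_rpow_mul_exp_neg_mul_sq (b := 1) one_pos (s := k) (by
    have : (0 : ℝ) ≤ k := Nat.cast_nonneg k
    linarith)
  simpa using this.integrableOn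

lemma tendsto_pow_mul_gaussian (k : ℕ) :
    Tendsto (fun t : ℝ => t ^ k * Real.exp (-t ^ 2)) atTop (𝓝 0) := by
  refine squeeze_zero' ?_ ?_ (Real.tendsto_pow_mul_exp_neg_atTop_nhds_zero k)
  · filter_upwards [eventually_ge_atTop 0] with t ht
    positivity
  · filter_upwards [eventually_ge_atTop 1] with t ht
    gcongr
    nlinarith

/-- The asymptotic behaviour of `erfc` in the closed right half-plane. -/
lemma exists_erfc_asymptotic : ∃ C : ℝ, 0 < C ∧ ∀ s : ℂ, 0 ≤ s.re → s ≠ 0 →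
    ‖cexp (s ^ 2) * erfc s - 1 / ((Real.sqrt Real.pi : ℂ) * s)‖ ≤ C / ‖s‖ ^ 3 := by
  -- `u1`, `u2`, `u3` are the successive derivatives of `u0`. As `u1 0 = 0`, the 1/s² term is absent
  -- and three integrations by parts leave an error of order |s|⁻³, governed by |u2 0| = 2 and the
  -- L¹ norm of `u3`.
  set u0 : ℝ → ℝ := fun t => Real.exp (-t ^ 2)
  set u1 : ℝ → ℝ := fun t => -2 * (t ^ 1 * Real.exp (-t ^ 2)) with hu1
  set u2 : ℝ → ℝ := fun t => 4 * (t ^ 2 * Real.exp (-t ^ 2)) - 2 * (t ^ 0 * Real.exp (-t ^ 2))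
    with hu2
  set u3 : ℝ → ℝ := fun t => 12 * (t ^ 1 * Real.exp (-t ^ 2)) - 8 * (t ^ 3 * Real.exp (-t ^ 2))
    with hu3
  have e : ∀ t : ℝ, HasDerivAt (fun t : ℝ => Real.exp (-t ^ 2)) (-2 * t * Real.exp (-t ^ 2)) t := by
    intro t
    refine ((hasDerivAt_pow 2 t).fun_neg).exp.congr_deriv ?_
    simp; ring
  have ek : ∀ (k : ℕ) (t : ℝ), HasDerivAt (fun t : ℝ => t ^ k * Real.exp (-t ^ 2))
      (k * t ^ (k - 1) * Real.exp (-t ^ 2) + t ^ k * (-2 * t * Real.exp (-t ^ 2))) t :=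
    fun k t => (hasDerivAt_pow k t).mul (e t)
  have d0 : ∀ t, HasDerivAt u0 (u1 t) t := by
    intro t; refine (e t).congr_deriv ?_; simp only [hu1]; ring
  have d1 : ∀ t, HasDerivAt u1 (u2 t) t := by
    intro t; refine ((ek 1 t).const_mul (-2)).congr_deriv ?_; simp only [hu2]; norm_num; ring
  have d2 : ∀ t, HasDerivAt u2 (u3 t) t := by
    intro t; refine (((ek 2 t).const_mul 4).fun_sub ((ek 0 t).const_mul 2)).congr_deriv ?_
    simp only [hu3]; norm_num; ring
  have i0 : IntegrableOn u0 (Ioi 0) := gaussian_integrableOn_Ioi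
  have i1 : IntegrableOn u1 (Ioi 0) := (integrableOn_pow_mul_gaussian 1).const_mul _
  have i2 : IntegrableOn u2 (Ioi 0) := ((integrableOn_pow_mul_gaussian 2).const_mul _).sub
    ((integrableOn_pow_mul_gaussian 0).const_mul _)
  have i3 : IntegrableOn u3 (Ioi 0) := ((integrableOn_pow_mul_gaussian 1).const_mul _).sub
    ((integrableOn_pow_mul_gaussian 3).const_mul _)
  have l0 : Tendsto u0 atTop (𝓝 0) := by
    simpa only [pow_zero, one_mul] using tendsto_pow_mul_gaussian 0
  have l1 : Tendsto u1 atTop (𝓝 0) := by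
    simpa [hu1] using (tendsto_pow_mul_gaussian 1).const_mul (-2)
  have l2 : Tendsto u2 atTop (𝓝 0) := by
    simpa [hu2] using ((tendsto_pow_mul_gaussian 2).const_mul 4).sub
      ((tendsto_pow_mul_gaussian 0).const_mul 2)
  set K : ℝ := ∫ t in Ioi (0 : ℝ), ‖u3 t‖
  have hK : 0 ≤ K := integral_nonneg fun _ => norm_nonneg _
  have hpi : (0 : ℝ) < Real.sqrt Real.pi := Real.sqrt_pos.2 Real.pi_pos
  refine ⟨2 / Real.sqrt Real.pi * ((2 + K) / 8), by positivity, fun s hs hs0 => ?_⟩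
  have hpi' : (Real.sqrt Real.pi : ℂ) ≠ 0 := by exact_mod_cast hpi.ne'
  have p0 := integral_by_parts_exp hs d0 i0 i1 l0
  have p1 := integral_by_parts_exp hs d1 i1 i2 l1
  have p2 := integral_by_parts_exp hs d2 i2 i3 l2
  have z0 : u0 0 = 1 := by simp [u0]
  have z1 : u1 0 = 0 := by simp [hu1]
  have z2 : u2 0 = -2 := by simp [hu2]
  rw [z0] at p0; rw [z1] at p1; rw [z2] at p2
  have hE : cexp (s ^ 2) * erfc s
      = 2 / (Real.sqrt Real.pi : ℂ) * ∫ t in Ioi (0 : ℝ), (u0 t : ℂ) * cexp (-(2 * s * t)) := by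
    have h := integral_shifted_gaussian s
    have : ∀ t : ℝ, (u0 t : ℂ) * cexp (-(2 * s * t)) = cexp (s ^ 2) * cexp (-(s + t) ^ 2) := by
      intro t
      simp only [u0, ofReal_exp]
      rw [← Complex.exp_add, ← Complex.exp_add]
      congr 1; push_cast; ring
    simp_rw [this]
    rw [integral_const_mul, h]
    field_simp
  set J0 := ∫ t in Ioi (0 : ℝ), (u0 t : ℂ) * cexp (-(2 * s * t))
  set J1 := ∫ t in Ioi (0 : ℝ), (u1 t : ℂ) * cexp (-(2 * s * t))
  set J2 := ∫ t in Ioi (0 : ℝ), (u2 t : ℂ) * cexp (-(2 * s * t))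
  set J3 := ∫ t in Ioi (0 : ℝ), (u3 t : ℂ) * cexp (-(2 * s * t))
  have hJ3 : ‖J3‖ ≤ K := by
    refine norm_integral_le_of_norm_le i3.norm ?_
    refine (ae_restrict_iff' measurableSet_Ioi).2 (ae_of_all _ fun t ht => ?_)
    rw [norm_mul, norm_real]
    refine mul_le_of_le_one_right (norm_nonneg _) ?_
    rw [norm_exp, Real.exp_le_one_iff]
    have : (2 * s * (t : ℂ)).re = 2 * s.re * t := by simp
    rw [neg_re, this]
    have : (0 : ℝ) < t := ht
    have := mul_nonneg hs this.le
    linarith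
  push_cast at p0 p1 p2
  have hJ : J0 = 1 / (2 * s) + (-2 + J3) / (8 * s ^ 3) := by
    have a2 : J2 = (-2 + J3) / (2 * s) := by rw [eq_div_iff (by simpa using hs0)]; rw [← p2]; ring
    have a1 : J1 = J2 / (2 * s) := by
      rw [eq_div_iff (by simpa using hs0), mul_comm, p1]; simp
    have a0 : J0 = (1 + J1) / (2 * s) := by
      rw [eq_div_iff (by simpa using hs0), mul_comm, p0]
    rw [a0, a1, a2]; field_simp; ring
  rw [hE, hJ]
  have : 2 / (Real.sqrt Real.pi : ℂ) * (1 / (2 * s) + (-2 + J3) / (8 * s ^ 3))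
      - 1 / ((Real.sqrt Real.pi : ℂ) * s)
      = 2 / (Real.sqrt Real.pi : ℂ) * ((-2 + J3) / (8 * s ^ 3)) := by field_simp; ring
  rw [this, norm_mul, norm_div, norm_div, norm_mul, norm_pow, norm_real,
    Real.norm_of_nonneg hpi.le, mul_div_assoc]
  rw [show ‖(2 : ℂ)‖ = 2 by simp, show ‖(8 : ℂ)‖ = 8 by simp]
  have : ‖-2 + J3‖ ≤ 2 + K := (norm_add_le _ _).trans (by simpa using hJ3)
  rw [← div_div]
  gcongr

end ErrorFunction

end LTaylor

namespace LTaylor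

/-! ### Cauchy's formula on a strip and the Taylor remainder as a line integral. -/

section StripCauchy

open MeasureTheory Set

/-- `f` is `O(|y|⁻²)` on the strip `|x| ≤ 1`. -/
def StripDecay (f : ℂ → ℂ) : Prop :=
  ∃ C Y : ℝ, 0 < Y ∧ ∀ x y : ℝ, |x| ≤ 1 → Y ≤ |y| → ‖f (x + y * I)‖ ≤ C / y ^ 2

lemma exists_le_div_one_add_sq {h : ℝ → ℂ} (hc : Continuous h) {C Y : ℝ} (hY : 0 < Y)
    (hb : ∀ y : ℝ, Y ≤ |y| → ‖h y‖ ≤ C / y ^ 2) :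
    ∃ C' : ℝ, 0 ≤ C' ∧ ∀ y : ℝ, ‖h y‖ ≤ C' * (1 + y ^ 2)⁻¹ := by
  obtain ⟨M, hM⟩ := (isCompact_Icc (a := -Y) (b := Y)).exists_bound_of_continuousOn hc.continuousOn
  have hM0 : 0 ≤ M := (norm_nonneg _).trans (hM 0 ⟨by linarith, hY.le⟩)
  refine ⟨M * (1 + Y ^ 2) + |C| * (1 + Y⁻¹ ^ 2), by positivity, fun y => ?_⟩
  rw [← div_eq_mul_inv, le_div_iff₀ (by positivity)]
  rcases le_total (|y|) Y with h1 | h1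
  · have h2 : y ^ 2 ≤ Y ^ 2 := sq_le_sq' (abs_le.1 h1).1 (abs_le.1 h1).2
    have h3 := hM y (abs_le.1 h1)
    have : ‖h y‖ * (1 + y ^ 2) ≤ M * (1 + Y ^ 2) := by gcongr
    have : 0 ≤ |C| * (1 + Y⁻¹ ^ 2) := by positivity
    linarith
  · have hy0 : y ≠ 0 := abs_pos.1 (hY.trans_le h1)
    have hy : 0 < y ^ 2 := by positivity
    have h2 : ‖h y‖ ≤ |C| / y ^ 2 := (hb y h1).trans (by gcongr; exact le_abs_self C)
    have h3 : ‖h y‖ * (1 + y ^ 2) ≤ |C| / y ^ 2 * (1 + y ^ 2) := by gcongr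
    have h4 : |C| / y ^ 2 * (1 + y ^ 2) = |C| * ((y ^ 2)⁻¹ + 1) := by field_simp
    have h5 : (y ^ 2)⁻¹ ≤ Y⁻¹ ^ 2 := by
      rw [inv_pow, ← sq_abs y]; gcongr
    have h6 : |C| * ((y ^ 2)⁻¹ + 1) ≤ |C| * (1 + Y⁻¹ ^ 2) :=
      mul_le_mul_of_nonneg_left (by linarith) (abs_nonneg C)
    have : 0 ≤ M * (1 + Y ^ 2) := by positivity
    linarith

lemma StripDecay.exists_line_bound {f : ℂ → ℂ} (hf : Continuous f) (h : StripDecay f) {x : ℝ}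
    (hx : |x| ≤ 1) :
    ∃ C : ℝ, 0 ≤ C ∧ ∀ y : ℝ, ‖f (x + y * I)‖ ≤ C * (1 + y ^ 2)⁻¹ := by
  obtain ⟨C, Y, hY, hC⟩ := h
  exact exists_le_div_one_add_sq (by fun_prop) hY (fun y hy => hC x y hx hy)

lemma StripDecay.integrable_mul {f : ℂ → ℂ} (hf : Continuous f) (h : StripDecay f) {x : ℝ}
    (hx : |x| ≤ 1) {k : ℝ → ℂ} (hk : Continuous k) {B : ℝ} (hB : ∀ y, ‖k y‖ ≤ B) :
    Integrable fun y : ℝ => f (x + y * I) * k y := by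
  obtain ⟨C, hC0, hC⟩ := h.exists_line_bound hf hx
  refine Integrable.mono' (integrable_inv_one_add_sq.const_mul (C * B)) ?_ ?_
  · exact Continuous.aestronglyMeasurable (by fun_prop)
  · refine ae_of_all _ fun y => ?_
    rw [norm_mul]
    calc ‖f (x + y * I)‖ * ‖k y‖ ≤ (C * (1 + y ^ 2)⁻¹) * B := by
          gcongr
          · exact hC y
          · exact hB y
      _ = _ := by ring

lemma sub_ne_zero_of_re_ne {x : ℝ} {z : ℂ} (h : z.re ≠ x) (y : ℝ) : (x : ℂ) + y * I - z ≠ 0 := by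
  intro h0
  apply h
  have := congrArg re h0
  simp at this
  linarith

lemma norm_inv_line_sub_le {x : ℝ} {z : ℂ} (h : z.re ≠ x) (y : ℝ) :
    ‖((x : ℂ) + y * I - z)⁻¹‖ ≤ |x - z.re|⁻¹ := by
  rw [norm_inv]
  have : |x - z.re| ≤ ‖(x : ℂ) + y * I - z‖ := by
    simpa using abs_re_le_norm ((x : ℂ) + y * I - z)
  have h2 : 0 < |x - z.re| := abs_pos.2 (sub_ne_zero.2 h.symm)
  gcongr

/-- Cauchy's theorem for a strip, in symmetric-limit form. -/
lemma tendsto_strip_integral {q : ℂ → ℂ} {t : ℝ}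
    (hq : DifferentiableOn ℂ q {s : ℂ | |s.re| ≤ 1}) {C Y : ℝ}
    (hb : ∀ x y : ℝ, |x| ≤ 1 → Y ≤ |y| → ‖q (x + y * I)‖ ≤ C / |y - t|) :
    Tendsto (fun R : ℝ => ∫ y in (-R + t)..(R + t), (q ((1 : ℝ) + y * I) - q ((-1 : ℝ) + y * I))) atTop
      (𝓝 0) := by
  have hb' : ∀ R : ℝ, 0 < R → Y + |t| ≤ R →
      ‖∫ y in (-R + t)..(R + t), (q ((1 : ℝ) + y * I) - q ((-1 : ℝ) + y * I))‖ ≤ 4 * (C / R) := by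
    intro R hR0 hR
    have hrect := integral_boundary_rect_eq_zero_of_differentiableOn q (-1 + ((-R + t : ℝ) : ℂ) * I)
      (1 + ((R + t : ℝ) : ℂ) * I) (hq.mono ?_)
    · simp only [add_re, neg_re, one_re, mul_re, ofReal_re, I_re, mul_zero, ofReal_im, I_im,
        mul_one, sub_self, add_zero, add_im, neg_im, one_im, neg_zero, mul_im, zero_add] at hrect
      have hcont : ∀ x : ℝ, |x| ≤ 1 → IntervalIntegrable (fun y : ℝ => q (x + y * I)) volume
          (-R + t) (R + t) := by
        intro x hx
        apply ContinuousOn.intervalIntegrable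
        refine hq.continuousOn.comp (by fun_prop) fun y _ => ?_
        simpa using hx
      rw [intervalIntegral.integral_sub (hcont 1 (by simp)) (hcont (-1) (by simp))]
      -- The rectangle is centred at height t, so |y - t| = R holds exactly on both horizontal
      -- sides.
      have hh : ∀ y : ℝ, |y - t| = R → ‖∫ x in (-1 : ℝ)..1, q (x + y * I)‖ ≤ 2 * (C / R) := by
        intro y hy
        have : ‖∫ x in (-1 : ℝ)..1, q (x + y * I)‖ ≤ C / R * |1 - (-1)| := by
          apply intervalIntegral.norm_integral_le_of_norm_le_const
          intro x hx
          rw [uIoc_of_le (by norm_num)] at hx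
          rw [← hy]
          refine hb x y (abs_le.2 ⟨hx.1.le, hx.2⟩) ?_
          have := abs_sub_le y 0 t
          simp only [sub_zero, zero_sub, abs_neg] at this
          linarith
        norm_num at this
        linarith
      have h1 := hh (-R + t) (by simp [abs_of_pos hR0])
      have h2 := hh (R + t) (by simp [abs_of_pos hR0])
      have : (∫ y in (-R + t)..(R + t), q ((1 : ℝ) + y * I)) -
          (∫ y in (-R + t)..(R + t), q ((-1 : ℝ) + y * I)) =
          I * ((∫ x in (-1 : ℝ)..1, q (x + ((-R + t : ℝ) : ℂ) * I)) -
            ∫ x in (-1 : ℝ)..1, q (x + ((R + t : ℝ) : ℂ) * I)) := by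
        simp only [smul_eq_mul] at hrect
        push_cast at hrect ⊢
        linear_combination (-I) * hrect + (((∫ y in (-R + t)..(R + t), q (1 + y * I)) -
          (∫ y in (-R + t)..(R + t), q (-1 + y * I)))) * I_mul_I
      rw [this, norm_mul, norm_I, one_mul]
      calc _ ≤ _ := norm_sub_le _ _
        _ ≤ _ := by linarith
    · intro s hs
      have := hs.1
      simp only [add_re, neg_re, one_re, mul_re, ofReal_re, I_re, mul_zero, ofReal_im, I_im,
        mul_one, sub_self, add_zero, mem_preimage] at this
      rw [uIcc_of_le (by norm_num)] at this
      exact abs_le.2 this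
  refine squeeze_zero_norm' (a := fun R : ℝ => 4 * (C / R)) ?_ ?_
  · filter_upwards [eventually_gt_atTop 0, eventually_ge_atTop (Y + |t|)] with R h1 h2
      using hb' R h1 h2
  · simpa using (tendsto_const_nhds.div_atTop tendsto_id).const_mul (4 : ℝ)

/-- A primitive is arctan(u/a) - (i/2) log(a² + u²). The logarithm is even in u and cancels between
symmetric limits. -/
lemma integral_inv_add_mul_I {a : ℝ} (ha : 0 < a) (R : ℝ) :
    ∫ u in (-R)..R, ((a : ℂ) + u * I)⁻¹ = ((2 * Real.arctan (R / a) : ℝ) : ℂ) := by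
  have hne : ∀ u : ℝ, (a : ℂ) + u * I ≠ 0 := by
    intro u h
    have := congrArg re h
    simp at this
    exact ha.ne' this
  have hd : ∀ u : ℝ, HasDerivAt (fun u : ℝ => ((Real.arctan (u / a) : ℝ) : ℂ)
      - I / 2 * ((Real.log (a ^ 2 + u ^ 2) : ℝ) : ℂ)) (((a : ℂ) + u * I)⁻¹) u := by
    intro u
    have h1 : HasDerivAt (fun u : ℝ => Real.arctan (u / a)) (1 / (1 + (u / a) ^ 2) * (1 / a)) u :=
      ((hasDerivAt_id u).div_const a).arctan
    have h2 : HasDerivAt (fun u : ℝ => Real.log (a ^ 2 + u ^ 2)) (2 * u / (a ^ 2 + u ^ 2)) u := by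
      have : HasDerivAt (fun u : ℝ => a ^ 2 + u ^ 2) (2 * u) u := by
        simpa using (hasDerivAt_pow 2 u).const_add (a ^ 2)
      exact this.log (by positivity)
    refine (h1.ofReal_comp.sub (h2.ofReal_comp.const_mul (I / 2))).congr_deriv ?_
    have h3 : ((a : ℂ) ^ 2 + u ^ 2) ≠ 0 := by
      have : (0 : ℝ) < a ^ 2 + u ^ 2 := by positivity
      exact_mod_cast this.ne'
    have h4 : (a : ℂ) ≠ 0 := by exact_mod_cast ha.ne'
    have h5 : (1 + ((u : ℂ) / a) ^ 2) ≠ 0 := by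
      have : (0 : ℝ) < 1 + (u / a) ^ 2 := by positivity
      exact_mod_cast this.ne'
    have h6 := hne u
    push_cast
    apply eq_inv_of_mul_eq_one_left
    have e1 : 1 / (1 + ((u : ℂ) / a) ^ 2) * (1 / a) = a / (a ^ 2 + u ^ 2) := by field_simp
    rw [e1]
    field_simp
    linear_combination (-(u : ℂ)^2) * I_sq
  rw [intervalIntegral.integral_eq_sub_of_hasDerivAt (fun u _ => hd u)]
  · rw [neg_div, Real.arctan_neg, neg_sq]
    push_cast; ring
  · apply Continuous.intervalIntegrable
    exact Continuous.inv₀ (by fun_prop) hne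

lemma tendsto_arctan_div {a : ℝ} (ha : 0 < a) :
    Tendsto (fun R : ℝ => ((2 * Real.arctan (R / a) : ℝ) : ℂ)) atTop (𝓝 (Real.pi : ℂ)) := by
  have h1 : Tendsto (fun R : ℝ => Real.arctan (R / a)) atTop (𝓝 (Real.pi / 2)) :=
    (Real.tendsto_arctan_atTop.mono_right nhdsWithin_le_nhds).comp (tendsto_id.atTop_div_const ha)
  have h2 := (h1.const_mul 2)
  rw [mul_div_cancel₀ _ two_ne_zero] at h2
  exact (continuous_ofReal.tendsto _).comp h2

/-- An explicit computation in place of the residue at z: once f(z) is subtracted from f(s), the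
quotient is entire, and this limit restores the subtracted term. -/
lemma tendsto_kernel_integral {z : ℂ} (hz : |z.re| < 1) :
    Tendsto (fun R : ℝ => ∫ y in (-R + z.im)..(R + z.im),
      ((((1 : ℝ) : ℂ) + y * I - z)⁻¹ - (((-1 : ℝ) : ℂ) + y * I - z)⁻¹)) atTop
      (𝓝 (2 * Real.pi)) := by
  have h1 : 0 < 1 - z.re := by linarith [(abs_lt.1 hz).2]
  have h2 : 0 < 1 + z.re := by linarith [(abs_lt.1 hz).1]
  have hlim := (tendsto_arctan_div h1).add (tendsto_arctan_div h2)
  rw [← two_mul] at hlim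
  refine hlim.congr fun R => ?_
  rw [← integral_inv_add_mul_I h1, ← integral_inv_add_mul_I h2]
  have hi : ∀ x : ℝ, z.re ≠ x →
      Continuous (fun y : ℝ => ((x : ℂ) + y * I - z)⁻¹) := fun x hx =>
    Continuous.inv₀ (by fun_prop) (sub_ne_zero_of_re_ne hx)
  rw [intervalIntegral.integral_sub ((hi 1 (ne_of_lt (by linarith))).intervalIntegrable _ _)
    ((hi (-1) (ne_of_gt (by linarith))).intervalIntegrable _ _)]
  have e1 : ∫ y in (-R + z.im)..(R + z.im), (((1 : ℝ) : ℂ) + y * I - z)⁻¹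
      = ∫ u in (-R)..R, (((1 - z.re : ℝ) : ℂ) + u * I)⁻¹ := by
    rw [← intervalIntegral.integral_comp_add_right (fun y : ℝ => (((1 : ℝ) : ℂ) + y * I - z)⁻¹)]
    refine intervalIntegral.integral_congr fun u _ => congrArg (fun w : ℂ => w⁻¹) ?_
    apply Complex.ext <;> simp
  have e2 : ∫ y in (-R + z.im)..(R + z.im), (((-1 : ℝ) : ℂ) + y * I - z)⁻¹
      = -∫ u in (-R)..R, (((1 + z.re : ℝ) : ℂ) + u * I)⁻¹ := by
    rw [← intervalIntegral.integral_comp_add_right (fun y : ℝ => (((-1 : ℝ) : ℂ) + y * I - z)⁻¹)]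
    have := intervalIntegral.integral_comp_neg (a := -R) (b := R)
      (fun u : ℝ => (((1 + z.re : ℝ) : ℂ) + u * I)⁻¹)
    rw [neg_neg] at this
    rw [← this, ← intervalIntegral.integral_neg]
    refine intervalIntegral.integral_congr fun u _ => ?_
    rw [← inv_neg]
    refine congrArg (fun w : ℂ => w⁻¹) ?_
    apply Complex.ext <;> simp
    ring
  rw [e1, e2, sub_neg_eq_add]

/-- Cauchy's formula for a strip. -/
lemma strip_cauchy {f : ℂ → ℂ} (hf : Differentiable ℂ f) (hd : StripDecay f) {z : ℂ}
    (hz : |z.re| ≠ 1) :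
    ∫ y : ℝ, (f ((1 : ℝ) + y * I) * (((1 : ℝ) : ℂ) + y * I - z)⁻¹
      - f ((-1 : ℝ) + y * I) * (((-1 : ℝ) : ℂ) + y * I - z)⁻¹) = 2 * Real.pi * (chi z * f z) := by
  have hz1 : z.re ≠ 1 := by rintro h; simp [h] at hz
  have hz2 : z.re ≠ -1 := by rintro h; simp [h] at hz
  have hk : ∀ x : ℝ, z.re ≠ x →
      Continuous (fun y : ℝ => ((x : ℂ) + y * I - z)⁻¹) := fun x hx =>
    Continuous.inv₀ (by fun_prop) (sub_ne_zero_of_re_ne hx)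
  have hint : ∀ x : ℝ, |x| ≤ 1 → z.re ≠ x →
      Integrable (fun y : ℝ => f (x + y * I) * ((x : ℂ) + y * I - z)⁻¹) := fun x hx hzx =>
    hd.integrable_mul hf.continuous hx (hk x hzx) (norm_inv_line_sub_le hzx)
  have hI := (hint 1 (by simp) hz1).sub (hint (-1) (by simp) hz2)
  have hlim := intervalIntegral_tendsto_integral (a := fun R : ℝ => -R + z.im)
    (b := fun R : ℝ => R + z.im) (l := atTop) hI
    (tendsto_atBot_add_const_right _ _ tendsto_neg_atTop_atBot)
    (tendsto_atTop_add_const_right _ _ tendsto_id)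
  refine tendsto_nhds_unique hlim ?_
  obtain ⟨C, Y, hY, hC⟩ := hd
  -- Used with v = f z when z lies in the strip, where the difference quotient is needed, and with v
  -- = 0 when z lies outside and the integrand is already holomorphic.
  have hbd : ∀ v : ℂ, ∀ x y : ℝ, |x| ≤ 1 → max Y (|z.im| + 1) ≤ |y| →
      ‖(f (x + y * I) - v) * ((x : ℂ) + y * I - z)⁻¹‖ ≤ (|C| / Y ^ 2 + ‖v‖) / |y - z.im| := by
    intro v x y hx hy
    have hy1 := (le_max_left _ _).trans hy
    have hy2 := (le_max_right _ _).trans hy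
    rw [norm_mul, norm_inv, div_eq_mul_inv]
    have h1 : |y - z.im| ≤ ‖(x : ℂ) + y * I - z‖ := by
      simpa using abs_im_le_norm ((x : ℂ) + y * I - z)
    have h2 : 0 < |y - z.im| := by
      have := abs_sub_abs_le_abs_sub y z.im
      linarith
    have h3 : ‖f (x + y * I)‖ ≤ |C| / Y ^ 2 := by
      refine (hC x y hx hy1).trans ?_
      rw [← sq_abs y]
      gcongr
      exact le_abs_self C
    gcongr
    exact (norm_sub_le _ _).trans (by gcongr)
  by_cases hin : |z.re| < 1
  · have hchi : chi z = 1 := by simp [chi, hin]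
    rw [hchi, one_mul]
    have hq : DifferentiableOn ℂ (dslope f z) {s : ℂ | |s.re| ≤ 1} :=
      ((differentiableOn_dslope (univ_mem)).2 hf.differentiableOn).mono (subset_univ _)
    have hqv : ∀ x y : ℝ, z.re ≠ x →
        dslope f z (x + y * I) = (f (x + y * I) - f z) * ((x : ℂ) + y * I - z)⁻¹ := by
      intro x y hx
      rw [dslope_of_ne, slope_def_field, div_eq_mul_inv]
      exact sub_ne_zero.1 (sub_ne_zero_of_re_ne hx y)
    have hq0 := tendsto_strip_integral (t := z.im) hq (C := |C| / Y ^ 2 + ‖f z‖)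
      (Y := max Y (|z.im| + 1)) ?_
    · have := hq0.add ((tendsto_kernel_integral hin).mul_const (f z))
      rw [zero_add] at this
      refine this.congr fun R => ?_
      rw [← intervalIntegral.integral_mul_const, ← intervalIntegral.integral_add]
      · congr 1; ext y
        rw [hqv 1 y hz1, hqv (-1) y hz2]
        simp only [Pi.sub_apply]
        ring
      · apply Continuous.intervalIntegrable
        have hqc : Continuous (dslope f z) := by
          rw [← continuousOn_univ]
          exact ((differentiableOn_dslope (univ_mem)).2 hf.differentiableOn).continuousOn
        fun_prop
      · exact (((hk 1 hz1).sub (hk (-1) hz2)).mul_const _).intervalIntegrable _ _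
    · intro x y hx hy
      have hne : (x : ℂ) + y * I ≠ z := by
        rintro rfl
        have := (le_max_right _ _).trans hy
        simp at this
        linarith
      rw [dslope_of_ne _ hne, slope_def_field, div_eq_mul_inv]
      exact hbd (f z) x y hx hy
  · have hchi : chi z = 0 := by simp [chi, hin]
    rw [hchi, zero_mul, mul_zero]
    have hq := tendsto_strip_integral (t := z.im) (q := fun s => (f s - 0) * (s - z)⁻¹)
      (C := |C| / Y ^ 2 + ‖(0 : ℂ)‖) (Y := max Y (|z.im| + 1)) ?_ ?_
    · simpa using hq
    · intro s hs
      have hne : s - z ≠ 0 := by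
        intro h
        rw [sub_eq_zero.1 h] at hs
        exact hin (lt_of_le_of_ne hs hz)
      exact ((hf.differentiableAt.sub_const _).mul
        ((differentiableAt_id.sub_const z).inv hne)).differentiableWithinAt
    · exact hbd 0

/-- The point `1 + iy`. -/
noncomputable def linePt (y : ℝ) : ℂ := 1 + y * I

lemma linePt_re (y : ℝ) : (linePt y).re = 1 := by simp [linePt]

lemma linePt_im (y : ℝ) : (linePt y).im = y := by simp [linePt]

lemma linePt_ne_zero (y : ℝ) : linePt y ≠ 0 := fun h => by
  have := congrArg re h; simp [linePt_re] at this

lemma one_le_norm_linePt (y : ℝ) : 1 ≤ ‖linePt y‖ := by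
  simpa [linePt_re] using abs_re_le_norm (linePt y)

@[fun_prop]
lemma continuous_linePt : Continuous linePt := by unfold linePt; fun_prop

lemma linePt_sub_ne_zero {z : ℂ} (hz : |z.re| ≠ 1) (y : ℝ) : linePt y - z ≠ 0 := fun h => by
  have := congrArg re h
  simp [linePt_re] at this
  apply hz; rw [show z.re = 1 by linarith]; simp

lemma linePt_add_ne_zero {z : ℂ} (hz : |z.re| ≠ 1) (y : ℝ) : linePt y + z ≠ 0 := by
  have := linePt_sub_ne_zero (z := -z) (by simpa using hz) y
  simpa using this

/-- The distance of `z` from the pair of lines `|Re z| = 1`. -/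
noncomputable def lineDist (z : ℂ) : ℝ := abs (1 - |z.re|)

lemma lineDist_pos {z : ℂ} (hz : |z.re| ≠ 1) : 0 < lineDist z :=
  abs_pos.2 (sub_ne_zero.2 hz.symm)

lemma lineDist_neg (z : ℂ) : lineDist (-z) = lineDist z := by simp [lineDist]

lemma abs_re_sub_one_le_norm_sub (z : ℂ) (y : ℝ) : lineDist z ≤ ‖linePt y - z‖ := by
  refine le_trans ?_ (abs_re_le_norm _)
  simp only [sub_re, linePt_re, lineDist]
  simpa using abs_abs_sub_abs_le (1 : ℝ) z.re

lemma norm_inv_linePt_sub_le {z : ℂ} (hz : |z.re| ≠ 1) (y : ℝ) :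
    ‖(linePt y - z)⁻¹‖ ≤ (lineDist z)⁻¹ := by
  rw [norm_inv]
  have := lineDist_pos hz
  gcongr
  exact abs_re_sub_one_le_norm_sub z y

lemma norm_inv_linePt_add_le {z : ℂ} (hz : |z.re| ≠ 1) (y : ℝ) :
    ‖(linePt y + z)⁻¹‖ ≤ (lineDist z)⁻¹ := by
  have := norm_inv_linePt_sub_le (z := -z) (by simpa using hz) y
  rwa [sub_neg_eq_add, lineDist_neg] at this

lemma StripDecay.integrable_linePt_mul {f : ℂ → ℂ} (hf : Continuous f) (h : StripDecay f)
    {k : ℝ → ℂ} (hk : Continuous k) {B : ℝ} (hB : ∀ y, ‖k y‖ ≤ B) :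
    Integrable fun y : ℝ => f (linePt y) * k y := by
  have := h.integrable_mul hf (x := 1) (by simp) hk hB
  simpa [linePt] using this

/-- Cauchy's formula for an even function on a strip. -/
lemma even_strip_cauchy {f : ℂ → ℂ} (hf : Differentiable ℂ f) (hd : StripDecay f)
    (heven : ∀ z, f (-z) = f z) {z : ℂ} (hz : |z.re| ≠ 1) :
    ∫ y : ℝ, f (linePt y) * ((linePt y - z)⁻¹ + (linePt y + z)⁻¹)
      = 2 * Real.pi * (chi z * f z) := by
  have hz1 : z.re ≠ 1 := by rintro h; simp [h] at hz
  have hz2 : z.re ≠ -1 := by rintro h; simp [h] at hz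
  have hi1 : Integrable fun y : ℝ => f (linePt y) * (linePt y - z)⁻¹ :=
    hd.integrable_linePt_mul hf.continuous
      (Continuous.inv₀ (by fun_prop) (linePt_sub_ne_zero hz)) (norm_inv_linePt_sub_le hz)
  have hi2 : Integrable fun y : ℝ => f (linePt y) * (linePt y + z)⁻¹ :=
    hd.integrable_linePt_mul hf.continuous
      (Continuous.inv₀ (by fun_prop) (linePt_add_ne_zero hz)) (norm_inv_linePt_add_le hz)
  have hneg : ∀ y : ℝ, f ((-1 : ℝ) + (-y : ℝ) * I) * (((-1 : ℝ) : ℂ) + (-y : ℝ) * I - z)⁻¹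
      = -(f (linePt y) * (linePt y + z)⁻¹) := by
    intro y
    rw [show (((-1 : ℝ) : ℂ) + (-y : ℝ) * I - z) = -(linePt y + z) by
      simp only [linePt]; push_cast; ring, show (((-1 : ℝ) : ℂ) + (-y : ℝ) * I) = -(linePt y) by
      simp only [linePt]; push_cast; ring, heven, inv_neg]
    ring
  have hi3 : Integrable fun y : ℝ =>
      f ((-1 : ℝ) + y * I) * (((-1 : ℝ) : ℂ) + y * I - z)⁻¹ := by
    have := hi2.neg.comp_neg
    refine this.congr (ae_of_all _ fun y => ?_)
    have := hneg (-y)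
    rw [neg_neg] at this
    simp only [Pi.neg_apply, this]
  rw [← strip_cauchy hf hd hz]
  rw [integral_sub (by simpa [linePt] using hi1) hi3]
  rw [← integral_neg_eq_self (fun y : ℝ => f ((-1 : ℝ) + y * I) *
    (((-1 : ℝ) : ℂ) + y * I - z)⁻¹)]
  simp_rw [hneg, mul_add]
  rw [integral_add hi1 hi2, integral_neg, sub_neg_eq_add]
  simp [linePt]

/-- The coefficients of the expansion of the Cauchy integral of `f` over `|Re s| = 1`. -/
noncomputable def lineCoeff (f : ℂ → ℂ) (k : ℕ) : ℂ :=
  1 / (2 * Real.pi) *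
    ∫ y : ℝ, f (linePt y) * ((linePt y)⁻¹ ^ (k + 1) - (-linePt y)⁻¹ ^ (k + 1))

lemma norm_inv_linePt_le (y : ℝ) : ‖(linePt y)⁻¹‖ ≤ 1 := by
  rw [norm_inv]; exact inv_le_one_of_one_le₀ (one_le_norm_linePt y)

lemma norm_lineCoeff_kernel_le (k : ℕ) (y : ℝ) :
    ‖(linePt y)⁻¹ ^ (k + 1) - (-linePt y)⁻¹ ^ (k + 1)‖ ≤ 2 := by
  refine (norm_sub_le _ _).trans ?_
  rw [norm_pow, norm_pow, inv_neg, norm_neg]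
  have := pow_le_one₀ (n := k + 1) (norm_nonneg _) (norm_inv_linePt_le y)
  linarith

@[fun_prop]
lemma continuous_inv_linePt : Continuous fun y : ℝ => (linePt y)⁻¹ :=
  Continuous.inv₀ (by fun_prop) linePt_ne_zero

@[fun_prop]
lemma continuous_inv_neg_linePt : Continuous fun y : ℝ => (-linePt y)⁻¹ :=
  Continuous.inv₀ (by fun_prop) fun y => neg_ne_zero.2 (linePt_ne_zero y)

lemma hasSum_geometric_inv {s z : ℂ} (hs : ‖z‖ < ‖s‖) :
    HasSum (fun k : ℕ => z ^ k * s⁻¹ ^ (k + 1)) (s - z)⁻¹ := by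
  have hs0 : s ≠ 0 := by
    rintro rfl
    simp only [norm_zero] at hs
    linarith [norm_nonneg z]
  have h : ‖z / s‖ < 1 := by
    rw [norm_div, div_lt_one (norm_pos_iff.2 hs0)]; exact hs
  have := (hasSum_geometric_of_norm_lt_one h).mul_right s⁻¹
  have e1 : (fun k : ℕ => z ^ k * s⁻¹ ^ (k + 1)) = fun k : ℕ => (z / s) ^ k * s⁻¹ := by
    ext k; rw [div_eq_mul_inv, mul_pow, pow_succ]; ring
  have e2 : (s - z)⁻¹ = (1 - z / s)⁻¹ * s⁻¹ := by
    rw [← mul_inv]; congr 1; field_simp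
  rw [e1, e2]
  exact this

/-- On the line |s| ≥ 1, so for |z| < 1 the geometric series of the kernel may be integrated term by
term. Uniqueness of power series then identifies the line integrals with the Taylor coefficients,
without shifting contours for each of them. -/
lemma hasSum_lineCoeff {f : ℂ → ℂ} (hf : Differentiable ℂ f) (hd : StripDecay f)
    (heven : ∀ z, f (-z) = f z) {z : ℂ} (hz : ‖z‖ < 1) :
    HasSum (fun k => z ^ k * lineCoeff f k) (f z) := by
  have hre : |z.re| < 1 := (abs_re_le_norm z).trans_lt hz
  have hcau := even_strip_cauchy hf hd heven hre.ne
  have hchi : chi z = 1 := by simp [chi, hre]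
  rw [hchi, one_mul] at hcau
  set G : ℕ → ℝ → ℂ := fun k y =>
    f (linePt y) * (z ^ k * ((linePt y)⁻¹ ^ (k + 1) - (-linePt y)⁻¹ ^ (k + 1))) with hG
  have hkb : ∀ (k : ℕ) (y : ℝ),
      ‖z ^ k * ((linePt y)⁻¹ ^ (k + 1) - (-linePt y)⁻¹ ^ (k + 1))‖ ≤ ‖z‖ ^ k * 2 := by
    intro k y
    rw [norm_mul, norm_pow]
    gcongr
    exact norm_lineCoeff_kernel_le k y
  have hint : ∀ k, Integrable (G k) := fun k =>
    hd.integrable_linePt_mul hf.continuous (by fun_prop) (hkb k)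
  have hint1 : Integrable fun y : ℝ => f (linePt y) * 1 :=
    hd.integrable_linePt_mul hf.continuous (by fun_prop) (B := 1) (by simp)
  have hsum : Summable fun k => ∫ y, ‖G k y‖ := by
    refine Summable.of_nonneg_of_le (fun k => integral_nonneg fun _ => norm_nonneg _)
      (fun k => ?_)
      ((summable_geometric_of_lt_one (norm_nonneg z) hz).mul_right (2 * ∫ y, ‖f (linePt y) * 1‖))
    rw [← mul_assoc, ← integral_const_mul]
    refine integral_mono (hint k).norm (hint1.norm.const_mul _) fun y => ?_
    simp only [hG, mul_one]
    rw [norm_mul, mul_comm]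
    gcongr
    exact hkb k y
  have hS := hasSum_integral_of_summable_integral_norm hint hsum
  have htsum : ∀ y, ∑' k, G k y = f (linePt y) * ((linePt y - z)⁻¹ + (linePt y + z)⁻¹) := by
    intro y
    have h1 : ‖z‖ < ‖linePt y‖ := hz.trans_le (one_le_norm_linePt y)
    have h2 := (hasSum_geometric_inv h1).sub (hasSum_geometric_inv (s := -linePt y) (z := z)
      (by rwa [norm_neg]))
    have h3 := h2.mul_left (f (linePt y))
    rw [show (-linePt y - z) = -(linePt y + z) by ring, inv_neg (a := linePt y + z),
      sub_neg_eq_add] at h3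
    rw [← h3.tsum_eq]
    refine tsum_congr fun k => ?_
    simp only [hG]; ring
  simp_rw [htsum] at hS
  rw [hcau] at hS
  have := hS.mul_left (1 / (2 * Real.pi) : ℂ)
  have hpi : (Real.pi : ℂ) ≠ 0 := by exact_mod_cast Real.pi_ne_zero
  rw [← mul_assoc, one_div, inv_mul_cancel₀ (by simp [hpi]), one_mul] at this
  refine this.congr_fun fun k => ?_
  simp only [hG, lineCoeff]
  rw [← mul_assoc, mul_comm (z ^ k), mul_assoc, one_div, ← integral_const_mul]
  congr 2; ext y; ring

lemma lineCoeff_eq {f : ℂ → ℂ} (hf : Differentiable ℂ f) (hd : StripDecay f)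
    (heven : ∀ z, f (-z) = f z) (k : ℕ) :
    lineCoeff f k = iteratedDeriv k f 0 / (k.factorial : ℂ) := by
  have h1 := (hf.analyticAt 0).hasFPowerSeriesAt
  have h2 : HasFPowerSeriesAt f (FormalMultilinearSeries.ofScalars ℂ (lineCoeff f)) 0 := by
    rw [hasFPowerSeriesAt_iff]
    filter_upwards [Metric.ball_mem_nhds (0 : ℂ) one_pos] with z hz
    have := hasSum_lineCoeff hf hd heven (mem_ball_zero_iff.1 hz)
    simpa using this
  have := h2.eq_formalMultilinearSeries h1
  have := congrArg (fun p : FormalMultilinearSeries ℂ ℂ ℂ => p.coeff k) this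
  simpa using this

/-- A geometric sum with exact remainder: inserted in Cauchy's formula, it turns the truncated
series into the Taylor remainder. -/
lemma pow_mul_inv_sub (m : ℕ) {s z : ℂ} (hs : s ≠ 0) (hsz : s - z ≠ 0) :
    z ^ m * (s⁻¹ ^ m * (s - z)⁻¹)
      = (s - z)⁻¹ - ∑ k ∈ Finset.range m, z ^ k * s⁻¹ ^ (k + 1) := by
  induction m with
  | zero => simp
  | succ m ih =>
    rw [Finset.sum_range_succ, ← sub_sub, ← ih]
    have h1 : s * s⁻¹ = 1 := mul_inv_cancel₀ hs
    have h2 : (s - z) * (s - z)⁻¹ = 1 := mul_inv_cancel₀ hsz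
    linear_combination z ^ m * s⁻¹ ^ m * (s - z)⁻¹ * h1 - z ^ m * s⁻¹ ^ m * s⁻¹ * h2

/-- The Cauchy transform of `f(s) / s^m` along `|Re s| = 1`, for even `f` and `m`. -/
noncomputable def lineTransform (f : ℂ → ℂ) (m : ℕ) (z : ℂ) : ℂ :=
  1 / (2 * Real.pi) *
    ∫ y : ℝ, f (linePt y) * ((linePt y)⁻¹ ^ m * ((linePt y - z)⁻¹ + (linePt y + z)⁻¹))

/-- The remainder of a Taylor polynomial as a Cauchy transform along `|Re s| = 1`. -/
theorem pow_mul_lineTransform {f : ℂ → ℂ} (hf : Differentiable ℂ f) (hd : StripDecay f)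
    (heven : ∀ z, f (-z) = f z) {n : ℕ} (hn : n ≠ 0) {z : ℂ} (hz : |z.re| ≠ 1) :
    z ^ (2 * n) * lineTransform f (2 * n) z = chi z * f z - taylorPoly f (2 * n - 1) z := by
  have hpi : (Real.pi : ℂ) ≠ 0 := by exact_mod_cast Real.pi_ne_zero
  have hT : taylorPoly f (2 * n - 1) z = ∑ k ∈ Finset.range (2 * n), lineCoeff f k * z ^ k := by
    rw [taylorPoly, Nat.sub_add_cancel (by omega)]
    exact Finset.sum_congr rfl fun k _ => by rw [lineCoeff_eq hf hd heven]
  have hC : chi z * f z = 1 / (2 * Real.pi) *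
      ∫ y : ℝ, f (linePt y) * ((linePt y - z)⁻¹ + (linePt y + z)⁻¹) := by
    rw [even_strip_cauchy hf hd heven hz]; field_simp
  have hi0 : Integrable fun y : ℝ => f (linePt y) * ((linePt y - z)⁻¹ + (linePt y + z)⁻¹) :=
    hd.integrable_linePt_mul hf.continuous
      ((Continuous.inv₀ (by fun_prop) (linePt_sub_ne_zero hz)).add
        (Continuous.inv₀ (by fun_prop) (linePt_add_ne_zero hz)))
      (fun y => (norm_add_le _ _).trans
        (add_le_add (norm_inv_linePt_sub_le hz y) (norm_inv_linePt_add_le hz y)))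
  have hik : ∀ k ∈ Finset.range (2 * n), Integrable fun y : ℝ =>
      f (linePt y) * ((linePt y)⁻¹ ^ (k + 1) - (-linePt y)⁻¹ ^ (k + 1)) * z ^ k := fun k _ =>
    (hd.integrable_linePt_mul hf.continuous (by fun_prop) (norm_lineCoeff_kernel_le k)).mul_const _
  have hpt : ∀ y : ℝ, z ^ (2 * n) *
      (f (linePt y) * ((linePt y)⁻¹ ^ (2 * n) * ((linePt y - z)⁻¹ + (linePt y + z)⁻¹)))
      = f (linePt y) * ((linePt y - z)⁻¹ + (linePt y + z)⁻¹)
        - ∑ k ∈ Finset.range (2 * n),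
          f (linePt y) * ((linePt y)⁻¹ ^ (k + 1) - (-linePt y)⁻¹ ^ (k + 1)) * z ^ k := by
    intro y
    have h1 := pow_mul_inv_sub (2 * n) (linePt_ne_zero y) (linePt_sub_ne_zero hz y)
    have h2 := pow_mul_inv_sub (2 * n) (z := z) (neg_ne_zero.2 (linePt_ne_zero y)) (by
      rw [show -linePt y - z = -(linePt y + z) by ring]
      exact neg_ne_zero.2 (linePt_add_ne_zero hz y))
    rw [show -linePt y - z = -(linePt y + z) by ring, inv_neg (a := linePt y + z)] at h2
    -- Here the even exponent matters: the two lines carry the same density, so their kernels can be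
    -- added.
    have h3 : (-linePt y)⁻¹ ^ (2 * n) = (linePt y)⁻¹ ^ (2 * n) := by
      rw [inv_neg, Even.neg_pow (even_two_mul n)]
    rw [h3] at h2
    have h4 : ∑ k ∈ Finset.range (2 * n),
          f (linePt y) * ((linePt y)⁻¹ ^ (k + 1) - (-linePt y)⁻¹ ^ (k + 1)) * z ^ k
        = f (linePt y) * (∑ k ∈ Finset.range (2 * n), z ^ k * (linePt y)⁻¹ ^ (k + 1)
          - ∑ k ∈ Finset.range (2 * n), z ^ k * (-linePt y)⁻¹ ^ (k + 1)) := by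
      rw [← Finset.sum_sub_distrib, Finset.mul_sum]
      exact Finset.sum_congr rfl fun k _ => by ring
    rw [h4]
    linear_combination f (linePt y) * h1 - f (linePt y) * h2
  rw [lineTransform, ← mul_assoc, mul_comm (z ^ (2 * n)), mul_assoc, ← integral_const_mul]
  simp_rw [hpt]
  rw [integral_sub hi0 (integrable_finsetSum _ hik), integral_finsetSum _ hik, mul_sub, ← hC, hT,
    Finset.mul_sum]
  congr 1
  refine Finset.sum_congr rfl fun k _ => ?_
  rw [integral_mul_const, lineCoeff, mul_assoc]

lemma norm_kernel_le {z z' : ℂ} {ρ : ℝ} (hρ : 0 < ρ) (h : ρ ≤ lineDist z') (hz : ‖z - z'‖ ≤ ρ / 2) (y : ℝ) :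
    ‖(linePt y - z)⁻¹ + (linePt y + z)⁻¹‖ ≤ 4 / ρ := by
  have h1 := (h.trans (abs_re_sub_one_le_norm_sub z' y))
  have h2 := (h.trans (by simpa [lineDist_neg] using abs_re_sub_one_le_norm_sub (-z') y))
  have h3 : ρ / 2 ≤ ‖linePt y - z‖ := by
    have := norm_sub_norm_le (linePt y - z') (z - z')
    rw [sub_sub_sub_cancel_right] at this
    linarith
  have h4 : ρ / 2 ≤ ‖linePt y + z‖ := by
    have := norm_sub_norm_le (linePt y + z') (z' - z)
    rw [show linePt y + z' - (z' - z) = linePt y + z by ring, norm_sub_rev z' z] at this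
    linarith
  refine (norm_add_le _ _).trans ?_
  rw [norm_inv, norm_inv]
  have e1 : ‖linePt y - z‖⁻¹ ≤ (ρ / 2)⁻¹ := by gcongr
  have e2 : ‖linePt y + z‖⁻¹ ≤ (ρ / 2)⁻¹ := by gcongr
  calc _ ≤ (ρ / 2)⁻¹ + (ρ / 2)⁻¹ := add_le_add e1 e2
    _ = _ := by field_simp; ring

lemma continuousAt_lineTransform {f : ℂ → ℂ} (hf : Continuous f) (hd : StripDecay f) (m : ℕ)
    {z : ℂ} (hz : |z.re| ≠ 1) : ContinuousAt (lineTransform f m) z := by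
  have hρ := lineDist_pos hz
  obtain ⟨C, hC0, hC⟩ := hd.exists_line_bound hf (x := 1) (by simp)
  refine ContinuousAt.const_mul ?_ _
  have hopen : ∀ᶠ z' in 𝓝 z, |z'.re| ≠ 1 :=
    (continuous_abs.comp continuous_re).continuousAt.eventually_ne hz
  refine continuousAt_of_dominated (bound := fun y => C * (1 + y ^ 2)⁻¹ * (4 / lineDist z)) ?_ ?_
    ((integrable_inv_one_add_sq.const_mul C).mul_const _) ?_
  · filter_upwards [hopen] with z' hz'
    refine Continuous.aestronglyMeasurable ?_
    have h1 := Continuous.inv₀ (f := fun y => linePt y - z') (by fun_prop) (linePt_sub_ne_zero hz')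
    have h2 := Continuous.inv₀ (f := fun y => linePt y + z') (by fun_prop) (linePt_add_ne_zero hz')
    exact (hf.comp continuous_linePt).mul ((continuous_inv_linePt.pow m).mul (h1.add h2))
  · filter_upwards [Metric.closedBall_mem_nhds z (half_pos hρ)] with z' hz'
    refine ae_of_all _ fun y => ?_
    rw [norm_mul, norm_mul, norm_pow]
    have h1 := hC y
    have h2 := norm_kernel_le hρ le_rfl (mem_closedBall_iff_norm.1 hz') y
    have h3 := pow_le_one₀ (n := m) (norm_nonneg _) (norm_inv_linePt_le y)
    have h4 : (((1 : ℝ) : ℂ) + y * I) = linePt y := by simp [linePt]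
    rw [h4] at h1
    gcongr
    exact (mul_le_of_le_one_left (norm_nonneg _) h3).trans h2
  · refine ae_of_all _ fun y => ?_
    have h1 : ContinuousAt (fun z' => (linePt y - z')⁻¹) z :=
      ContinuousAt.inv₀ (by fun_prop) (linePt_sub_ne_zero hz y)
    have h2 : ContinuousAt (fun z' => (linePt y + z')⁻¹) z :=
      ContinuousAt.inv₀ (by fun_prop) (linePt_add_ne_zero hz y)
    fun_prop

@[fun_prop]
lemma differentiable_taylorPoly (f : ℂ → ℂ) (m : ℕ) : Differentiable ℂ (taylorPoly f m) := by
  unfold taylorPoly; fun_prop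

lemma isOpen_re_ne_one : IsOpen {z : ℂ | |z.re| ≠ 1} :=
  isOpen_ne.preimage (continuous_abs.comp continuous_re)

lemma differentiableAt_chi_mul {f : ℂ → ℂ} (hf : Differentiable ℂ f) {z : ℂ} (hz : |z.re| ≠ 1) :
    DifferentiableAt ℂ (fun z => chi z * f z) z := by
  rcases lt_or_gt_of_ne hz with h | h
  · have : ∀ᶠ z' in 𝓝 z, |z'.re| < 1 :=
      (continuous_abs.comp continuous_re).continuousAt.eventually_lt continuousAt_const h
    refine (hf z).congr_of_eventuallyEq ?_
    filter_upwards [this] with z' hz'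
    simp [chi, hz']
  · have : ∀ᶠ z' in 𝓝 z, 1 < |z'.re| :=
      (continuousAt_const (y := (1 : ℝ))).eventually_lt
        (continuous_abs.comp continuous_re).continuousAt h
    refine (differentiableAt_const (0 : ℂ)).congr_of_eventuallyEq ?_
    filter_upwards [this] with z' hz'
    simp [chi, hz'.not_gt]

/-- Away from 0 the remainder formula can be divided by z^{2n}. At 0 the transform is continuous, so
the singularity is removable. -/
lemma differentiableOn_lineTransform {f : ℂ → ℂ} (hf : Differentiable ℂ f) (hd : StripDecay f)
    (heven : ∀ z, f (-z) = f z) {n : ℕ} (hn : n ≠ 0) :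
    DifferentiableOn ℂ (lineTransform f (2 * n)) {z : ℂ | |z.re| ≠ 1} := by
  have h0 : {z : ℂ | |z.re| ≠ 1} ∈ 𝓝 (0 : ℂ) := isOpen_re_ne_one.mem_nhds (by simp)
  rw [← differentiableOn_compl_singleton_and_continuousAt_iff h0]
  refine ⟨fun z hz => ?_, continuousAt_lineTransform hf.continuous hd _ (by simp)⟩
  have hz0 : z ≠ 0 := hz.2
  have : DifferentiableAt ℂ
      (fun z => (chi z * f z - taylorPoly f (2 * n - 1) z) / z ^ (2 * n)) z :=
    ((differentiableAt_chi_mul hf hz.1).sub (differentiable_taylorPoly f _ z)).div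
      (by fun_prop) (pow_ne_zero _ hz0)
  refine (this.congr_of_eventuallyEq ?_).differentiableWithinAt
  filter_upwards [isOpen_re_ne_one.mem_nhds hz.1, isOpen_ne.mem_nhds hz0] with z' h1 h2
  rw [← pow_mul_lineTransform hf hd heven hn h1, mul_div_cancel_left₀ _ (pow_ne_zero _ h2)]

end StripCauchy

end LTaylor

namespace LTaylor

/-! ### The phase near the saddle point and its square root. -/

section LocalPhase

open Metric Set

/-- A holomorphic function near `1` whose Taylor expansion there is close to `-(z - 1)²`. -/
structure LocalPhase (φ : ℂ → ℂ) : Prop where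
  diff : DifferentiableOn ℂ φ (ball 1 (1 / 100))
  at_one : φ 1 = 0
  deriv_one : deriv φ 1 = 0
  near : ∀ z ∈ ball (1 : ℂ) (1 / 100), ‖deriv (deriv φ) z + 2‖ ≤ 1 / 20
  im_eq : (iteratedDeriv 2 φ 1).im = 0

lemma one_mem_ball_one : (1 : ℂ) ∈ ball (1 : ℂ) (1 / 100) := mem_ball_self (by norm_num)

/-- The quotient of `φ` by `(z - 1)²`. -/
noncomputable def phaseQuot (φ : ℂ → ℂ) : ℂ → ℂ := dslope (dslope φ 1) 1

namespace LocalPhase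

variable {φ : ℂ → ℂ} (h : LocalPhase φ)
include h

lemma differentiableAt {z : ℂ} (hz : z ∈ ball (1 : ℂ) (1 / 100)) : DifferentiableAt ℂ φ z :=
  h.diff.differentiableAt (isOpen_ball.mem_nhds hz)

lemma diff_deriv : DifferentiableOn ℂ (deriv φ) (ball 1 (1 / 100)) := h.diff.deriv isOpen_ball

lemma norm_deriv_add_le {z : ℂ} (hz : z ∈ ball (1 : ℂ) (1 / 100)) :
    ‖deriv φ z + 2 * (z - 1)‖ ≤ 1 / 20 * ‖z - 1‖ := by
  have hd : ∀ x ∈ ball (1 : ℂ) (1 / 100), HasDerivWithinAt (fun z => deriv φ z + 2 * (z - 1))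
      (deriv (deriv φ) x + 2) (ball 1 (1 / 100)) x := by
    intro x hx
    have h1 := (h.diff_deriv.differentiableAt (isOpen_ball.mem_nhds hx)).hasDerivAt
    have h2 : HasDerivAt (fun z : ℂ => 2 * (z - 1)) 2 x := by
      simpa using ((hasDerivAt_id x).sub_const 1).const_mul 2
    exact (h1.add h2).hasDerivWithinAt
  have := (convex_ball (1 : ℂ) (1 / 100)).norm_image_sub_le_of_norm_hasDerivWithin_le hd h.near
    one_mem_ball_one hz
  simpa [h.deriv_one] using this

lemma norm_add_sq_le {z : ℂ} (hz : z ∈ ball (1 : ℂ) (1 / 100)) :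
    ‖φ z + (z - 1) ^ 2‖ ≤ 1 / 20 * ‖z - 1‖ ^ 2 := by
  -- On the ball of radius ‖z - 1‖ the derivative is bounded by a multiple of ‖z - 1‖, so the mean
  -- value inequality yields the square.
  have hsub : closedBall (1 : ℂ) ‖z - 1‖ ⊆ ball (1 : ℂ) (1 / 100) :=
    closedBall_subset_ball (mem_ball_iff_norm.1 hz)
  have hd : ∀ x ∈ closedBall (1 : ℂ) ‖z - 1‖, HasDerivWithinAt (fun z => φ z + (z - 1) ^ 2)
      (deriv φ x + 2 * (x - 1)) (closedBall (1 : ℂ) ‖z - 1‖) x := by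
    intro x hx
    have h1 := (h.differentiableAt (hsub hx)).hasDerivAt
    have h2 : HasDerivAt (fun z : ℂ => (z - 1) ^ 2) (2 * (x - 1)) x := by
      simpa using ((hasDerivAt_id x).sub_const 1).fun_pow 2
    exact (h1.add h2).hasDerivWithinAt
  have := (convex_closedBall (1 : ℂ) ‖z - 1‖).norm_image_sub_le_of_norm_hasDerivWithin_le hd
    (C := 1 / 20 * ‖z - 1‖) (fun x hx => (h.norm_deriv_add_le (hsub hx)).trans (by
      gcongr; exact mem_closedBall_iff_norm.1 hx))
    (mem_closedBall_self (norm_nonneg _)) (y := z) (mem_closedBall_iff_norm.2 le_rfl)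
  simp only [h.at_one, sub_self, zero_add, ne_eq, OfNat.ofNat_ne_zero, not_false_eq_true,
    zero_pow, sub_zero] at this
  calc _ ≤ _ := this
    _ = _ := by ring

lemma eq_sq_mul_phaseQuot (z : ℂ) : φ z = (z - 1) ^ 2 * phaseQuot φ z := by
  have h1 := sub_smul_dslope φ 1 z
  have h2 := sub_smul_dslope (dslope φ 1) 1 z
  rw [dslope_same, h.deriv_one, sub_zero] at h2
  rw [h.at_one, sub_zero, ← h2] at h1
  rw [← h1, phaseQuot]; simp only [smul_eq_mul]; ring

lemma diff_phaseQuot : DifferentiableOn ℂ (phaseQuot φ) (ball 1 (1 / 100)) := by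
  have := isOpen_ball.mem_nhds one_mem_ball_one
  exact (differentiableOn_dslope this).2 ((differentiableOn_dslope this).2 h.diff)

lemma phaseQuot_one : phaseQuot φ 1 = iteratedDeriv 2 φ 1 / 2 := by
  have hQ : ∀ z ∈ ball (1 : ℂ) (1 / 100), DifferentiableAt ℂ (phaseQuot φ) z := fun z hz =>
    h.diff_phaseQuot.differentiableAt (isOpen_ball.mem_nhds hz)
  have hQ' : DifferentiableAt ℂ (deriv (phaseQuot φ)) 1 :=
    (h.diff_phaseQuot.deriv isOpen_ball).differentiableAt (isOpen_ball.mem_nhds one_mem_ball_one)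
  have h1 : deriv φ =ᶠ[𝓝 1] fun z => 2 * (z - 1) * phaseQuot φ z
      + (z - 1) ^ 2 * deriv (phaseQuot φ) z := by
    filter_upwards [isOpen_ball.mem_nhds one_mem_ball_one] with z hz
    have h2 : HasDerivAt (fun z : ℂ => (z - 1) ^ 2) (2 * (z - 1)) z := by
      simpa using ((hasDerivAt_id z).sub_const 1).fun_pow 2
    have h3 := (h2.mul (hQ z hz).hasDerivAt).deriv
    rw [← h3]
    congr 1
    exact funext h.eq_sq_mul_phaseQuot
  rw [iteratedDeriv_succ, iteratedDeriv_one, h1.deriv_eq]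
  have h2 : HasDerivAt (fun z : ℂ => (z - 1) ^ 2) (2 * (1 - 1)) (1 : ℂ) := by
    simpa using ((hasDerivAt_id (1 : ℂ)).sub_const 1).fun_pow 2
  have h4 : HasDerivAt (fun z : ℂ => 2 * (z - 1)) 2 (1 : ℂ) := by
    simpa using ((hasDerivAt_id (1 : ℂ)).sub_const 1).const_mul 2
  have h5 := (h4.mul (hQ 1 one_mem_ball_one).hasDerivAt).add (h2.mul hQ'.hasDerivAt)
  have := h5.deriv
  simp only [sub_self, mul_zero, zero_mul, add_zero, ne_eq, OfNat.ofNat_ne_zero,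
    not_false_eq_true, zero_pow] at this
  rw [eq_div_iff two_ne_zero, mul_comm, ← this]
  rfl

lemma norm_phaseQuot_add_one_le {z : ℂ} (hz : z ∈ ball (1 : ℂ) (1 / 100)) :
    ‖phaseQuot φ z + 1‖ ≤ 1 / 20 := by
  rcases eq_or_ne z 1 with rfl | hne
  · have := h.near 1 one_mem_ball_one
    have h2 : phaseQuot φ 1 + 1 = (deriv (deriv φ) 1 + 2) / 2 := by
      rw [h.phaseQuot_one, iteratedDeriv_succ, iteratedDeriv_one]; ring
    rw [h2, norm_div]
    norm_num
    linarith
  · have h1 := h.norm_add_sq_le hz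
    have h2 : φ z + (z - 1) ^ 2 = (z - 1) ^ 2 * (phaseQuot φ z + 1) := by
      rw [h.eq_sq_mul_phaseQuot z]; ring
    rw [h2, norm_mul, norm_pow, mul_comm] at h1
    exact le_of_mul_le_mul_right h1 (by have := norm_pos_iff.2 (sub_ne_zero.2 hne); positivity)

/-- The second derivative is real and within 1/20 of -2, hence negative. Therefore |φ''(1)| can
stand for -φ''(1) in the Gaussian and in the branch of the square root. -/
lemma norm_iteratedDeriv_two : iteratedDeriv 2 φ 1 = -((‖iteratedDeriv 2 φ 1‖ : ℝ) : ℂ) ∧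
    19 / 10 ≤ ‖iteratedDeriv 2 φ 1‖ ∧ ‖iteratedDeriv 2 φ 1‖ ≤ 21 / 10 := by
  have h1 := h.near 1 one_mem_ball_one
  rw [← iteratedDeriv_one (f := φ), ← iteratedDeriv_succ] at h1
  norm_num at h1
  set d := iteratedDeriv 2 φ 1
  have hd : d = (d.re : ℂ) := by apply Complex.ext <;> simp [d, h.im_eq]
  have h2 : |d.re + 2| ≤ 1 / 20 := by
    have := (abs_re_le_norm (d + 2)).trans h1
    simpa using this
  have h3 := abs_le.1 h2
  have h4 : ‖d‖ = -d.re := by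
    rw [hd, norm_real, Real.norm_eq_abs, abs_of_neg (by linarith), ofReal_re]
  refine ⟨?_, by linarith, by linarith⟩
  rw [h4]
  conv_lhs => rw [hd]
  push_cast; ring

/-- The expansion of the phase to fourth order, with uniform bounds. -/
lemma taylor_expansion : ∃ c : ℂ, ∃ Ψ : ℂ → ℂ, ‖c‖ ≤ 10 ∧
    ∀ t : ℂ, ‖t‖ < 1 / 100 → ‖Ψ t‖ ≤ 2000 ∧
      φ (1 + t) = -((‖iteratedDeriv 2 φ 1‖ : ℝ) : ℂ) / 2 * t ^ 2 + c * t ^ 3 + t ^ 4 * Ψ t := by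
  have hnh := isOpen_ball.mem_nhds one_mem_ball_one
  have hQ := h.diff_phaseQuot
  have hQ1 := (differentiableOn_dslope hnh).2 hQ
  -- The Schwarz lemma bounds a divided difference by the oscillation over the radius: here
  -- (1/10)/(1/100) = 10, and for the next one 20/(1/100) = 2000.
  have b1 : ∀ z ∈ ball (1 : ℂ) (1 / 100), ‖dslope (phaseQuot φ) 1 z‖ ≤ 10 := by
    intro z hz
    refine (norm_dslope_le_div_of_mapsTo_ball (R₂ := 1 / 10) hQ (fun x hx => ?_) hz).trans (by
      norm_num)
    rw [mem_closedBall_iff_norm]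
    have e1 := h.norm_phaseQuot_add_one_le hx
    have e2 := h.norm_phaseQuot_add_one_le one_mem_ball_one
    calc _ = ‖(phaseQuot φ x + 1) - (phaseQuot φ 1 + 1)‖ := by congr 1; ring
      _ ≤ _ := norm_sub_le _ _
      _ ≤ _ := by linarith
  have b2 : ∀ z ∈ ball (1 : ℂ) (1 / 100), ‖dslope (dslope (phaseQuot φ) 1) 1 z‖ ≤ 2000 := by
    intro z hz
    refine (norm_dslope_le_div_of_mapsTo_ball (R₂ := 20) hQ1 (fun x hx => ?_) hz).trans (by
      norm_num)
    rw [mem_closedBall_iff_norm]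
    have e1 := b1 x hx
    have e2 := b1 1 one_mem_ball_one
    exact (norm_sub_le _ _).trans (by linarith)
  refine ⟨dslope (phaseQuot φ) 1 1, fun t => dslope (dslope (phaseQuot φ) 1) 1 (1 + t),
    b1 1 one_mem_ball_one, fun t ht => ?_⟩
  have hmem : 1 + t ∈ ball (1 : ℂ) (1 / 100) := by
    rw [mem_ball_iff_norm]; simpa using ht
  refine ⟨b2 _ hmem, ?_⟩
  have e1 := sub_smul_dslope (phaseQuot φ) 1 (1 + t)
  have e2 := sub_smul_dslope (dslope (phaseQuot φ) 1) 1 (1 + t)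
  have e3 := h.eq_sq_mul_phaseQuot (1 + t)
  rw [add_sub_cancel_left] at e1 e2 e3
  have e4 : phaseQuot φ 1 = -((‖iteratedDeriv 2 φ 1‖ : ℝ) : ℂ) / 2 := by
    rw [h.phaseQuot_one]
    conv_lhs => rw [h.norm_iteratedDeriv_two.1]
  simp only [smul_eq_mul] at e1 e2
  rw [e3, ← e4]
  linear_combination (-t ^ 2) * e1 - t ^ 3 * e2

/-- A local coordinate `v` at `1` with `v² = -φ`, close to `z - 1`. -/
lemma exists_sqrt : ∃ v : ℂ → ℂ, DifferentiableOn ℂ v (ball 1 (1 / 100)) ∧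
    (∀ z ∈ ball (1 : ℂ) (1 / 100), v z ^ 2 = -φ z) ∧ v 1 = 0 ∧
    deriv v 1 = (Real.sqrt (‖iteratedDeriv 2 φ 1‖ / 2) : ℂ) ∧
    (∀ z ∈ ball (1 : ℂ) (1 / 100), ∀ z' ∈ ball (1 : ℂ) (1 / 100),
      ‖v z - v z' - (z - z')‖ ≤ 1 / 10 * ‖z - z'‖) := by
  -- Dividing out (z - 1)² leaves a function within 1/20 of 1 (up to sign), so its principal square
  -- root is holomorphic and v = (z - 1)s.
  set s : ℂ → ℂ := fun z => cexp (Complex.log (-phaseQuot φ z) / 2) with hs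
  have hslit : ∀ z ∈ ball (1 : ℂ) (1 / 100), -phaseQuot φ z ∈ slitPlane := by
    intro z hz
    left
    have h1 := (abs_re_le_norm _).trans (h.norm_phaseQuot_add_one_le hz)
    simp only [add_re, one_re] at h1
    have := abs_le.1 h1
    simp only [neg_re]
    linarith
  have hsd : DifferentiableOn ℂ s (ball 1 (1 / 100)) := by
    intro z hz
    exact (((h.diff_phaseQuot z hz).neg.clog (hslit z hz)).div_const 2).cexp
  have hs2 : ∀ z ∈ ball (1 : ℂ) (1 / 100), s z ^ 2 = -phaseQuot φ z := by
    intro z hz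
    rw [hs]
    simp only
    rw [← Complex.exp_nat_mul]
    rw [show ((2 : ℕ) : ℂ) * (Complex.log (-phaseQuot φ z) / 2) = Complex.log (-phaseQuot φ z) by
      push_cast; ring]
    exact Complex.exp_log (slitPlane_ne_zero (hslit z hz))
  have hsre : ∀ z, 0 ≤ (s z).re := by
    intro z
    simp only [hs, Complex.exp_re]
    refine mul_nonneg (Real.exp_pos _).le (Real.cos_nonneg_of_mem_Icc ?_)
    have : (Complex.log (-phaseQuot φ z) / 2).im = (-phaseQuot φ z).arg / 2 := by
      rw [show (Complex.log (-phaseQuot φ z) / 2)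
        = Complex.log (-phaseQuot φ z) / ((2 : ℝ) : ℂ) by norm_num, div_ofReal_im, log_im]
    rw [this]
    have h1 := Complex.neg_pi_lt_arg (-phaseQuot φ z)
    have h2 := Complex.arg_le_pi (-phaseQuot φ z)
    constructor <;> linarith
  have hs1 : ∀ z ∈ ball (1 : ℂ) (1 / 100), ‖s z - 1‖ ≤ 1 / 20 := by
    intro z hz
    have h1 : 1 ≤ ‖s z + 1‖ := by
      have := (le_abs_self _).trans (abs_re_le_norm (s z + 1))
      simp only [add_re, one_re] at this
      linarith [hsre z]
    have h2 : (s z - 1) * (s z + 1) = -(phaseQuot φ z + 1) := by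
      linear_combination hs2 z hz
    have h3 : ‖s z - 1‖ * ‖s z + 1‖ ≤ 1 / 20 := by
      rw [← norm_mul, h2, norm_neg]; exact h.norm_phaseQuot_add_one_le hz
    nlinarith [norm_nonneg (s z - 1)]
  set v : ℂ → ℂ := fun z => (z - 1) * s z with hv
  have hvd : DifferentiableOn ℂ v (ball 1 (1 / 100)) := by
    intro z hz
    exact ((differentiableAt_id.sub_const 1).differentiableWithinAt).mul (hsd z hz)
  have hv2 : ∀ z ∈ ball (1 : ℂ) (1 / 100), v z ^ 2 = -φ z := by
    intro z hz
    rw [hv]; simp only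
    rw [mul_pow, hs2 z hz, h.eq_sq_mul_phaseQuot z]; ring
  have hvd1 : deriv v 1 = s 1 := by
    have h1 := (hsd.differentiableAt (isOpen_ball.mem_nhds one_mem_ball_one)).hasDerivAt
    have h2 := ((hasDerivAt_id (1 : ℂ)).sub_const 1).mul h1
    have := h2.deriv
    simp only [id_eq, sub_self, one_mul, zero_mul, add_zero] at this
    exact this
  -- Differentiating v² = -φ expresses v' through φ' and s, so no bound for s' is needed.
  have hvb : ∀ z ∈ ball (1 : ℂ) (1 / 100), ‖deriv v z - 1‖ ≤ 1 / 10 := by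
    intro z hz
    rcases eq_or_ne z 1 with rfl | hne
    · rw [hvd1]; linarith [hs1 1 hz]
    · have hvz := (hvd.differentiableAt (isOpen_ball.mem_nhds hz)).hasDerivAt
      have h1 : 2 * v z * deriv v z = -deriv φ z := by
        have e1 := (hvz.pow 2).deriv
        have e2 : (v ^ 2) =ᶠ[𝓝 z] fun z => -φ z := by
          filter_upwards [isOpen_ball.mem_nhds hz] with x hx using hv2 x hx
        rw [e2.deriv_eq, deriv.fun_neg] at e1
        rw [e1]; simp
      have h2 : 2 * v z * (deriv v z - 1)
          = -(deriv φ z + 2 * (z - 1)) - 2 * (z - 1) * (s z - 1) := by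
        rw [mul_sub, h1]; simp only [hv]; ring
      have hpos : 0 < ‖z - 1‖ := norm_pos_iff.2 (sub_ne_zero.2 hne)
      have h3 : ‖2 * v z * (deriv v z - 1)‖ ≤ 3 / 20 * ‖z - 1‖ := by
        rw [h2]
        refine (norm_sub_le _ _).trans ?_
        rw [norm_neg, norm_mul, norm_mul]
        have e1 := h.norm_deriv_add_le hz
        have e2 : ‖(2 : ℂ)‖ * ‖z - 1‖ * ‖s z - 1‖ ≤ 2 * ‖z - 1‖ * (1 / 20) := by
          rw [show ‖(2 : ℂ)‖ = 2 by simp]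
          gcongr; exact hs1 z hz
        linarith
      have h4 : 19 / 20 ≤ ‖s z‖ := by
        have := norm_sub_norm_le (1 : ℂ) (1 - s z)
        rw [sub_sub_cancel, norm_one, norm_sub_rev] at this
        linarith [hs1 z hz]
      rw [norm_mul, norm_mul, show ‖(2 : ℂ)‖ = 2 by simp, hv] at h3
      simp only at h3
      rw [norm_mul] at h3
      have h5 : ‖z - 1‖ * (2 * ‖s z‖ * ‖deriv v z - 1‖) ≤ ‖z - 1‖ * (3 / 20) := by
        calc _ = 2 * (‖z - 1‖ * ‖s z‖) * ‖deriv v z - 1‖ := by ring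
          _ ≤ _ := h3
          _ = _ := by ring
      have h6 := le_of_mul_le_mul_left h5 hpos
      nlinarith [norm_nonneg (deriv v z - 1)]
  refine ⟨v, hvd, hv2, by simp [hv], ?_, ?_⟩
  · rw [hvd1]
    have h1 : -phaseQuot φ 1 = ((‖iteratedDeriv 2 φ 1‖ / 2 : ℝ) : ℂ) := by
      rw [h.phaseQuot_one]
      conv_lhs => rw [h.norm_iteratedDeriv_two.1]
      push_cast; ring
    have hp : 0 < ‖iteratedDeriv 2 φ 1‖ / 2 := by linarith [h.norm_iteratedDeriv_two.2.1]
    simp only [hs]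
    rw [h1, ← ofReal_log hp.le, Real.sqrt_eq_rpow, Real.rpow_def_of_pos hp]
    push_cast; congr 1; ring
  · intro z hz z' hz'
    have hd : ∀ x ∈ ball (1 : ℂ) (1 / 100), HasDerivWithinAt (fun z => v z - z)
        (deriv v x - 1) (ball 1 (1 / 100)) x := fun x hx =>
      ((hvd.differentiableAt (isOpen_ball.mem_nhds hx)).hasDerivAt.sub
        (hasDerivAt_id x)).hasDerivWithinAt
    have := (convex_ball (1 : ℂ) (1 / 100)).norm_image_sub_le_of_norm_hasDerivWithin_le hd hvb
      hz' hz
    calc _ = ‖v z - z - (v z' - z')‖ := by congr 1; ring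
      _ ≤ _ := this

end LocalPhase

/-- Properties of a square root `v` of `-φ` near `1`. -/
lemma ball_subset_image_of_near_id {v : ℂ → ℂ} (hv1 : v 1 = 0)
    (hv : ∀ z ∈ ball (1 : ℂ) (1 / 100), ∀ z' ∈ ball (1 : ℂ) (1 / 100),
      ‖v z - v z' - (z - z')‖ ≤ 1 / 10 * ‖z - z'‖) :
    ∀ a ∈ ball (0 : ℂ) (1 / 200), ∃ z ∈ ball (1 : ℂ) (1 / 100), v z = a := by
  intro a ha
  have happ : ApproximatesLinearOn v (ContinuousLinearEquiv.refl ℂ ℂ : ℂ →L[ℂ] ℂ)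
      (ball (1 : ℂ) (1 / 100)) (1 / 10) := by
    intro z hz z' hz'
    simpa using hv z hz z' hz'
  have hsub : closedBall (1 : ℂ) (1 / 150) ⊆ ball (1 : ℂ) (1 / 100) :=
    closedBall_subset_ball (by norm_num)
  -- The image contains a ball of radius (1 - 1/10)/150 = 3/500, which exceeds 1/200.
  have hsurj := happ.surjOn_closedBall_of_nonlinearRightInverse
    (ContinuousLinearEquiv.refl ℂ ℂ).toNonlinearRightInverse (by norm_num) hsub
  have hnn : ((ContinuousLinearEquiv.refl ℂ ℂ).toNonlinearRightInverse.nnnorm : ℝ) = 1 := by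
    simp [ContinuousLinearEquiv.toNonlinearRightInverse]
  rw [hnn, hv1] at hsurj
  obtain ⟨z, hz, hza⟩ := hsurj (show a ∈ _ by
    refine closedBall_subset_closedBall ?_ (ball_subset_closedBall ha)
    norm_num)
  exact ⟨z, hsub hz, hza⟩

end LocalPhase

end LTaylor

namespace LTaylor

/-! ### Normalised functions and the integrand at the saddle point. -/

section SaddlePoint

open MeasureTheory Metric Set

/-- A normalised even entire function `f` with phase `φ`, i.e. `f z = z ^ (2 n) exp (-n φ z)`. -/
structure Admissible (C₀ : ℝ) (n : ℕ) (f φ : ℂ → ℂ) : Prop where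
  phase : LocalPhase φ
  entire : Differentiable ℂ f
  even : ∀ z, f (-z) = f z
  decay : StripDecay f
  exp_eq : ∀ z : ℂ, 1 / 2 < z.re → cexp (n * φ z) * f z = z ^ (2 * n)
  vertical : ∀ x y : ℝ, 1 / 2 ≤ x → ‖f (x + y * I)‖ ≤ C₀ * ‖f x‖

/-- Each term of the convergent series Σ n² rⁿ is at most its sum, and √n · n ≤ n². This converts
exponentially small tails into O(1/n). -/
lemma exists_sqrt_mul_pow_le {r : ℝ} (h0 : 0 ≤ r) (h1 : r < 1) :
    ∃ K : ℝ, 0 ≤ K ∧ ∀ n : ℕ, n ≠ 0 → Real.sqrt n * r ^ n ≤ K / n := by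
  have hs := summable_pow_mul_geometric_of_norm_lt_one 2 (r := r) (by
    rwa [Real.norm_of_nonneg h0])
  refine ⟨∑' n : ℕ, (n : ℝ) ^ 2 * r ^ n, tsum_nonneg fun n => by positivity, fun n hn => ?_⟩
  have hn1 : (1 : ℝ) ≤ n := by exact_mod_cast Nat.one_le_iff_ne_zero.2 hn
  rw [le_div_iff₀ (by positivity)]
  have h2 : Real.sqrt n ≤ n := by
    rw [Real.sqrt_le_left (by positivity)]; nlinarith
  have h3 : (n : ℝ) ^ 2 * r ^ n ≤ _ := hs.le_tsum n (fun k _ => by positivity)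
  refine le_trans ?_ h3
  have : Real.sqrt n * r ^ n * n = (Real.sqrt n * n) * r ^ n := by ring
  rw [this, pow_two]
  gcongr

lemma exists_pow_le_div {r : ℝ} (h0 : 0 ≤ r) (h1 : r < 1) :
    ∃ K : ℝ, 0 ≤ K ∧ ∀ n : ℕ, n ≠ 0 → r ^ n ≤ K / n := by
  obtain ⟨K, hK, h⟩ := exists_sqrt_mul_pow_le h0 h1
  refine ⟨K, hK, fun n hn => le_trans ?_ (h n hn)⟩
  have hn1 : (1 : ℝ) ≤ n := by exact_mod_cast Nat.one_le_iff_ne_zero.2 hn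
  have := Real.one_le_sqrt.2 hn1
  have h2 : 0 ≤ r ^ n := pow_nonneg h0 n
  nlinarith

namespace Admissible

variable {C₀ : ℝ} {n : ℕ} {f φ : ℂ → ℂ} (h : Admissible C₀ n f φ)
include h

lemma map_one : f 1 = 1 := by
  have := h.exp_eq 1 (by norm_num)
  simpa [h.phase.at_one] using this

lemma one_le : 1 ≤ C₀ := by
  have := h.vertical 1 0 (by norm_num)
  simpa [h.map_one] using this

lemma mul_inv_pow_eq {z : ℂ} (hz : 1 / 2 < z.re) : f z * z⁻¹ ^ (2 * n) = cexp (-(n * φ z)) := by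
  have h1 := h.exp_eq z hz
  have hz0 : z ≠ 0 := by rintro rfl; norm_num at hz
  have h2 : z ^ (2 * n) ≠ 0 := pow_ne_zero _ hz0
  rw [Complex.exp_neg, inv_pow, ← h1, mul_inv, mul_comm]
  rw [← h1] at h2
  rw [mul_assoc, inv_mul_cancel₀ (right_ne_zero_of_mul h2), mul_one]

/-- The size of f on the line is controlled by f(1) = 1, so all the decay comes from |s|^{-2n}. No
knowledge of φ far from the saddle is required. -/
lemma norm_line_le (y : ℝ) : ‖cexp (-(n * φ (linePt y)))‖ ≤ C₀ * ((1 + y ^ 2)⁻¹) ^ n := by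
  rw [← h.mul_inv_pow_eq (by rw [linePt_re]; norm_num), norm_mul]
  have h1 := h.vertical 1 y (by norm_num)
  rw [ofReal_one, h.map_one, norm_one, mul_one] at h1
  have h2 : ‖(linePt y)⁻¹ ^ (2 * n)‖ = ((1 + y ^ 2)⁻¹) ^ n := by
    rw [pow_mul, norm_pow]
    congr 1
    rw [norm_pow, norm_inv, inv_pow, Complex.sq_norm, normSq_apply, linePt_re, linePt_im]
    congr 1; ring
  rw [h2]
  gcongr
  exact h1

end Admissible

/-- Applied with x = n y²: giving up 7/20 of the exponent absorbs the polynomial factor and leaves a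
Gaussian. -/
lemma pow_le_mul_exp {x : ℝ} (hx : 0 ≤ x) :
    (x + x ^ 2 + x ^ 3) * Real.exp (-(17 / 20 * x)) ≤ 200 * Real.exp (-(x / 2)) := by
  have e : Real.exp (-(x / 2)) = Real.exp (7 / 20 * x) * Real.exp (-(17 / 20 * x)) := by
    rw [← Real.exp_add]; congr 1; ring
  rw [e, ← mul_assoc]
  gcongr
  have hx' : 0 ≤ 7 / 20 * x := by positivity
  have h1 := Real.pow_div_factorial_le_exp _ hx' 1
  have h2 := Real.pow_div_factorial_le_exp _ hx' 2
  have h3 := Real.pow_div_factorial_le_exp _ hx' 3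
  simp only [Nat.factorial] at h1 h2 h3
  norm_num at h1 h2 h3
  have h2' : (7 / 20 * x) ^ 2 = 49 / 400 * x ^ 2 := by ring
  have h3' : (7 / 20 * x) ^ 3 = 343 / 8000 * x ^ 3 := by ring
  rw [h2'] at h2; rw [h3'] at h3
  nlinarith

/-- Pairing t with -t gives a first-order odd difference and a second-order even one, as the
symmetrised integrand requires. -/
lemma inv_add_bounds {b t : ℂ} {c : ℝ} (hc : 0 < c) (hb : c ≤ ‖b‖) (ht : ‖t‖ ≤ c / 2) :
    ‖(b + t)⁻¹‖ ≤ 2 / c ∧ ‖(b + t)⁻¹ - (b - t)⁻¹‖ ≤ 8 / c ^ 2 * ‖t‖ ∧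
      ‖(b + t)⁻¹ + (b - t)⁻¹ - 2 * b⁻¹‖ ≤ 8 / c ^ 3 * ‖t‖ ^ 2 := by
  have h1 : c / 2 ≤ ‖b + t‖ := by
    have := norm_sub_norm_le b (-t)
    rw [sub_neg_eq_add, norm_neg] at this
    linarith
  have h2 : c / 2 ≤ ‖b - t‖ := by
    have := norm_sub_norm_le b t
    linarith
  have n0 : b ≠ 0 := norm_pos_iff.1 (hc.trans_le hb)
  have n1 : b + t ≠ 0 := norm_pos_iff.1 ((half_pos hc).trans_le h1)
  have n2 : b - t ≠ 0 := norm_pos_iff.1 ((half_pos hc).trans_le h2)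
  have i1 : ‖(b + t)⁻¹‖ ≤ 2 / c := by
    rw [norm_inv, ← inv_div]; gcongr
  have i2 : ‖(b - t)⁻¹‖ ≤ 2 / c := by
    rw [norm_inv, ← inv_div]; gcongr
  have i0 : ‖b⁻¹‖ ≤ 1 / c := by
    rw [norm_inv, one_div]; gcongr
  refine ⟨i1, ?_, ?_⟩
  · have : (b + t)⁻¹ - (b - t)⁻¹ = -2 * t * ((b + t)⁻¹ * (b - t)⁻¹) := by field_simp; ring
    rw [this, norm_mul, norm_mul, norm_mul]
    calc ‖(-2 : ℂ)‖ * ‖t‖ * (‖(b + t)⁻¹‖ * ‖(b - t)⁻¹‖) ≤ 2 * ‖t‖ * (2 / c * (2 / c)) := by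
          rw [show ‖(-2 : ℂ)‖ = 2 by simp]; gcongr
      _ = _ := by field_simp; ring
  · have : (b + t)⁻¹ + (b - t)⁻¹ - 2 * b⁻¹ = 2 * t ^ 2 * ((b + t)⁻¹ * (b - t)⁻¹ * b⁻¹) := by
      field_simp; ring
    rw [this, norm_mul, norm_mul, norm_mul, norm_mul, norm_pow]
    calc ‖(2 : ℂ)‖ * ‖t‖ ^ 2 * (‖(b + t)⁻¹‖ * ‖(b - t)⁻¹‖ * ‖b⁻¹‖)
        ≤ 2 * ‖t‖ ^ 2 * (2 / c * (2 / c) * (1 / c)) := by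
          rw [show ‖(2 : ℂ)‖ = 2 by simp]; gcongr
      _ = _ := by field_simp; ring

/-- The kernel `1 / (s - z) + 1 / (s + z)` at `s = 1 + t`. -/
noncomputable def cauchyKernel (z t : ℂ) : ℂ := (1 - z + t)⁻¹ + (1 + z + t)⁻¹

lemma cauchyKernel_bounds {z t : ℂ} {c : ℝ} (hc : 0 < c) (h1 : c ≤ ‖z - 1‖) (h2 : c ≤ ‖z + 1‖)
    (ht : ‖t‖ ≤ c / 2) :
    ‖cauchyKernel z t‖ ≤ 4 / c ∧ ‖cauchyKernel z t - cauchyKernel z (-t)‖ ≤ 16 / c ^ 2 * ‖t‖ ∧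
      ‖cauchyKernel z t + cauchyKernel z (-t) - 2 * cauchyKernel z 0‖ ≤ 16 / c ^ 3 * ‖t‖ ^ 2 := by
  have a := inv_add_bounds hc (b := 1 - z) (by rwa [norm_sub_rev]) ht
  have b := inv_add_bounds hc (b := 1 + z) (by rwa [add_comm]) ht
  simp only [cauchyKernel, add_zero, ← sub_eq_add_neg]
  refine ⟨(norm_add_le _ _).trans ?_, ?_, ?_⟩
  · linarith [a.1, b.1, show 2 / c + 2 / c = 4 / c by ring]
  · rw [show (1 - z + t)⁻¹ + (1 + z + t)⁻¹ - ((1 - z - t)⁻¹ + (1 + z - t)⁻¹)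
      = ((1 - z + t)⁻¹ - (1 - z - t)⁻¹) + ((1 + z + t)⁻¹ - (1 + z - t)⁻¹) by ring]
    refine (norm_add_le _ _).trans ((add_le_add a.2.1 b.2.1).trans (le_of_eq (by ring)))
  · rw [show (1 - z + t)⁻¹ + (1 + z + t)⁻¹ + ((1 - z - t)⁻¹ + (1 + z - t)⁻¹)
        - 2 * ((1 - z)⁻¹ + (1 + z)⁻¹)
      = ((1 - z + t)⁻¹ + (1 - z - t)⁻¹ - 2 * (1 - z)⁻¹)
        + ((1 + z + t)⁻¹ + (1 + z - t)⁻¹ - 2 * (1 + z)⁻¹) by ring]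
    refine (norm_add_le _ _).trans ((add_le_add a.2.2 b.2.2).trans (le_of_eq (by ring)))

/-- The symmetrised integrand near the saddle point. -/
lemma LocalPhase.symmetric_bound {φ : ℂ → ℂ} (h : LocalPhase φ) {c : ℝ} (hc : 0 < c) (n : ℕ)
    {z : ℂ} (h1 : c ≤ ‖z - 1‖) (h2 : c ≤ ‖z + 1‖) {y : ℝ} (hy : |y| ≤ c / 2)
    (hy' : |y| < 1 / 100) :
    ‖cexp (-(n * φ (1 + y * I))) * cauchyKernel z (y * I)
      + cexp (-(n * φ (1 + (-(y * I))))) * cauchyKernel z (-(y * I))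
      - 2 * (cexp (-(n * ((‖iteratedDeriv 2 φ 1‖ : ℝ) : ℂ) / 2 * (y : ℂ) ^ 2)) *
        cauchyKernel z 0)‖
    ≤ (16 / c ^ 3 + 16000 / c + 480 / c ^ 2 + 7200 / c) *
      ((y ^ 2 + n * y ^ 4 + n ^ 2 * y ^ 6) * Real.exp (-(17 / 20 * (n * y ^ 2)))) := by
  set t : ℂ := y * I with ht
  set A : ℝ := ‖iteratedDeriv 2 φ 1‖ with hA
  have hnt : ‖t‖ = |y| := by simp [ht]
  have hnn : ‖-t‖ = |y| := by rw [norm_neg, hnt]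
  obtain ⟨-, hA1, hA2⟩ := h.norm_iteratedDeriv_two
  have ht2 : t ^ 2 = -(y : ℂ) ^ 2 := by rw [ht, mul_pow, I_sq]; ring
  obtain ⟨cc, Ψ, hcc, hΨ⟩ := h.taylor_expansion
  obtain ⟨k1, k2, k3⟩ := cauchyKernel_bounds hc h1 h2 (t := t) (by rwa [hnt])
  obtain ⟨k1', -, -⟩ := cauchyKernel_bounds hc h1 h2 (t := -t) (by rwa [hnn])
  rw [hnt] at k2 k3
  set kp := cauchyKernel z t
  set km := cauchyKernel z (-t)
  set k0 := cauchyKernel z 0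
  -- deviations of the phase from its quadratic part
  set up : ℂ := n * (φ (1 + t) - (A : ℂ) / 2 * (y : ℂ) ^ 2) with hup
  set um : ℂ := n * (φ (1 + -t) - (A : ℂ) / 2 * (y : ℂ) ^ 2) with hum
  set m : ℂ := cexp (-(n * (A : ℂ) / 2 * (y : ℂ) ^ 2)) with hm
  have hmem : ∀ τ : ℂ, ‖τ‖ = |y| → 1 + τ ∈ ball (1 : ℂ) (1 / 100) := by
    intro τ hτ; rw [mem_ball_iff_norm]; simpa [hτ] using hy'
  -- A coarse bound, used only inside exponentials: 1/20 from φ against -(z - 1)² and 1/20 from A/2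
  -- against 1.
  have quad : ∀ τ : ℂ, ‖τ‖ = |y| → τ ^ 2 = -(y : ℂ) ^ 2 →
      ‖(n : ℂ) * (φ (1 + τ) - (A : ℂ) / 2 * (y : ℂ) ^ 2)‖ ≤ 1 / 10 * (n * y ^ 2) := by
    intro τ hτ hτ2
    have e1 := h.norm_add_sq_le (hmem τ hτ)
    rw [add_sub_cancel_left, hτ, sq_abs, hτ2] at e1
    rw [norm_mul, norm_natCast]
    have e2 : ‖(1 - (A : ℂ) / 2) * (y : ℂ) ^ 2‖ ≤ 1 / 20 * y ^ 2 := by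
      rw [norm_mul, norm_pow, norm_real, Real.norm_eq_abs, sq_abs]
      gcongr
      rw [show (1 - (A : ℂ) / 2) = ((1 - A / 2 : ℝ) : ℂ) by push_cast; ring, norm_real,
        Real.norm_eq_abs, abs_le]
      constructor <;> linarith
    have e3 : ‖φ (1 + τ) - (A : ℂ) / 2 * (y : ℂ) ^ 2‖ ≤ 1 / 10 * y ^ 2 := by
      calc _ = ‖(φ (1 + τ) + -(y : ℂ) ^ 2) + (1 - (A : ℂ) / 2) * (y : ℂ) ^ 2‖ := by
            congr 1; ring
        _ ≤ _ := norm_add_le _ _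
        _ ≤ _ := by linarith
    calc _ ≤ (n : ℝ) * (1 / 10 * y ^ 2) := by gcongr
      _ = _ := by ring
  have hy0 := abs_nonneg y
  have hy4 : y ^ 4 = |y| ^ 4 := by rw [show (4 : ℕ) = 2 * 2 by rfl, pow_mul, pow_mul, sq_abs]
  have hy6 : y ^ 6 = |y| ^ 6 := by rw [show (6 : ℕ) = 2 * 3 by rfl, pow_mul, pow_mul, sq_abs]
  -- The bound that gives the orders in n: 10|y|³ + 2000|y|⁴ ≤ 30|y|³ because |y| < 1/100.
  have cub : ∀ τ : ℂ, ‖τ‖ = |y| → τ ^ 2 = -(y : ℂ) ^ 2 →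
      ‖(n : ℂ) * (φ (1 + τ) - (A : ℂ) / 2 * (y : ℂ) ^ 2)‖ ≤ 30 * n * |y| ^ 3 := by
    intro τ hτ hτ2
    obtain ⟨e1, e2⟩ := hΨ τ (by rwa [hτ])
    rw [e2, hτ2, norm_mul, norm_natCast]
    have : ‖-(A : ℂ) / 2 * -(y : ℂ) ^ 2 + cc * τ ^ 3 + τ ^ 4 * Ψ τ - (A : ℂ) / 2 * (y : ℂ) ^ 2‖
        ≤ 10 * |y| ^ 3 + |y| ^ 4 * 2000 := by
      calc _ = ‖cc * τ ^ 3 + τ ^ 4 * Ψ τ‖ := by congr 1; ring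
        _ ≤ _ := norm_add_le _ _
        _ ≤ _ := by
          rw [norm_mul, norm_mul, norm_pow, norm_pow, hτ]
          gcongr
    have h4 : |y| ^ 4 * 2000 ≤ 20 * |y| ^ 3 := by
      have : |y| ^ 4 = |y| ^ 3 * |y| := by ring
      rw [this]
      have : |y| ^ 3 * |y| ≤ |y| ^ 3 * (1 / 100) := by gcongr
      linarith
    calc _ ≤ (n : ℝ) * (10 * |y| ^ 3 + |y| ^ 4 * 2000) := by gcongr
      _ ≤ (n : ℝ) * (10 * |y| ^ 3 + 20 * |y| ^ 3) := by gcongr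
      _ = _ := by ring
  have hnt2 : (-t) ^ 2 = -(y : ℂ) ^ 2 := by rw [neg_sq, ht2]
  have qp := quad t hnt ht2
  have qm := quad (-t) hnn hnt2
  have cp := cub t hnt ht2
  have cm := cub (-t) hnn hnt2
  rw [← hup] at qp cp
  rw [← hum] at qm cm
  -- The cubic terms are odd and cancel. Without this cancellation the error would be of order
  -- n^{-1/2} instead of 1/n.
  have sum4 : ‖up + um‖ ≤ 4000 * (n * y ^ 4) := by
    obtain ⟨e1, e2⟩ := hΨ t (by rwa [hnt])
    obtain ⟨e3, e4⟩ := hΨ (-t) (by rwa [hnn])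
    have : up + um = n * (t ^ 4 * (Ψ t + Ψ (-t))) := by
      rw [hup, hum, e2, e4, hnt2, ht2]; ring
    rw [this, norm_mul, norm_mul, norm_natCast, norm_pow, hnt, hy4]
    calc (n : ℝ) * (|y| ^ 4 * ‖Ψ t + Ψ (-t)‖) ≤ n * (|y| ^ 4 * (2000 + 2000)) := by
          gcongr
          exact (norm_add_le _ _).trans (add_le_add e1 e3)
      _ = _ := by ring
  have hrem : ∀ u : ℂ, ‖u‖ ≤ 1 / 10 * (n * y ^ 2) → ‖u‖ ≤ 30 * n * |y| ^ 3 →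
      ‖cexp (-u) - 1 + u‖ ≤ 900 * (n ^ 2 * y ^ 6) * Real.exp (1 / 10 * (n * y ^ 2)) := by
    intro u hu1 hu2
    have := Complex.norm_exp_sub_sum_le_norm_mul_exp (-u) 2
    simp only [Finset.sum_range_succ, Finset.sum_range_zero, pow_zero, pow_one, Nat.factorial,
      norm_neg] at this
    norm_num at this
    rw [show cexp (-u) - 1 + u = cexp (-u) - (1 + -u) by ring]
    refine this.trans ?_
    have : ‖u‖ ^ 2 ≤ (30 * n * |y| ^ 3) ^ 2 := by gcongr
    calc ‖u‖ ^ 2 * Real.exp ‖u‖ ≤ (30 * n * |y| ^ 3) ^ 2 * Real.exp (1 / 10 * (n * y ^ 2)) := by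
          gcongr
      _ = _ := by rw [hy6]; ring
  have rp := hrem up qp cp
  have rm := hrem um qm cm
  have ep : cexp (-(n * φ (1 + t))) = m * cexp (-up) := by
    rw [hm, ← Complex.exp_add, hup]; congr 1; ring
  have em : cexp (-(n * φ (1 + -t))) = m * cexp (-um) := by
    rw [hm, ← Complex.exp_add, hum]; congr 1; ring
  have hmn : ‖m‖ ≤ Real.exp (-(19 / 20 * (n * y ^ 2))) := by
    rw [hm, norm_exp]
    rw [show (-((n : ℂ) * (A : ℂ) / 2 * (y : ℂ) ^ 2)) = ((-(n * A / 2 * y ^ 2) : ℝ) : ℂ) by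
      push_cast; ring, ofReal_re]
    refine Real.exp_le_exp.2 (neg_le_neg ?_)
    have : 0 ≤ (n : ℝ) * y ^ 2 := by positivity
    calc 19 / 20 * (n * y ^ 2) ≤ A / 2 * (n * y ^ 2) :=
          mul_le_mul_of_nonneg_right (by linarith) this
      _ = _ := by ring
  rw [ep, em]
  -- The even kernel difference, the even part of the phase, odd phase times odd kernel, and the
  -- second-order exponential remainders: each is O(1/n) where y² is of order 1/n.
  have key : m * cexp (-up) * kp + m * cexp (-um) * km - 2 * (m * k0)
      = m * ((kp + km - 2 * k0) - ((up + um) * kp - um * (kp - km))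
        + ((cexp (-up) - 1 + up) * kp + (cexp (-um) - 1 + um) * km)) := by ring
  rw [key, norm_mul]
  set X := Real.exp (1 / 10 * (n * y ^ 2)) with hX
  have hX1 : 1 ≤ X := Real.one_le_exp (by positivity)
  have b1 : ‖kp + km - 2 * k0‖ ≤ 16 / c ^ 3 * y ^ 2 * X := by
    rw [sq_abs] at k3
    exact k3.trans (le_mul_of_one_le_right (by positivity) hX1)
  have b2 : ‖(up + um) * kp‖ ≤ 16000 / c * (n * y ^ 4) * X := by
    rw [norm_mul]
    calc ‖up + um‖ * ‖kp‖ ≤ 4000 * (n * y ^ 4) * (4 / c) := by gcongr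
      _ = 16000 / c * (n * y ^ 4) := by ring
      _ ≤ _ := le_mul_of_one_le_right (by positivity) hX1
  have b3 : ‖um * (kp - km)‖ ≤ 480 / c ^ 2 * (n * y ^ 4) * X := by
    rw [norm_mul]
    calc ‖um‖ * ‖kp - km‖ ≤ 30 * n * |y| ^ 3 * (16 / c ^ 2 * |y|) := by gcongr
      _ = 480 / c ^ 2 * (n * y ^ 4) := by rw [hy4]; ring
      _ ≤ _ := le_mul_of_one_le_right (by positivity) hX1
  have b4 : ‖(cexp (-up) - 1 + up) * kp + (cexp (-um) - 1 + um) * km‖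
      ≤ 7200 / c * (n ^ 2 * y ^ 6) * X := by
    refine (norm_add_le _ _).trans ?_
    rw [norm_mul, norm_mul]
    calc _ ≤ 900 * (n ^ 2 * y ^ 6) * X * (4 / c) + 900 * (n ^ 2 * y ^ 6) * X * (4 / c) := by
          gcongr
      _ = _ := by ring
  clear_value X m kp km k0 up um A
  have hsum : ‖(kp + km - 2 * k0) - ((up + um) * kp - um * (kp - km))
        + ((cexp (-up) - 1 + up) * kp + (cexp (-um) - 1 + um) * km)‖
      ≤ (16 / c ^ 3 * y ^ 2 + 16000 / c * (n * y ^ 4) + 480 / c ^ 2 * (n * y ^ 4)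
        + 7200 / c * (n ^ 2 * y ^ 6)) * X := by
    calc _ ≤ ‖kp + km - 2 * k0‖ + (‖(up + um) * kp‖ + ‖um * (kp - km)‖)
          + ‖(cexp (-up) - 1 + up) * kp + (cexp (-um) - 1 + um) * km‖ :=
          (norm_add_le _ _).trans (add_le_add_left ((norm_sub_le _ _).trans
            (add_le_add_right (norm_sub_le _ _) _)) _)
      _ ≤ _ := by linarith
  have hpoly : 16 / c ^ 3 * y ^ 2 + 16000 / c * (n * y ^ 4) + 480 / c ^ 2 * (n * y ^ 4)
        + 7200 / c * (n ^ 2 * y ^ 6)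
      ≤ (16 / c ^ 3 + 16000 / c + 480 / c ^ 2 + 7200 / c) * (y ^ 2 + n * y ^ 4 + n ^ 2 * y ^ 6) := by
    have p1 : 0 ≤ 16 / c ^ 3 := by positivity
    have p2 : 0 ≤ 16000 / c := by positivity
    have p3 : 0 ≤ 480 / c ^ 2 := by positivity
    have p4 : 0 ≤ 7200 / c := by positivity
    have q1 : 0 ≤ y ^ 2 := by positivity
    have q2 : 0 ≤ (n : ℝ) * y ^ 4 := by positivity
    have q3 : 0 ≤ (n : ℝ) ^ 2 * y ^ 6 := by positivity
    generalize 16 / c ^ 3 = P1 at *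
    generalize 16000 / c = P2 at *
    generalize 480 / c ^ 2 = P3 at *
    generalize 7200 / c = P4 at *
    generalize y ^ 2 = Q1 at *
    generalize (n : ℝ) * y ^ 4 = Q2 at *
    generalize (n : ℝ) ^ 2 * y ^ 6 = Q3 at *
    linarith [mul_nonneg p1 q2, mul_nonneg p1 q3, mul_nonneg p2 q1, mul_nonneg p2 q3,
      mul_nonneg p3 q1, mul_nonneg p3 q3, mul_nonneg p4 q1, mul_nonneg p4 q2,
      add_mul (P1 + P2 + P3) P4 (Q1 + Q2 + Q3)]
  -- 19/20 comes from A ≥ 19/10, and 1/10 is lost to the deviation of the phase.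
  have hfin : Real.exp (-(19 / 20 * (n * y ^ 2))) * X = Real.exp (-(17 / 20 * (n * y ^ 2))) := by
    rw [hX, ← Real.exp_add]; congr 1; ring
  rw [← hfin]
  calc ‖m‖ * _ ≤ Real.exp (-(19 / 20 * (n * y ^ 2))) *
        ((16 / c ^ 3 + 16000 / c + 480 / c ^ 2 + 7200 / c) *
          (y ^ 2 + n * y ^ 4 + n ^ 2 * y ^ 6) * X) := by
        refine mul_le_mul hmn (hsum.trans ?_) (norm_nonneg _) (Real.exp_pos _).le
        exact mul_le_mul_of_nonneg_right hpoly (by linarith)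
    _ = _ := by ring

end SaddlePoint

end LTaylor

namespace LTaylor

/-! ### The saddle point approximation of the Cauchy transform. -/

section SaddlePointIntegral

open MeasureTheory Metric Set

lemma exp_neg_mul_eq_pow (a : ℝ) (n : ℕ) : Real.exp (-(n * a)) = Real.exp (-a) ^ n := by
  rw [← Real.exp_nat_mul]; congr 1; ring

lemma cauchyKernel_linePt (z : ℂ) (y : ℝ) :
    (linePt y - z)⁻¹ + (linePt y + z)⁻¹ = cauchyKernel z (y * I) := by
  rw [cauchyKernel, linePt]; congr 2 <;> ring

lemma linePt_neg (y : ℝ) : linePt (-y) = 1 + -(y * I) := by simp [linePt]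

lemma H0_eq {φ : ℂ → ℂ} {n : ℕ} (hn : n ≠ 0) (hφ : 0 < ‖iteratedDeriv 2 φ 1‖) {z : ℂ}
    (hz1 : z ≠ 1) (hz2 : z ≠ -1) :
    H0 φ z = Real.sqrt n / (4 * Real.pi) * ∫ y : ℝ,
      2 * (cexp (-(n * ((‖iteratedDeriv 2 φ 1‖ : ℝ) : ℂ) / 2 * (y : ℂ) ^ 2)) *
        cauchyKernel z 0) := by
  set A := ‖iteratedDeriv 2 φ 1‖ with hA
  have hn' : (0 : ℝ) < n := by positivity
  have e1 : ∫ y : ℝ, cexp (-(n * (A : ℂ) / 2 * (y : ℂ) ^ 2))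
      = ((Real.sqrt (Real.pi / (n * A / 2)) : ℝ) : ℂ) := by
    rw [← integral_gaussian, ← integral_complex_ofReal]
    congr 1; ext y; push_cast; congr 1; ring
  rw [integral_const_mul, integral_mul_const, e1]
  have k0 : cauchyKernel z 0 = 2 / (1 - z ^ 2) := by
    have a1 : 1 - z ≠ 0 := sub_ne_zero.2 hz1.symm
    have a2 : 1 + z ≠ 0 := by
      intro h; apply hz2; linear_combination h
    have a3 : 1 - z ^ 2 ≠ 0 := by
      rw [show 1 - z ^ 2 = (1 - z) * (1 + z) by ring]; exact mul_ne_zero a1 a2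
    rw [cauchyKernel, add_zero, add_zero]
    field_simp
    ring
  rw [H0, k0, ← hA]
  have e2 : 1 / Real.sqrt (2 * Real.pi * A)
      = Real.sqrt n / (4 * Real.pi) * (2 * Real.sqrt (Real.pi / (n * A / 2))) := by
    have hpi := Real.pi_pos
    rw [show Real.pi / (n * A / 2) = (2 * Real.pi) ^ 2 / (n * (2 * Real.pi * A)) by
      field_simp, Real.sqrt_div (by positivity), Real.sqrt_sq (by positivity),
      Real.sqrt_mul hn'.le (2 * Real.pi * A)]
    have : Real.sqrt n ≠ 0 := (Real.sqrt_pos.2 hn').ne'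
    have : Real.sqrt (2 * Real.pi * A) ≠ 0 := (Real.sqrt_pos.2 (by positivity)).ne'
    field_simp
    norm_num
  have e3 : (1 : ℂ) / (Real.sqrt (2 * Real.pi * A) : ℂ)
      = Real.sqrt n / (4 * Real.pi) * (2 * (Real.sqrt (Real.pi / (n * A / 2)) : ℂ)) := by
    exact_mod_cast congrArg (fun x : ℝ => (x : ℂ)) e2
  rw [e3]; ring

lemma integrable_gaussian_mul (b : ℝ) (hb : 0 < b) (k : ℂ) :
    Integrable fun y : ℝ => 2 * (cexp (-((b : ℂ) * (y : ℂ) ^ 2)) * k) := by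
  have := (integrable_exp_neg_mul_sq hb).ofReal (𝕜 := ℂ)
  have h2 := (this.mul_const k).const_mul 2
  refine h2.congr (ae_of_all _ fun y => ?_)
  simp only [coe_algebraMap]
  push_cast; ring_nf

set_option maxHeartbeats 600000 in
/-- The saddle point approximation of the Cauchy transform, uniformly away from `±1`. -/
theorem exists_saddle_bound (C₀ : ℝ) {c : ℝ} (hc : 0 < c) : ∃ C : ℝ, 0 ≤ C ∧
    ∀ (n : ℕ) (f φ : ℂ → ℂ), n ≠ 0 → Admissible C₀ n f φ → ∀ z : ℂ, |z.re| ≠ 1 →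
      c ≤ ‖z - 1‖ → c ≤ ‖z + 1‖ →
      ‖(Real.sqrt n : ℂ) * lineTransform f (2 * n) z - H0 φ z‖
        ≤ C / n * (1 + (lineDist z)⁻¹) := by
  -- The cut: c/2 keeps the kernel expansion valid, 1/200 stays in the disc where the phase is
  -- controlled.
  set η : ℝ := min (c / 2) (1 / 200) with hη
  have hη0 : 0 < η := lt_min (by positivity) (by norm_num)
  set Kc : ℝ := 16 / c ^ 3 + 16000 / c + 480 / c ^ 2 + 7200 / c with hKc
  have hKc0 : 0 ≤ Kc := by positivity
  obtain ⟨K1, hK1, hK1'⟩ := exists_sqrt_mul_pow_le (r := (1 + η ^ 2)⁻¹) (by positivity)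
    (inv_lt_one_of_one_lt₀ (by nlinarith))
  obtain ⟨K2, hK2, hK2'⟩ := exists_pow_le_div (r := Real.exp (-(9 / 20 * η ^ 2)))
    (Real.exp_pos _).le (by rw [Real.exp_lt_one_iff]; nlinarith)
  have hpi := Real.pi_pos
  refine ⟨(Kc * 200 + 4 / c * K2) + |C₀| * (1 + η ^ 2) * K1, by positivity, ?_⟩
  intro n f φ hn h z hz h1 h2
  have hn1 : (1 : ℝ) ≤ n := by exact_mod_cast Nat.one_le_iff_ne_zero.2 hn
  have hn0 : (0 : ℝ) < n := by linarith
  set A := ‖iteratedDeriv 2 φ 1‖ with hA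
  obtain ⟨-, hA1, hA2⟩ := h.phase.norm_iteratedDeriv_two
  have hld := lineDist_pos hz
  set ld := lineDist z with hldd
  have hz1 : z ≠ 1 := by rintro rfl; simp at hz
  have hz2 : z ≠ -1 := by rintro rfl; simp at hz
  set g : ℝ → ℂ := fun y => cexp (-(n * φ (linePt y))) * cauchyKernel z (y * I) with hg
  have hgf : ∀ y : ℝ,
      f (linePt y) * ((linePt y)⁻¹ ^ (2 * n) * ((linePt y - z)⁻¹ + (linePt y + z)⁻¹)) = g y := by
    intro y
    rw [← mul_assoc, h.mul_inv_pow_eq (by rw [linePt_re]; norm_num), cauchyKernel_linePt]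
  have hgi : Integrable g := by
    have h3 : Continuous fun y : ℝ => (linePt y)⁻¹ ^ (2 * n) *
        ((linePt y - z)⁻¹ + (linePt y + z)⁻¹) :=
      (continuous_inv_linePt.pow _).mul
        ((Continuous.inv₀ (by fun_prop) (linePt_sub_ne_zero hz)).add
        (Continuous.inv₀ (by fun_prop) (linePt_add_ne_zero hz)))
    have h4 := h.decay.integrable_linePt_mul h.entire.continuous h3 (B := ld⁻¹ + ld⁻¹) (by
      intro y
      rw [norm_mul, norm_pow]
      refine (mul_le_of_le_one_left (norm_nonneg _)
        (pow_le_one₀ (norm_nonneg _) (norm_inv_linePt_le y))).trans ?_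
      exact (norm_add_le _ _).trans
        (add_le_add (norm_inv_linePt_sub_le hz y) (norm_inv_linePt_add_le hz y)))
    exact h4.congr (ae_of_all _ hgf)
  set m : ℝ → ℂ := fun y => 2 * (cexp (-(n * (A : ℂ) / 2 * (y : ℂ) ^ 2)) * cauchyKernel z 0)
    with hm
  have hmi : Integrable m := by
    have := integrable_gaussian_mul (n * A / 2) (by positivity) (cauchyKernel z 0)
    refine this.congr (ae_of_all _ fun y => ?_)
    simp only [hm]; push_cast; rfl
  have hgneg : ∫ y, g (-y) = ∫ y, g y := integral_neg_eq_self g volume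
  have hH : H0 φ z = Real.sqrt n / (4 * Real.pi) * ∫ y, m y := H0_eq hn (by linarith) hz1 hz2
  -- The integral is counted twice, at y and at -y, whence 4π instead of 2π.
  have hI : (Real.sqrt n : ℂ) * lineTransform f (2 * n) z - H0 φ z
      = Real.sqrt n / (4 * Real.pi) * ∫ y, (g y + g (-y) - m y) := by
    rw [integral_sub (f := fun y => g y + g (-y)) (hgi.add hgi.comp_neg) hmi,
      integral_add hgi hgi.comp_neg, hgneg, hH, lineTransform]
    simp_rw [hgf]
    have : (Real.pi : ℂ) ≠ 0 := by exact_mod_cast hpi.ne'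
    field_simp
    ring
  -- Beyond the cut z may be arbitrarily close to the line, and only this bound is available. It
  -- multiplies an exponentially small factor and is the sole source of the singular term in the
  -- conclusion.
  have hker : ∀ y : ℝ, ‖cauchyKernel z (y * I)‖ ≤ 2 * ld⁻¹ := by
    intro y
    rw [← cauchyKernel_linePt, two_mul]
    exact (norm_add_le _ _).trans
      (add_le_add (norm_inv_linePt_sub_le hz y) (norm_inv_linePt_add_le hz y))
  have hk0 : ‖cauchyKernel z 0‖ ≤ 2 / c := by
    have a := inv_add_bounds hc (b := 1 - z) (t := 0) (by rwa [norm_sub_rev]) (by simp; positivity)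
    rw [cauchyKernel, add_zero, add_zero]
    have i1 : ‖(1 - z)⁻¹‖ ≤ 1 / c := by
      rw [norm_inv, one_div, norm_sub_rev]; gcongr
    have i2 : ‖(1 + z)⁻¹‖ ≤ 1 / c := by
      rw [norm_inv, one_div, add_comm]; gcongr
    calc _ ≤ _ := norm_add_le _ _
      _ ≤ 1 / c + 1 / c := add_le_add i1 i2
      _ = _ := by ring
  have hC0 : 0 ≤ C₀ := by linarith [h.one_le]
  -- Of the n factors (1 + y²)⁻¹, one is kept for integrability and the other n - 1 are replaced by
  -- their value at η.
  set Q : ℝ := ((1 + η ^ 2)⁻¹) ^ n * (1 + η ^ 2) with hQ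
  have hQ0 : 0 ≤ Q := by positivity
  have hbound : ∀ y : ℝ, ‖g y + g (-y) - m y‖
      ≤ (Kc * 200 / n + 4 / c * (K2 / n)) * Real.exp (-(n / 2) * y ^ 2)
        + (4 * C₀ * ld⁻¹ * Q) * (1 + y ^ 2)⁻¹ := by
    intro y
    rcases le_or_gt |y| η with hy | hy
    · have hs := h.phase.symmetric_bound hc n h1 h2 (y := y)
        (hy.trans (min_le_left _ _)) ((hy.trans (min_le_right _ _)).trans_lt (by norm_num))
      have e1 : g y + g (-y) - m y = cexp (-(n * φ (1 + y * I))) * cauchyKernel z (y * I)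
          + cexp (-(n * φ (1 + (-(y * I))))) * cauchyKernel z (-(y * I))
          - 2 * (cexp (-(n * ((‖iteratedDeriv 2 φ 1‖ : ℝ) : ℂ) / 2 * (y : ℂ) ^ 2)) *
        cauchyKernel z 0) := by
        simp only [hg, hm, linePt_neg]
        simp [linePt, hA]
      rw [e1]
      refine hs.trans ?_
      have hx : 0 ≤ n * y ^ 2 := by positivity
      have e2 : (y ^ 2 + n * y ^ 4 + n ^ 2 * y ^ 6)
          = 1 / n * ((n * y ^ 2) + (n * y ^ 2) ^ 2 + (n * y ^ 2) ^ 3) := by field_simp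
      have e3 := pow_le_mul_exp hx
      have e4 : Real.exp (-(n * y ^ 2 / 2)) = Real.exp (-(n / 2) * y ^ 2) := by congr 1; ring
      rw [e4] at e3
      have e5 : 0 ≤ 4 / c * (K2 / n) * Real.exp (-(n / 2) * y ^ 2) := by positivity
      have e6 : 0 ≤ (4 * C₀ * ld⁻¹ * Q) * (1 + y ^ 2)⁻¹ := by positivity
      calc Kc * ((y ^ 2 + n * y ^ 4 + n ^ 2 * y ^ 6) * Real.exp (-(17 / 20 * (n * y ^ 2))))
          = Kc * (1 / n) * (((n * y ^ 2) + (n * y ^ 2) ^ 2 + (n * y ^ 2) ^ 3)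
            * Real.exp (-(17 / 20 * (n * y ^ 2)))) := by rw [e2]; ring
        _ ≤ Kc * (1 / n) * (200 * Real.exp (-(n / 2) * y ^ 2)) := by gcongr
        _ = Kc * 200 / n * Real.exp (-(n / 2) * y ^ 2) := by ring
        _ ≤ _ := by rw [add_mul]; linarith
    · have hy2 : η ^ 2 ≤ y ^ 2 := by rw [← sq_abs y]; gcongr
      have hp : ((1 + y ^ 2)⁻¹) ^ n ≤ Q * (1 + y ^ 2)⁻¹ := by
        obtain ⟨k, rfl⟩ := Nat.exists_eq_succ_of_ne_zero hn
        have e1 : Q = ((1 + η ^ 2)⁻¹) ^ k := by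
          rw [hQ, Nat.succ_eq_add_one, pow_succ, mul_assoc,
            inv_mul_cancel₀ (by positivity), mul_one]
        rw [e1, Nat.succ_eq_add_one, pow_succ]
        gcongr
      have b1 : ∀ x : ℝ, x ^ 2 = y ^ 2 → ‖g x‖ ≤ C₀ * (Q * (1 + y ^ 2)⁻¹) * (2 * ld⁻¹) := by
        intro x hx
        simp only [hg]
        rw [norm_mul]
        have := h.norm_line_le x
        rw [hx] at this
        have h4 := hker x
        have h5 : ‖cexp (-(n * φ (linePt x)))‖ ≤ C₀ * (Q * (1 + y ^ 2)⁻¹) :=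
          this.trans (by gcongr)
        gcongr
      have b2 : ‖m y‖ ≤ 4 / c * (K2 / n) * Real.exp (-(n / 2) * y ^ 2) := by
        simp only [hm]
        rw [norm_mul, norm_mul, norm_exp,
          show (-((n : ℂ) * (A : ℂ) / 2 * (y : ℂ) ^ 2)) = ((-(n * A / 2 * y ^ 2) : ℝ) : ℂ) by
          push_cast; ring, ofReal_re, show ‖(2 : ℂ)‖ = 2 by simp]
        have e1 : Real.exp (-(n * A / 2 * y ^ 2))
            ≤ Real.exp (-(9 / 20 * η ^ 2)) ^ n * Real.exp (-(n / 2) * y ^ 2) := by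
          rw [← exp_neg_mul_eq_pow, ← Real.exp_add]
          apply Real.exp_le_exp.2
          have e2 : (n : ℝ) * η ^ 2 ≤ n * y ^ 2 := by gcongr
          have e3 : 19 / 10 * (n * y ^ 2) ≤ A * (n * y ^ 2) :=
            mul_le_mul_of_nonneg_right hA1 (by positivity)
          have e4 : n * A / 2 * y ^ 2 = A * (n * y ^ 2) / 2 := by ring
          rw [e4]
          have e5 : -((n : ℝ) / 2) * y ^ 2 = -(n * y ^ 2) / 2 := by ring
          have e6 : (n : ℝ) * (9 / 20 * η ^ 2) = 9 / 20 * (n * η ^ 2) := by ring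
          rw [e5, e6]
          linarith
        have e7 := hK2' n hn
        calc 2 * (Real.exp (-(n * A / 2 * y ^ 2)) * ‖cauchyKernel z 0‖)
            ≤ 2 * ((K2 / n * Real.exp (-(n / 2) * y ^ 2)) * (2 / c)) := by
              gcongr
              exact e1.trans (by gcongr)
          _ = _ := by ring
      have b3 : 0 ≤ Kc * 200 / n * Real.exp (-(n / 2) * y ^ 2) := by positivity
      calc ‖g y + g (-y) - m y‖ ≤ ‖g y‖ + ‖g (-y)‖ + ‖m y‖ :=
            (norm_sub_le _ _).trans (add_le_add_left (norm_add_le _ _) _)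
        _ ≤ _ := by
          have := b1 y rfl
          have h6 := b1 (-y) (by ring)
          rw [add_mul]
          linarith
  have hgauss : Integrable fun y : ℝ => Real.exp (-(n / 2) * y ^ 2) :=
    integrable_exp_neg_mul_sq (by positivity)
  have hB : ‖∫ y, (g y + g (-y) - m y)‖ ≤ ∫ y : ℝ, ((Kc * 200 / n + 4 / c * (K2 / n)) *
      Real.exp (-(n / 2) * y ^ 2) + (4 * C₀ * ld⁻¹ * Q) * (1 + y ^ 2)⁻¹) :=
    norm_integral_le_of_norm_le
      ((hgauss.const_mul _).add (integrable_inv_one_add_sq.const_mul _)) (ae_of_all _ hbound)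
  rw [integral_add (hgauss.const_mul _) (integrable_inv_one_add_sq.const_mul _),
    integral_const_mul, integral_const_mul, integral_gaussian, integral_univ_inv_one_add_sq] at hB
  rw [hI, norm_mul]
  have hsn : 0 < Real.sqrt n := Real.sqrt_pos.2 hn0
  have hnorm : ‖(Real.sqrt n : ℂ) / (4 * Real.pi)‖ = Real.sqrt n / (4 * Real.pi) := by
    rw [show (Real.sqrt n : ℂ) / (4 * Real.pi) = ((Real.sqrt n / (4 * Real.pi) : ℝ) : ℂ) by
      push_cast; rfl, norm_real, Real.norm_of_nonneg (by positivity)]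
  rw [hnorm]
  have hsq : Real.sqrt n * Real.sqrt (Real.pi / (n / 2)) ≤ 4 * Real.pi := by
    rw [← Real.sqrt_mul hn0.le]
    rw [show (n : ℝ) * (Real.pi / (n / 2)) = 2 * Real.pi by field_simp]
    rw [Real.sqrt_le_left (by positivity)]
    nlinarith [Real.pi_gt_three]
  have hQn : Real.sqrt n * Q ≤ (1 + η ^ 2) * K1 / n := by
    have := hK1' n hn
    calc Real.sqrt n * Q = (1 + η ^ 2) * (Real.sqrt n * ((1 + η ^ 2)⁻¹) ^ n) := by rw [hQ]; ring
      _ ≤ (1 + η ^ 2) * (K1 / n) := by gcongr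
      _ = _ := by ring
  set P : ℝ := Kc * 200 / n + 4 / c * (K2 / n) with hP
  have hP0 : 0 ≤ P := by positivity
  calc Real.sqrt n / (4 * Real.pi) * ‖∫ y, (g y + g (-y) - m y)‖
      ≤ Real.sqrt n / (4 * Real.pi) * (P * Real.sqrt (Real.pi / (n / 2))
        + 4 * C₀ * ld⁻¹ * Q * Real.pi) := by gcongr
    _ = P * (Real.sqrt n * Real.sqrt (Real.pi / (n / 2))) / (4 * Real.pi)
        + C₀ * ld⁻¹ * (Real.sqrt n * Q) := by field_simp
    _ ≤ P * (4 * Real.pi) / (4 * Real.pi) + C₀ * ld⁻¹ * ((1 + η ^ 2) * K1 / n) := by gcongr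
    _ = P + C₀ * ld⁻¹ * ((1 + η ^ 2) * K1 / n) := by field_simp
    _ = (Kc * 200 + 4 / c * K2) / n + (C₀ * (1 + η ^ 2) * K1) / n * ld⁻¹ := by rw [hP]; ring
    _ ≤ _ := by
      rw [abs_of_nonneg hC0]
      have p1 : 0 ≤ (Kc * 200 + 4 / c * K2) / n := by positivity
      have p2 : 0 ≤ (C₀ * (1 + η ^ 2) * K1) / n := by positivity
      have p3 : 0 < ld⁻¹ := by positivity
      generalize (Kc * 200 + 4 / c * K2) = X at *
      generalize (C₀ * (1 + η ^ 2) * K1) = Y at *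
      have e : (X + Y) / n * (1 + ld⁻¹) = X / n + Y / n * ld⁻¹ + X / n * ld⁻¹ + Y / n := by ring
      rw [e]
      linarith [mul_nonneg p1 p3.le]

end SaddlePointIntegral

end LTaylor

namespace LTaylor

/-! ### Removing the singularity of the bound at the lines |Re z| = 1. -/

section NearLines

open MeasureTheory Metric Set

lemma H0_neg (φ : ℂ → ℂ) (z : ℂ) : H0 φ (-z) = H0 φ z := by simp [H0]

lemma taylorPoly_neg {f : ℂ → ℂ} (he : ∀ z, f (-z) = f z) (m : ℕ) (z : ℂ) :
    taylorPoly f m (-z) = taylorPoly f m z := by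
  unfold taylorPoly
  refine Finset.sum_congr rfl fun k _ => ?_
  have h1 := iteratedDeriv_comp_neg k f 0
  simp only [he, neg_zero, smul_eq_mul] at h1
  rw [neg_pow]
  linear_combination -(z ^ k / (k.factorial : ℂ)) * h1

/-- The scaled polynomial `-T z / z ^ (2 n)`. -/
noncomputable def outerPart (f : ℂ → ℂ) (n : ℕ) (z : ℂ) : ℂ :=
  -(taylorPoly f (2 * n - 1) z * z⁻¹ ^ (2 * n))

lemma differentiableAt_outerPart (f : ℂ → ℂ) (n : ℕ) {z : ℂ} (hz : z ≠ 0) :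
    DifferentiableAt ℂ (outerPart f n) z := by
  unfold outerPart
  exact ((differentiable_taylorPoly f _ z).mul ((differentiableAt_inv hz).pow _)).neg

lemma outerPart_neg {f : ℂ → ℂ} (he : ∀ z, f (-z) = f z) (n : ℕ) (z : ℂ) :
    outerPart f n (-z) = outerPart f n z := by
  simp only [outerPart]
  rw [taylorPoly_neg he, inv_neg, Even.neg_pow (even_two_mul n)]

lemma pow_mul_inv_pow {z : ℂ} (hz : z ≠ 0) (k : ℕ) : z ^ k * z⁻¹ ^ k = 1 := by
  rw [← mul_pow, mul_inv_cancel₀ hz, one_pow]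

lemma differentiableAt_H0 (φ : ℂ → ℂ) {z : ℂ} (h1 : z ≠ 1) (h2 : z ≠ -1) :
    DifferentiableAt ℂ (H0 φ) z := by
  unfold H0
  have : 1 - z ^ 2 ≠ 0 := by
    rw [show 1 - z ^ 2 = (1 - z) * (1 + z) by ring]
    refine mul_ne_zero (sub_ne_zero.2 h1.symm) fun h => h2 (by linear_combination h)
  fun_prop (disch := assumption)

lemma differentiableAt_mul_inv_pow {f : ℂ → ℂ} (hf : Differentiable ℂ f) (k : ℕ) {z : ℂ}
    (hz : z ≠ 0) : DifferentiableAt ℂ (fun z => f z * z⁻¹ ^ k) z :=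
  (hf z).mul ((differentiableAt_inv hz).pow _)

namespace Admissible

variable {C₀ : ℝ} {n : ℕ} {f φ : ℂ → ℂ} (h : Admissible C₀ n f φ)
include h

/-- Outside the strip the transform equals `outerPart`, which is analytic except at 0 and so
continues it across the lines; inside, the transform exceeds it by the jump f z^{-2n}. -/
lemma lineTransform_eq_outerPart (hn : n ≠ 0) {z : ℂ} (hz : 1 < |z.re|) :
    lineTransform f (2 * n) z = outerPart f n z := by
  have h1 := pow_mul_lineTransform h.entire h.decay h.even hn hz.ne'
  have hz0 : z ≠ 0 := by rintro rfl; simp at hz; linarith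
  have hchi : chi z = 0 := indicator_of_notMem (by simpa using hz.le) _
  rw [hchi, zero_mul, zero_sub] at h1
  rw [outerPart, ← neg_mul, ← h1]
  linear_combination -(lineTransform f (2 * n) z) * (pow_mul_inv_pow hz0 (2 * n))

lemma lineTransform_eq_add (hn : n ≠ 0) {z : ℂ} (hz : |z.re| < 1) (hz0 : z ≠ 0) :
    lineTransform f (2 * n) z = outerPart f n z + f z * z⁻¹ ^ (2 * n) := by
  have h1 := pow_mul_lineTransform h.entire h.decay h.even hn hz.ne
  have hchi : chi z = 1 := indicator_of_mem (by simpa using hz) _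
  rw [hchi, one_mul] at h1
  have h2 : outerPart f n z + f z * z⁻¹ ^ (2 * n)
      = (f z - taylorPoly f (2 * n - 1) z) * z⁻¹ ^ (2 * n) := by rw [outerPart]; ring
  rw [h2, ← h1]
  linear_combination -(lineTransform f (2 * n) z) * (pow_mul_inv_pow hz0 (2 * n))

lemma norm_real_le {x : ℝ} (hx : |x| < 1 / 100) :
    ‖f ((1 + x : ℝ) : ℂ)‖ ≤ (1 + x) ^ (2 * n) * Real.exp (21 / 20 * x ^ 2) ^ n := by
  have hx' := abs_lt.1 hx
  have hb : ((1 + x : ℝ) : ℂ) ∈ ball (1 : ℂ) (1 / 100) := by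
    rw [mem_ball_iff_norm, show ((1 + x : ℝ) : ℂ) - 1 = (x : ℂ) by push_cast; ring, norm_real]
    exact hx
  have h1 := h.mul_inv_pow_eq (z := ((1 + x : ℝ) : ℂ)) (by rw [ofReal_re]; linarith)
  have h0 : ((1 + x : ℝ) : ℂ) ≠ 0 := ofReal_ne_zero.2 (by linarith)
  have h2 : f ((1 + x : ℝ) : ℂ) = ((1 + x : ℝ) : ℂ) ^ (2 * n) * cexp (-(n * φ ((1 + x : ℝ) : ℂ))) := by
    rw [← h1]; linear_combination -(f ((1 + x : ℝ) : ℂ)) * pow_mul_inv_pow h0 (2 * n)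
  rw [h2, norm_mul, norm_pow, norm_real, Real.norm_of_nonneg (by linarith), norm_exp,
    ← Real.exp_nat_mul]
  refine mul_le_mul_of_nonneg_left (Real.exp_le_exp.2 ?_) (pow_nonneg (by linarith) _)
  have h3 := h.phase.norm_add_sq_le hb
  rw [show ((1 + x : ℝ) : ℂ) - 1 = (x : ℂ) by push_cast; ring, norm_real, Real.norm_eq_abs,
    sq_abs] at h3
  have h4 := (abs_le.1 ((abs_re_le_norm _).trans h3)).1
  rw [add_re, ← ofReal_pow, ofReal_re] at h4
  have h5 : (-((n : ℂ) * φ ((1 + x : ℝ) : ℂ))).re = n * -(φ ((1 + x : ℝ) : ℂ)).re := by simp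
  rw [h5]
  gcongr
  linarith

/-- The jump is exponentially small near the line and away from ±1. Passing to the real point 1 + x
costs at most e^{(21/20) x²} per power, with (21/20)(c/24)² < c²/500, while |y| ≥ c/4 gains 1 +
c²/64. -/
lemma norm_mul_inv_pow_le {c : ℝ} (hc : 0 < c) (hc1 : c ≤ 1) {x y : ℝ} (hx : |x| < c / 24)
    (hx2 : |x| < 1 / 100) (hy : c / 4 ≤ |y|) :
    ‖f ((1 + x : ℝ) + y * I) * ((1 + x : ℝ) + y * I : ℂ)⁻¹ ^ (2 * n)‖
      ≤ C₀ * ((1 - c ^ 2 / 500) * (1 + c ^ 2 / 64))⁻¹ ^ n := by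
  have hx' := abs_lt.1 hx2
  have h1 := h.vertical (1 + x) y (by linarith)
  have h2 := h.norm_real_le hx2
  have hC0 : 0 ≤ C₀ := by linarith [h.one_le]
  have hx4 : x ^ 2 ≤ (c / 24) ^ 2 := by rw [← sq_abs]; gcongr
  have hy2 : (c / 4) ^ 2 ≤ y ^ 2 := by rw [← sq_abs y]; gcongr
  have hc2 : c ^ 2 ≤ 1 := by nlinarith
  have hn : ‖((1 + x : ℝ) + y * I : ℂ)⁻¹ ^ (2 * n)‖ = (((1 + x) ^ 2 + y ^ 2)⁻¹) ^ n := by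
    rw [pow_mul, norm_pow]
    congr 1
    rw [norm_pow, norm_inv, inv_pow, Complex.sq_norm, normSq_apply]
    congr 1; simp; ring
  have hexp : Real.exp (21 / 20 * x ^ 2) ≤ (1 - c ^ 2 / 500)⁻¹ := by
    have h3 := Real.add_one_le_exp (-(21 / 20 * x ^ 2))
    rw [Real.exp_neg] at h3
    have h4 : 1 - c ^ 2 / 500 ≤ (Real.exp (21 / 20 * x ^ 2))⁻¹ := by nlinarith
    have h5 : 0 < 1 - c ^ 2 / 500 := by linarith
    rw [← inv_inv (Real.exp _)]
    gcongr
  have hfrac : (1 + x) ^ 2 * ((1 + x) ^ 2 + y ^ 2)⁻¹ ≤ (1 + c ^ 2 / 64)⁻¹ := by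
    have p1 : 0 < (1 + x) ^ 2 := by nlinarith
    rw [← div_eq_mul_inv, inv_eq_one_div, div_le_div_iff₀ (by positivity) (by positivity)]
    have : (1 + x) ^ 2 ≤ 4 := by nlinarith
    nlinarith [mul_nonneg (sq_nonneg c) (sub_nonneg.2 this)]
  rw [norm_mul, hn]
  have hp0 : 0 ≤ (1 + x) ^ 2 * ((1 + x) ^ 2 + y ^ 2)⁻¹ := by positivity
  calc ‖f ((1 + x : ℝ) + y * I)‖ * (((1 + x) ^ 2 + y ^ 2)⁻¹) ^ n
      ≤ (C₀ * ((1 + x) ^ (2 * n) * Real.exp (21 / 20 * x ^ 2) ^ n))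
        * (((1 + x) ^ 2 + y ^ 2)⁻¹) ^ n := by
        gcongr
        exact h1.trans (by gcongr)
    _ = C₀ * (Real.exp (21 / 20 * x ^ 2) * ((1 + x) ^ 2 * ((1 + x) ^ 2 + y ^ 2)⁻¹)) ^ n := by
        rw [mul_pow, mul_pow, pow_mul]; ring
    _ ≤ C₀ * ((1 - c ^ 2 / 500)⁻¹ * (1 + c ^ 2 / 64)⁻¹) ^ n := by
        have : 0 ≤ (1 - c ^ 2 / 500)⁻¹ := inv_nonneg.2 (by linarith)
        gcongr
    _ = _ := by rw [← mul_inv]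

end Admissible

/-- On the circle ρ² is u times its conjugate, so the sum is u times twice Re u. For ρ > 0 it
vanishes only where the circle meets the vertical diameter. -/
lemma norm_sq_add_sq_of_norm_eq {u : ℂ} {ρ : ℝ} (h : ‖u‖ = ρ) :
    ‖u ^ 2 + (ρ : ℂ) ^ 2‖ = 2 * ρ * |u.re| := by
  have h1 : (ρ : ℂ) ^ 2 = u * (starRingEnd ℂ) u := by
    rw [mul_conj, normSq_eq_norm_sq, h]; push_cast; rfl
  rw [h1, show u ^ 2 + u * (starRingEnd ℂ) u = u * (u + (starRingEnd ℂ) u) by ring, norm_mul, h,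
    add_conj, norm_real, Real.norm_eq_abs, abs_mul, abs_two]
  ring

/-- A bound with a simple pole on the vertical diameter of a disc improves to a uniform bound on
its horizontal diameter. -/
lemma norm_le_of_norm_le_one_add_inv {G : ℂ → ℂ} {p : ℂ} {ρ M : ℝ} (hρ : 0 < ρ) (hM : 0 ≤ M)
    (hG : DifferentiableOn ℂ G (closedBall p ρ))
    (hb : ∀ ζ ∈ closedBall p ρ, (ζ - p).re ≠ 0 → ‖G ζ‖ ≤ M * (1 + |(ζ - p).re|⁻¹))
    {z : ℂ} (hz : z ∈ ball p ρ) (him : (z - p).im = 0) : ‖G z‖ ≤ M * (2 * (ρ + 1) / ρ) := by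
  -- The multiplier cancels the pole of the bound at the two points where the circle meets the
  -- vertical diameter, and is at least ρ² on the horizontal one, so the maximum principle applies.
  have hd : DiffContOnCl ℂ (fun ζ => G ζ * ((ζ - p) ^ 2 + (ρ : ℂ) ^ 2)) (ball p ρ) := by
    apply DifferentiableOn.diffContOnCl
    rw [closure_ball _ hρ.ne']
    exact hG.mul (by fun_prop)
  have hmax := norm_le_of_forall_mem_frontier_norm_le isBounded_ball hd (C := M * (2 * ρ * (ρ + 1)))
    (by
      intro ζ hζ
      rw [frontier_ball _ hρ.ne', mem_sphere_iff_norm] at hζ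
      rw [norm_mul, norm_sq_add_sq_of_norm_eq hζ]
      by_cases hr : (ζ - p).re = 0
      · rw [hr, abs_zero, mul_zero, mul_zero]; positivity
      · have h1 := hb ζ (mem_closedBall_iff_norm.2 hζ.le) hr
        have h2 : |(ζ - p).re| ≤ ρ := hζ ▸ abs_re_le_norm _
        have h3 : 0 < |(ζ - p).re| := abs_pos.2 hr
        calc ‖G ζ‖ * (2 * ρ * |(ζ - p).re|)
            ≤ M * (1 + |(ζ - p).re|⁻¹) * (2 * ρ * |(ζ - p).re|) := by gcongr
          _ = M * (2 * ρ * (|(ζ - p).re| + 1)) := by field_simp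
          _ ≤ _ := by gcongr) (subset_closure hz)
  rw [norm_mul] at hmax
  have h4 : ρ ^ 2 ≤ ‖(z - p) ^ 2 + (ρ : ℂ) ^ 2‖ := by
    have : (z - p) = (((z - p).re : ℝ) : ℂ) := by apply Complex.ext <;> simp [him]
    rw [this, ← ofReal_pow, ← ofReal_pow, ← ofReal_add, norm_real,
      Real.norm_of_nonneg (by positivity)]
    nlinarith [sq_nonneg (z - p).re]
  have h5 : ‖G z‖ * ρ ^ 2 ≤ M * (2 * ρ * (ρ + 1)) :=
    (mul_le_mul_of_nonneg_left h4 (norm_nonneg _)).trans hmax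
  rw [show M * (2 * (ρ + 1) / ρ) = M * (2 * ρ * (ρ + 1)) / ρ ^ 2 by field_simp,
    le_div_iff₀ (by positivity)]
  exact h5

/-- Away from `±1` both `-T z / z ^ (2 n)` (outside) and the Cauchy transform (inside) are
approximated by `H₀`, up to the lines `|Re z| = 1`. -/
theorem exists_outer_inner_bound (C₀ : ℝ) {c : ℝ} (hc : 0 < c) : ∃ C : ℝ, 0 ≤ C ∧
    ∀ (n : ℕ) (f φ : ℂ → ℂ), n ≠ 0 → Admissible C₀ n f φ → ∀ z : ℂ,
      c ≤ ‖z - 1‖ → c ≤ ‖z + 1‖ →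
      (1 ≤ |z.re| → ‖(Real.sqrt n : ℂ) * outerPart f n z - H0 φ z‖ ≤ C / n) ∧
      (|z.re| ≤ 1 → z ≠ 0 → ‖(Real.sqrt n : ℂ) * (outerPart f n z + f z * z⁻¹ ^ (2 * n))
        - H0 φ z‖ ≤ C / n) ∧
      (|z.re| < 1 → ‖(Real.sqrt n : ℂ) * lineTransform f (2 * n) z - H0 φ z‖ ≤ C / n) := by
  wlog hc1 : c ≤ 1 / 10 generalizing c
  · obtain ⟨C, hC, H⟩ := this (c := 1 / 10) (by norm_num) le_rfl
    refine ⟨C, hC, fun n f φ hn h z h1 h2 => H n f φ hn h z ?_ ?_⟩ <;> linarith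
  -- Discs of radius 2ε = c/25 < c/24 about a point of the line keep |Im ζ| ≥ c/4, so the jump is
  -- exponentially small on all of them.
  set ε : ℝ := c / 50 with hε
  have hε0 : 0 < ε := by positivity
  obtain ⟨C1, hC1, H1⟩ := exists_saddle_bound C₀ (c := c / 4) (by positivity)
  set r : ℝ := ((1 - c ^ 2 / 500) * (1 + c ^ 2 / 64))⁻¹ with hr
  have hc2 : c ^ 2 ≤ 1 / 100 := by nlinarith
  have hr1 : 1 < (1 - c ^ 2 / 500) * (1 + c ^ 2 / 64) := by nlinarith [sq_nonneg (c ^ 2), pow_pos hc 2]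
  obtain ⟨K, hK, HK⟩ := exists_sqrt_mul_pow_le (r := r) (by rw [hr]; positivity)
    (by rw [hr]; exact inv_lt_one_of_one_lt₀ hr1)
  set M : ℝ := C1 + |C₀| * K with hM
  have hM0 : 0 ≤ M := by positivity
  set S : ℝ := M * (2 * (2 * ε + 1) / (2 * ε)) + |C₀| * K with hS
  have hS0 : 0 ≤ S := by positivity
  refine ⟨C1 * (1 + ε⁻¹) + S, by positivity, ?_⟩
  intro n f φ hn h
  have hn1 : (1 : ℝ) ≤ n := by exact_mod_cast Nat.one_le_iff_ne_zero.2 hn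
  have hn0 : (0 : ℝ) < n := by linarith
  have hC0 : 0 ≤ C₀ := by linarith [h.one_le]
  have hgs : ∀ ζ : ℂ, |ζ.re - 1| < c / 24 → |ζ.re - 1| < 1 / 100 → c / 4 ≤ |ζ.im| →
      ‖(Real.sqrt n : ℂ) * (f ζ * ζ⁻¹ ^ (2 * n))‖ ≤ |C₀| * K / n := by
    intro ζ h1 h2 h3
    have h4 := h.norm_mul_inv_pow_le hc (by linarith) h1 h2 h3
    have e : ((1 + (ζ.re - 1) : ℝ) + ζ.im * I : ℂ) = ζ := by
      rw [show 1 + (ζ.re - 1) = ζ.re by ring, re_add_im]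
    rw [e] at h4
    rw [norm_mul, norm_real, Real.norm_of_nonneg (Real.sqrt_nonneg _)]
    calc _ ≤ Real.sqrt n * (C₀ * r ^ n) := by gcongr
      _ = C₀ * (Real.sqrt n * r ^ n) := by ring
      _ ≤ C₀ * (K / n) := by gcongr; exact HK n hn
      _ = _ := by rw [abs_of_nonneg hC0]; ring
  have key : ∀ z : ℂ, |z.re - 1| < ε → c ≤ ‖z - 1‖ →
      ‖(Real.sqrt n : ℂ) * outerPart f n z - H0 φ z‖ ≤ M * (2 * (2 * ε + 1) / (2 * ε)) / n ∧
      ‖(Real.sqrt n : ℂ) * (f z * z⁻¹ ^ (2 * n))‖ ≤ |C₀| * K / n := by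
    intro z hz1 hz2
    have him : c / 2 ≤ |z.im| := by
      have h1 := norm_le_abs_re_add_abs_im (z - 1)
      simp only [sub_re, one_re, sub_im, one_im, sub_zero] at h1
      linarith
    refine ⟨?_, hgs z (by linarith) (by linarith) (by linarith)⟩
    set p : ℂ := linePt z.im with hp
    have hpre : p.re = 1 := linePt_re _
    have hpim : p.im = z.im := linePt_im _
    have hgeom : ∀ ζ ∈ closedBall p (2 * ε), |ζ.re - 1| ≤ 2 * ε ∧ c / 4 ≤ |ζ.im| := by
      intro ζ hζ
      rw [mem_closedBall_iff_norm] at hζ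
      have h1 := (abs_re_le_norm _).trans hζ
      have h2 := (abs_im_le_norm _).trans hζ
      rw [sub_re, hpre] at h1
      rw [sub_im, hpim] at h2
      refine ⟨h1, ?_⟩
      have := abs_sub_abs_le_abs_sub z.im ζ.im
      rw [abs_sub_comm] at this
      linarith
    have hne : ∀ ζ ∈ closedBall p (2 * ε), ζ ≠ 0 ∧ ζ ≠ 1 ∧ ζ ≠ -1 := by
      intro ζ hζ
      have h2 := (hgeom ζ hζ).2
      refine ⟨?_, ?_, ?_⟩ <;> rintro rfl <;> simp at h2 <;> linarith
    have hfin := norm_le_of_norm_le_one_add_inv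
      (G := fun ζ => (Real.sqrt n : ℂ) * outerPart f n ζ - H0 φ ζ) (p := p) (ρ := 2 * ε)
      (M := M / n) (by positivity) (by positivity)
      (fun ζ hζ => (((differentiableAt_outerPart f n (hne ζ hζ).1).const_mul _).sub
        (differentiableAt_H0 φ (hne ζ hζ).2.1 (hne ζ hζ).2.2)).differentiableWithinAt)
      ?_ (z := z) ?_ ?_
    · refine hfin.trans (le_of_eq ?_); ring
    · intro ζ hζ hre
      obtain ⟨g1, g2⟩ := hgeom ζ hζ
      have g1' := abs_le.1 g1
      rw [sub_re, hpre] at hre ⊢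
      have habs : |ζ.re| = ζ.re := abs_of_pos (by linarith)
      have hld : lineDist ζ = |ζ.re - 1| := by rw [lineDist, habs, abs_sub_comm]
      have n1 : c / 4 ≤ ‖ζ - 1‖ := by
        have := abs_im_le_norm (ζ - 1)
        rw [sub_im, one_im, sub_zero] at this
        linarith
      have n2 : c / 4 ≤ ‖ζ + 1‖ := by
        have := abs_im_le_norm (ζ + 1)
        rw [add_im, one_im, add_zero] at this
        linarith
      have hs := H1 n f φ hn h ζ (by rw [habs]; exact fun e => hre (by linarith)) n1 n2
      rw [hld] at hs
      have hx : 0 ≤ |ζ.re - 1|⁻¹ := by positivity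
      have hCK : 0 ≤ |C₀| * K / n := by positivity
      have e : M / n * (1 + |ζ.re - 1|⁻¹) = C1 / n * (1 + |ζ.re - 1|⁻¹) + |C₀| * K / n
          + |C₀| * K / n * |ζ.re - 1|⁻¹ := by rw [hM]; ring
      rw [e]
      rcases lt_or_gt_of_ne (show ζ.re ≠ 1 from fun e => hre (by linarith)) with hlt | hgt
      -- On the inner half of the disc the saddle point bound is for `outerPart` plus the jump, and
      -- the jump is subtracted at the cost of an O(1/n) term.
      · rw [h.lineTransform_eq_add hn (by rw [habs]; exact hlt) (hne ζ hζ).1] at hs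
        have h3 := hgs ζ (by linarith) (by linarith) g2
        have h4 : (Real.sqrt n : ℂ) * outerPart f n ζ - H0 φ ζ
            = ((Real.sqrt n : ℂ) * (outerPart f n ζ + f ζ * ζ⁻¹ ^ (2 * n)) - H0 φ ζ)
              - (Real.sqrt n : ℂ) * (f ζ * ζ⁻¹ ^ (2 * n)) := by ring
        simp only [h4]
        refine (norm_sub_le _ _).trans ?_
        linarith [mul_nonneg hCK hx]
      · rw [h.lineTransform_eq_outerPart hn (by rw [habs]; exact hgt)] at hs
        linarith [mul_nonneg hCK hx]
    · rw [mem_ball_iff_norm]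
      have : z - p = ((z.re - 1 : ℝ) : ℂ) := by
        apply Complex.ext <;> simp [hpre, hpim]
      rw [this, norm_real, Real.norm_eq_abs]
      linarith
    · rw [sub_im, hpim, sub_self]
  have e0 : (C1 * (1 + ε⁻¹) + S) / n = C1 / n * (1 + ε⁻¹) + M * (2 * (2 * ε + 1) / (2 * ε)) / n
      + |C₀| * K / n := by rw [hS]; ring
  have p1 : 0 ≤ C1 / n * (1 + ε⁻¹) := by positivity
  have p2 : 0 ≤ M * (2 * (2 * ε + 1) / (2 * ε)) / n := by positivity
  have p3 : 0 ≤ |C₀| * K / n := by positivity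
  have main : ∀ z : ℂ, 0 ≤ z.re → c ≤ ‖z - 1‖ → c ≤ ‖z + 1‖ →
      (1 ≤ |z.re| → ‖(Real.sqrt n : ℂ) * outerPart f n z - H0 φ z‖
        ≤ (C1 * (1 + ε⁻¹) + S) / n) ∧
      (|z.re| ≤ 1 → z ≠ 0 → ‖(Real.sqrt n : ℂ) * (outerPart f n z + f z * z⁻¹ ^ (2 * n))
        - H0 φ z‖ ≤ (C1 * (1 + ε⁻¹) + S) / n) := by
    intro z hz0 h1 h2
    rw [e0, abs_of_nonneg hz0]
    rcases lt_or_ge (|z.re - 1|) ε with hlt | hge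
    · obtain ⟨k1, k2⟩ := key z hlt h1
      refine ⟨fun _ => by linarith, fun _ _ => ?_⟩
      rw [show (Real.sqrt n : ℂ) * (outerPart f n z + f z * z⁻¹ ^ (2 * n)) - H0 φ z
        = ((Real.sqrt n : ℂ) * outerPart f n z - H0 φ z)
          + (Real.sqrt n : ℂ) * (f z * z⁻¹ ^ (2 * n)) by ring]
      refine (norm_add_le _ _).trans ?_
      linarith
    · have habs : |z.re| = z.re := abs_of_nonneg hz0
      have hne : z.re ≠ 1 := by intro e; rw [e] at hge; simp at hge; linarith
      have hld : lineDist z = |z.re - 1| := by rw [lineDist, habs, abs_sub_comm]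
      have hs := H1 n f φ hn h z (by rwa [habs]) (by linarith) (by linarith)
      have hs' : C1 / n * (1 + (lineDist z)⁻¹) ≤ C1 / n * (1 + ε⁻¹) := by
        rw [hld]; gcongr
      constructor
      · intro hz
        rw [h.lineTransform_eq_outerPart hn
          (by rw [habs]; exact lt_of_le_of_ne hz hne.symm)] at hs
        linarith
      · intro hz hz0
        rw [h.lineTransform_eq_add hn (by rw [habs]; exact lt_of_le_of_ne hz hne) hz0] at hs
        linarith
  have main' : ∀ z : ℂ, c ≤ ‖z - 1‖ → c ≤ ‖z + 1‖ →
      (1 ≤ |z.re| → ‖(Real.sqrt n : ℂ) * outerPart f n z - H0 φ z‖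
        ≤ (C1 * (1 + ε⁻¹) + S) / n) ∧
      (|z.re| ≤ 1 → z ≠ 0 → ‖(Real.sqrt n : ℂ) * (outerPart f n z + f z * z⁻¹ ^ (2 * n))
        - H0 φ z‖ ≤ (C1 * (1 + ε⁻¹) + S) / n) := by
    intro z h1 h2
    rcases le_total 0 z.re with h0 | h0
    · exact main z h0 h1 h2
    · have := main (-z) (by simpa using h0)
        (by rwa [show -z - 1 = -(z + 1) by ring, norm_neg])
        (by rwa [show -z + 1 = -(z - 1) by ring, norm_neg])
      rw [outerPart_neg h.even, H0_neg, h.even, inv_neg, Even.neg_pow (even_two_mul n), neg_re,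
        abs_neg, neg_ne_zero] at this
      exact this
  intro z h1 h2
  obtain ⟨a1, a2⟩ := main' z h1 h2
  refine ⟨a1, a2, fun hz => ?_⟩
  -- At 0 the splitting into `outerPart` and jump is meaningless, but `lineDist 0 = 1` and the
  -- saddle point bound applies directly.
  by_cases hz0 : z = 0
  · subst hz0
    have hs := H1 n f φ hn h 0 (by simp) (by simp; linarith) (by simp; linarith)
    refine hs.trans ?_
    rw [e0]
    have : (1 : ℝ) + (lineDist 0)⁻¹ ≤ 1 + ε⁻¹ := by
      have : (1 : ℝ) ≤ ε⁻¹ := (one_le_inv₀ hε0).2 (by linarith)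
      simpa [lineDist] using this
    have : C1 / n * (1 + (lineDist 0)⁻¹) ≤ C1 / n * (1 + ε⁻¹) := by gcongr
    linarith
  · rw [h.lineTransform_eq_add hn hz hz0]
    exact a2 hz.le hz0

end NearLines

end LTaylor

namespace LTaylor

/-! ### The error function approximation near the saddle point. -/

section LocalExpansion

open MeasureTheory Metric Set

/-- A conformal square root `v` of `-φ` near `1`, close to `z ↦ z - 1`. -/
structure LocalRoot (φ v : ℂ → ℂ) : Prop where
  diff : DifferentiableOn ℂ v (ball 1 (1 / 100))
  sq : ∀ z ∈ ball (1 : ℂ) (1 / 100), v z ^ 2 = -φ z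
  at_one : v 1 = 0
  deriv_one : deriv v 1 = (Real.sqrt (‖iteratedDeriv 2 φ 1‖ / 2) : ℂ)
  near : ∀ z ∈ ball (1 : ℂ) (1 / 100), ∀ z' ∈ ball (1 : ℂ) (1 / 100),
    ‖v z - v z' - (z - z')‖ ≤ 1 / 10 * ‖z - z'‖

/-- The part of the ball around `1` where `‖v‖ < δ`. -/
def rootDisk (v : ℂ → ℂ) (δ : ℝ) : Set ℂ := {z ∈ ball (1 : ℂ) (1 / 100) | ‖v z‖ < δ}

/-- The analytic function `H₀ + 1 / (2 √π v)`, with its value at `1` filled in. -/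
noncomputable def rootResidual (φ v : ℂ → ℂ) : ℂ → ℂ :=
  dslope (fun z => -2 / (Real.sqrt (2 * Real.pi * ‖iteratedDeriv 2 φ 1‖) * (1 + z)) +
    (2 * (Real.sqrt Real.pi : ℂ) * dslope v 1 z)⁻¹) 1

/-- The residual error of the `erfc` approximation near `1`. -/
noncomputable def localError (f : ℂ → ℂ) (n : ℕ) (v : ℂ → ℂ) (z : ℂ) : ℂ :=
  (Real.sqrt n : ℂ) * (f z * z⁻¹ ^ (2 * n) * (1 / 2 * erfc (Real.sqrt n * v z)) + outerPart f n z)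

lemma re_pos_of_mem_ball {z : ℂ} (hz : z ∈ ball (1 : ℂ) (1 / 100)) : 99 / 100 < z.re := by
  have h1 := (abs_re_le_norm _).trans_lt (mem_ball_iff_norm.1 hz)
  have := (abs_lt.1 h1).1
  simp at this
  linarith

namespace LocalRoot

variable {φ v : ℂ → ℂ} (h : LocalRoot φ v)
include h

lemma norm_sub_le {z : ℂ} (hz : z ∈ ball (1 : ℂ) (1 / 100)) :
    ‖v z - (z - 1)‖ ≤ 1 / 10 * ‖z - 1‖ := by
  simpa [h.at_one] using h.near z hz 1 one_mem_ball_one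

lemma le_norm {z : ℂ} (hz : z ∈ ball (1 : ℂ) (1 / 100)) : 9 / 10 * ‖z - 1‖ ≤ ‖v z‖ := by
  have h1 := h.norm_sub_le hz
  have h2 := norm_sub_norm_le (z - 1) (v z)
  rw [norm_sub_rev (z - 1) (v z)] at h2
  linarith

lemma norm_le {z : ℂ} (hz : z ∈ ball (1 : ℂ) (1 / 100)) : ‖v z‖ ≤ 11 / 10 * ‖z - 1‖ := by
  have h1 := h.norm_sub_le hz
  have h2 := norm_sub_norm_le (v z) (z - 1)
  linarith

lemma ne_zero {z : ℂ} (hz : z ∈ ball (1 : ℂ) (1 / 100)) (h1 : z ≠ 1) : v z ≠ 0 := by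
  rw [← norm_pos_iff]
  have := norm_pos_iff.2 (sub_ne_zero.2 h1)
  linarith [h.le_norm hz]

/-- The curve Re v = 0 is not the line Re z = 1. Between the two, v is nearly imaginary because v is
close to z - 1, so Re v² is negative and e^{n v²} is negligible. -/
lemma re_sq_le {z : ℂ} (hz : z ∈ ball (1 : ℂ) (1 / 100)) (hs : (v z).re * (z.re - 1) ≤ 0) :
    (v z ^ 2).re ≤ -(9 / 10 * ‖v z‖ ^ 2) := by
  have h1 := (abs_re_le_norm _).trans (h.norm_sub_le hz)
  simp only [sub_re, one_re] at h1
  have h2 := h.le_norm hz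
  have h3 : |(v z).re| ≤ |(v z).re - (z.re - 1)| := by
    rw [← sq_le_sq]; nlinarith [sq_nonneg (z.re - 1)]
  have h4 : |(v z).re| ≤ 1 / 9 * ‖v z‖ := by linarith
  have h5 : (v z).re ^ 2 ≤ (1 / 9 * ‖v z‖) ^ 2 := by rw [← sq_abs]; gcongr
  have h6 : ‖v z‖ ^ 2 = (v z).re ^ 2 + (v z).im ^ 2 := by
    rw [Complex.sq_norm, normSq_apply]; ring
  have h7 : (v z ^ 2).re = (v z).re ^ 2 - (v z).im ^ 2 := by
    rw [pow_two, mul_re]; ring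
  rw [h7]
  nlinarith

lemma isOpen_rootDisk (δ : ℝ) : IsOpen (rootDisk v δ) :=
  h.diff.continuousOn.norm.isOpen_inter_preimage isOpen_ball (isOpen_Iio (a := δ))

/-- From (9/10)‖z - 1‖ ≤ ‖v z‖ the set lies within 1/180 of 1. The ambient ball therefore never cuts
it, and its frontier lies on the curve ‖v‖ = δ. -/
lemma closure_rootDisk_subset {δ : ℝ} (hδ : δ < 1 / 200) :
    closure (rootDisk v δ) ⊆ ball 1 (1 / 100) := by
  have : rootDisk v δ ⊆ closedBall 1 (1 / 180) := by
    intro z hz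
    rw [mem_closedBall_iff_norm]
    linarith [h.le_norm hz.1, hz.2]
  refine (closure_minimal this isClosed_closedBall).trans (closedBall_subset_ball (by norm_num))

lemma norm_eq_of_mem_frontier {δ : ℝ} (hδ : δ < 1 / 200) {z : ℂ}
    (hz : z ∈ frontier (rootDisk v δ)) : z ∈ ball (1 : ℂ) (1 / 100) ∧ ‖v z‖ = δ := by
  have hb := h.closure_rootDisk_subset hδ hz.1
  refine ⟨hb, le_antisymm ?_ ?_⟩
  · have hc : ContinuousAt v z := (h.diff.differentiableAt (isOpen_ball.mem_nhds hb)).continuousAt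
    exact hc.norm.continuousWithinAt.closure_le hz.1 continuousWithinAt_const
      (fun y hy => hy.2.le)
  · by_contra hlt
    rw [(h.isOpen_rootDisk δ).frontier_eq] at hz
    exact hz.2 ⟨hb, not_le.1 hlt⟩

lemma le_norm_dslope {z : ℂ} (hz : z ∈ ball (1 : ℂ) (1 / 100)) (hA : LocalPhase φ) :
    1 / 10 ≤ ‖dslope v 1 z‖ := by
  by_cases h1 : z = 1
  · obtain ⟨-, hA1, -⟩ := hA.norm_iteratedDeriv_two
    rw [h1, dslope_same, h.deriv_one, norm_real, Real.norm_of_nonneg (Real.sqrt_nonneg _)]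
    apply Real.le_sqrt_of_sq_le
    linarith
  · rw [dslope_of_ne _ h1, slope_def_field, h.at_one, sub_zero, norm_div]
    have := norm_pos_iff.2 (sub_ne_zero.2 h1)
    rw [le_div_iff₀ this]
    linarith [h.le_norm hz]

lemma rootResidual_eq (hA : LocalPhase φ) {z : ℂ} (hz : z ∈ ball (1 : ℂ) (1 / 100)) (h1 : z ≠ 1) :
    rootResidual φ v z = H0 φ z + 1 / (2 * (Real.sqrt Real.pi : ℂ) * v z) := by
  obtain ⟨-, hA1, -⟩ := hA.norm_iteratedDeriv_two
  have hpi := Real.pi_pos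
  have hv := h.ne_zero hz h1
  have hz1 : z - 1 ≠ 0 := sub_ne_zero.2 h1
  have hz2 : 1 + z ≠ 0 := fun e => by
    have := congrArg re e
    simp at this
    linarith [re_pos_of_mem_ball hz]
  have hz3 : 1 - z ^ 2 ≠ 0 := by
    rw [show 1 - z ^ 2 = -(z - 1) * (1 + z) by ring]
    exact mul_ne_zero (neg_ne_zero.2 hz1) hz2
  have hs : (Real.sqrt (2 * Real.pi * ‖iteratedDeriv 2 φ 1‖) : ℂ) ≠ 0 :=
    ofReal_ne_zero.2 (Real.sqrt_pos.2 (by positivity)).ne'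
  have hsp : (Real.sqrt Real.pi : ℂ) ≠ 0 := ofReal_ne_zero.2 (Real.sqrt_pos.2 hpi).ne'
  have e1 : Real.sqrt (2 * Real.pi * ‖iteratedDeriv 2 φ 1‖)
      = 2 * Real.sqrt Real.pi * Real.sqrt (‖iteratedDeriv 2 φ 1‖ / 2) := by
    rw [mul_assoc, mul_assoc, ← Real.sqrt_mul hpi.le, show 2 * (Real.pi * ‖iteratedDeriv 2 φ 1‖)
      = 2 ^ 2 * (Real.pi * (‖iteratedDeriv 2 φ 1‖ / 2)) by ring,
      Real.sqrt_mul (by positivity), Real.sqrt_sq (by norm_num)]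
  rw [rootResidual, dslope_of_ne _ h1, slope_def_field, dslope_same, h.deriv_one,
    dslope_of_ne _ h1, slope_def_field, h.at_one, sub_zero, H0]
  -- The residues at 1 of `H0` and of 1/(2√π v) cancel because v'(1) = √(|φ''(1)|/2).
  have e2 : -2 / ((Real.sqrt (2 * Real.pi * ‖iteratedDeriv 2 φ 1‖) : ℂ) * (1 + 1)) +
    (2 * (Real.sqrt Real.pi : ℂ) * (Real.sqrt (‖iteratedDeriv 2 φ 1‖ / 2) : ℂ))⁻¹ = 0 := by
    rw [show (2 * (Real.sqrt Real.pi : ℂ) * (Real.sqrt (‖iteratedDeriv 2 φ 1‖ / 2) : ℂ))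
      = (Real.sqrt (2 * Real.pi * ‖iteratedDeriv 2 φ 1‖) : ℂ) by rw [e1]; push_cast; ring]
    field_simp
    ring
  rw [e2]
  rw [show 1 - z ^ 2 = -(z - 1) * (1 + z) by ring]
  field_simp
  ring

lemma differentiableOn_rootResidual (hA : LocalPhase φ) :
    DifferentiableOn ℂ (rootResidual φ v) (ball 1 (1 / 100)) := by
  obtain ⟨-, hA1, -⟩ := hA.norm_iteratedDeriv_two
  have hpi := Real.pi_pos
  have hn := ball_mem_nhds (1 : ℂ) (show (0 : ℝ) < 1 / 100 by norm_num)
  have hs : (Real.sqrt (2 * Real.pi * ‖iteratedDeriv 2 φ 1‖) : ℂ) ≠ 0 :=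
    ofReal_ne_zero.2 (Real.sqrt_pos.2 (by positivity)).ne'
  have hsp : (Real.sqrt Real.pi : ℂ) ≠ 0 := ofReal_ne_zero.2 (Real.sqrt_pos.2 hpi).ne'
  rw [rootResidual, differentiableOn_dslope hn]
  refine DifferentiableOn.add ?_ (DifferentiableOn.inv ?_ ?_)
  · refine (differentiableOn_const _).div (by fun_prop) fun z hz => mul_ne_zero hs fun e => ?_
    have := congrArg re e
    simp at this
    linarith [re_pos_of_mem_ball hz]
  · exact ((differentiableOn_dslope hn).2 h.diff).const_mul _
  · intro z hz
    refine mul_ne_zero (mul_ne_zero two_ne_zero hsp) (norm_pos_iff.1 ?_)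
    linarith [h.le_norm_dslope hz hA]

lemma differentiableOn_localError {f : ℂ → ℂ} (hf : Differentiable ℂ f) (n : ℕ) :
    DifferentiableOn ℂ (localError f n v) (ball 1 (1 / 100)) := by
  intro z hz
  have hz0 : z ≠ 0 := by
    rintro rfl
    have := re_pos_of_mem_ball hz
    simp at this
    linarith
  have hv := h.diff.differentiableAt (isOpen_ball.mem_nhds hz)
  have h1 : DifferentiableAt ℂ (fun z => erfc (Real.sqrt n * v z)) z :=
    (differentiable_erfc _).comp z (hv.const_mul _)
  exact ((((differentiableAt_mul_inv_pow hf _ hz0).mul (h1.const_mul _)).add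
    (differentiableAt_outerPart f n hz0)).const_mul _).differentiableWithinAt

end LocalRoot

/-- The `erfc` approximation near `1`, with the residual `H₀ + 1 / (2 √π v)`. -/
theorem exists_local_bound (C₀ : ℝ) {δ : ℝ} (hδ0 : 0 < δ) (hδ : δ < 1 / 200) : ∃ C : ℝ, 0 ≤ C ∧
    ∀ (n : ℕ) (f φ v : ℂ → ℂ), n ≠ 0 → Admissible C₀ n f φ → LocalRoot φ v →
      ∀ z ∈ rootDisk v δ, ‖localError f n v z - rootResidual φ v z‖ ≤ C / n ∧
        ‖rootResidual φ v z‖ ≤ C := by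
  obtain ⟨C1, hC1, H1⟩ := exists_outer_inner_bound C₀ (c := δ / 2) (by positivity)
  obtain ⟨C2, hC2, H2⟩ := exists_erfc_asymptotic
  obtain ⟨K, hK, HK⟩ := exists_sqrt_mul_pow_le (r := Real.exp (-(9 / 10 * δ ^ 2)))
    (Real.exp_pos _).le (by rw [Real.exp_lt_one_iff]; nlinarith [pow_pos hδ0 2])
  have hpi := Real.pi_gt_three
  set S : ℝ := C1 + K + C2 / δ ^ 3 with hS
  set R : ℝ := 4 / δ + 1 / δ with hR
  have hC2' := hC2.le
  have hS0 : 0 ≤ S := by positivity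
  have hR0 : 0 ≤ R := by positivity
  refine ⟨S + R, by positivity, ?_⟩
  intro n f φ v hn h hv z hz
  have hn1 : (1 : ℝ) ≤ n := by exact_mod_cast Nat.one_le_iff_ne_zero.2 hn
  have hn0 : (0 : ℝ) < n := by linarith
  have hsn : 0 < Real.sqrt n := Real.sqrt_pos.2 hn0
  have hbdd : Bornology.IsBounded (rootDisk v δ) := isBounded_ball.subset (sep_subset _ _)
  have hcl := hv.closure_rootDisk_subset hδ
  have hsp1 : 1 ≤ Real.sqrt Real.pi := Real.one_le_sqrt.2 (by linarith)
  have hfr : ∀ ζ ∈ frontier (rootDisk v δ), ζ ∈ ball (1 : ℂ) (1 / 100) ∧ ‖v ζ‖ = δ ∧ ζ ≠ 1 ∧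
      δ / 2 ≤ ‖ζ - 1‖ ∧ δ / 2 ≤ ‖ζ + 1‖ ∧ 1 ≤ ‖ζ + 1‖ := by
    intro ζ hζ
    obtain ⟨hb, he⟩ := hv.norm_eq_of_mem_frontier hδ hζ
    have h1 := hv.norm_le hb
    have h2 := re_pos_of_mem_ball hb
    have h3 : 1 ≤ ‖ζ + 1‖ := by
      refine le_trans ?_ (re_le_norm _)
      simp; linarith
    refine ⟨hb, he, ?_, by linarith, by linarith, h3⟩
    rintro rfl
    simp at h1
    rw [h1, norm_zero] at he
    linarith
  constructor
  -- Both functions are analytic up to the closure, so they need comparing only on ‖v‖ = δ, where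
  -- the outer estimate and the expansion of `erfc` are both available.
  · have hd : DiffContOnCl ℂ (fun ζ => localError f n v ζ - rootResidual φ v ζ) (rootDisk v δ) := by
      apply DifferentiableOn.diffContOnCl
      exact ((hv.differentiableOn_localError h.entire n).sub
        (hv.differentiableOn_rootResidual h.phase)).mono hcl
    refine (norm_le_of_forall_mem_frontier_norm_le hbdd hd (C := S / n) ?_ (subset_closure hz)).trans
      (by gcongr; linarith)
    intro ζ hζ
    obtain ⟨hb, he, hne, b1, b2, -⟩ := hfr ζ hζ
    have hre := re_pos_of_mem_ball hb
    have hre0 : |ζ.re| = ζ.re := abs_of_pos (by linarith)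
    have hζ0 : ζ ≠ 0 := by rintro rfl; simp at hre; linarith
    obtain ⟨o1, o2, -⟩ := H1 n f φ hn h ζ b1 b2
    rw [hre0] at o1 o2
    have hv0 := hv.ne_zero hb hne
    have hg : f ζ * ζ⁻¹ ^ (2 * n) = cexp ((Real.sqrt n * v ζ) ^ 2) := by
      rw [h.mul_inv_pow_eq (by linarith), mul_pow, hv.sq ζ hb, ← ofReal_pow,
        Real.sq_sqrt hn0.le, ofReal_natCast, mul_neg]
    -- Covers the points where the sign of Re v and the side of the line disagree: there the jump
    -- may be added or dropped freely.
    have hmis : (v ζ).re * (ζ.re - 1) ≤ 0 →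
        ‖(Real.sqrt n : ℂ) * (f ζ * ζ⁻¹ ^ (2 * n))‖ ≤ K / n := by
      intro hs
      have h1 := hv.re_sq_le hb hs
      rw [hg, norm_mul, norm_real, Real.norm_of_nonneg hsn.le, norm_exp]
      refine le_trans ?_ (HK n hn)
      gcongr
      rw [← Real.exp_nat_mul]
      apply Real.exp_le_exp.2
      rw [mul_pow, ← ofReal_pow, Real.sq_sqrt hn0.le, re_ofReal_mul]
      rw [he] at h1
      gcongr
    have herf : ∀ s : ℂ, 0 ≤ s.re → ‖s‖ = δ → ‖(Real.sqrt n : ℂ) *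
        (cexp ((Real.sqrt n * s) ^ 2) * (1 / 2 * erfc (Real.sqrt n * s)))
        - 1 / (2 * (Real.sqrt Real.pi : ℂ) * s)‖ ≤ C2 / δ ^ 3 / n := by
      intro s hs1 hs2
      have hs0 : s ≠ 0 := by rintro rfl; simp at hs2; linarith
      have hsnc : (Real.sqrt n : ℂ) ≠ 0 := ofReal_ne_zero.2 hsn.ne'
      have h1 := H2 (Real.sqrt n * s) (by rw [re_ofReal_mul]; positivity)
        (mul_ne_zero hsnc hs0)
      have hspc : (Real.sqrt Real.pi : ℂ) ≠ 0 := ofReal_ne_zero.2 (by linarith)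
      have e : (Real.sqrt n : ℂ) *
        (cexp ((Real.sqrt n * s) ^ 2) * (1 / 2 * erfc (Real.sqrt n * s)))
        - 1 / (2 * (Real.sqrt Real.pi : ℂ) * s) = (Real.sqrt n : ℂ) / 2 *
        (cexp ((Real.sqrt n * s) ^ 2) * erfc (Real.sqrt n * s)
          - 1 / ((Real.sqrt Real.pi : ℂ) * (Real.sqrt n * s))) := by
        field_simp
      have e2 : ‖(Real.sqrt n : ℂ) / 2‖ = Real.sqrt n / 2 := by
        rw [norm_div, norm_real, Real.norm_of_nonneg hsn.le]; simp
      rw [e, norm_mul, e2]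
      have e3 : ‖(Real.sqrt n : ℂ) * s‖ = Real.sqrt n * δ := by
        rw [norm_mul, norm_real, Real.norm_of_nonneg hsn.le, hs2]
      rw [e3] at h1
      calc _ ≤ Real.sqrt n / 2 * (C2 / (Real.sqrt n * δ) ^ 3) := by gcongr
        _ = C2 / δ ^ 3 / (Real.sqrt n) ^ 2 / 2 := by field_simp
        _ = C2 / δ ^ 3 / n / 2 := by rw [Real.sq_sqrt hn0.le]
        _ ≤ _ := half_le_self (by positivity)
    have hsum : S / n = C1 / n + K / n + C2 / δ ^ 3 / n := by rw [hS]; ring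
    have hKn : 0 ≤ K / n := by positivity
    rw [hsum, hv.rootResidual_eq h.phase hb hne, localError]
    rcases le_total 0 (v ζ).re with hpos | hneg
    · have h1 := herf (v ζ) hpos he
      rw [← hg] at h1
      have h2 : ‖(Real.sqrt n : ℂ) * outerPart f n ζ - H0 φ ζ‖ ≤ C1 / n + K / n := by
        rcases le_total 1 ζ.re with hz1 | hz1
        · linarith [o1 hz1]
        · have e : (Real.sqrt n : ℂ) * outerPart f n ζ - H0 φ ζ
              = ((Real.sqrt n : ℂ) * (outerPart f n ζ + f ζ * ζ⁻¹ ^ (2 * n)) - H0 φ ζ)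
                - (Real.sqrt n : ℂ) * (f ζ * ζ⁻¹ ^ (2 * n)) := by ring
          rw [e]
          exact (norm_sub_le _ _).trans (add_le_add (o2 hz1 hζ0)
            (hmis (mul_nonpos_of_nonneg_of_nonpos hpos (by linarith))))
      rw [show (Real.sqrt n : ℂ) * (f ζ * ζ⁻¹ ^ (2 * n) * (1 / 2 * erfc (Real.sqrt n * v ζ))
        + outerPart f n ζ) - (H0 φ ζ + 1 / (2 * (Real.sqrt Real.pi : ℂ) * v ζ))
        = ((Real.sqrt n : ℂ) * outerPart f n ζ - H0 φ ζ)
          + ((Real.sqrt n : ℂ) * (f ζ * ζ⁻¹ ^ (2 * n) * (1 / 2 * erfc (Real.sqrt n * v ζ)))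
            - 1 / (2 * (Real.sqrt Real.pi : ℂ) * v ζ)) by ring]
      exact (norm_add_le _ _).trans (add_le_add h2 h1)
    -- For Re v ≤ 0 the reflection erfc(-s) = 2 - erfc(s) produces an extra f z^{-2n}, which turns
    -- `outerPart` into the inner transform.
    · have h1 := herf (-v ζ) (by simpa using hneg) (by rwa [norm_neg])
      rw [mul_neg, neg_sq, ← hg, erfc_neg] at h1
      have h2 : ‖(Real.sqrt n : ℂ) * (outerPart f n ζ + f ζ * ζ⁻¹ ^ (2 * n)) - H0 φ ζ‖
          ≤ C1 / n + K / n := by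
        rcases le_total ζ.re 1 with hz1 | hz1
        · linarith [o2 hz1 hζ0]
        · have e : (Real.sqrt n : ℂ) * (outerPart f n ζ + f ζ * ζ⁻¹ ^ (2 * n)) - H0 φ ζ
              = ((Real.sqrt n : ℂ) * outerPart f n ζ - H0 φ ζ)
                + (Real.sqrt n : ℂ) * (f ζ * ζ⁻¹ ^ (2 * n)) := by ring
          rw [e]
          exact (norm_add_le _ _).trans (add_le_add (o1 hz1)
            (hmis (mul_nonpos_of_nonpos_of_nonneg hneg (by linarith))))
      have hspc : (Real.sqrt Real.pi : ℂ) ≠ 0 := ofReal_ne_zero.2 (by linarith)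
      rw [show (Real.sqrt n : ℂ) * (f ζ * ζ⁻¹ ^ (2 * n) * (1 / 2 * erfc (Real.sqrt n * v ζ))
        + outerPart f n ζ) - (H0 φ ζ + 1 / (2 * (Real.sqrt Real.pi : ℂ) * v ζ))
        = ((Real.sqrt n : ℂ) * (outerPart f n ζ + f ζ * ζ⁻¹ ^ (2 * n)) - H0 φ ζ)
          - ((Real.sqrt n : ℂ) * (f ζ * ζ⁻¹ ^ (2 * n) * (1 / 2 * (2 - erfc (Real.sqrt n * v ζ))))
            - 1 / (2 * (Real.sqrt Real.pi : ℂ) * -v ζ)) by field_simp; ring]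
      exact (norm_sub_le _ _).trans (add_le_add h2 h1)
  · have hd : DiffContOnCl ℂ (rootResidual φ v) (rootDisk v δ) :=
      ((hv.differentiableOn_rootResidual h.phase).mono hcl).diffContOnCl
    refine (norm_le_of_forall_mem_frontier_norm_le hbdd hd (C := R) ?_ (subset_closure hz)).trans
      (by linarith)
    intro ζ hζ
    obtain ⟨hb, he, hne, b1, -, b3⟩ := hfr ζ hζ
    rw [hv.rootResidual_eq h.phase hb hne]
    obtain ⟨-, hA1, -⟩ := h.phase.norm_iteratedDeriv_two
    have k1 : ‖H0 φ ζ‖ ≤ 4 / δ := by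
      have hsA : 1 ≤ Real.sqrt (2 * Real.pi * ‖iteratedDeriv 2 φ 1‖) :=
        Real.one_le_sqrt.2 (by nlinarith)
      rw [H0, show 1 - ζ ^ 2 = -((ζ - 1) * (ζ + 1)) by ring, norm_mul, norm_div, norm_div, norm_one,
        norm_real, Real.norm_of_nonneg (Real.sqrt_nonneg _), norm_neg, norm_mul]
      have : δ / 2 * 1 ≤ ‖ζ - 1‖ * ‖ζ + 1‖ := by gcongr
      calc _ ≤ 1 / 1 * (‖(2 : ℂ)‖ / (δ / 2 * 1)) := by gcongr
        _ = 4 / δ := by rw [RCLike.norm_ofNat]; field_simp; norm_num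
    have k2 : ‖1 / (2 * (Real.sqrt Real.pi : ℂ) * v ζ)‖ ≤ 1 / δ := by
      rw [norm_div, norm_mul, norm_mul, norm_real, Real.norm_of_nonneg (Real.sqrt_nonneg _), he,
        norm_one, RCLike.norm_ofNat]
      gcongr
      nlinarith
    exact (norm_add_le _ _).trans (add_le_add k1 k2)

end LocalExpansion

end LTaylor

namespace LTaylor

/-! ### The expansion on the whole plane for normalised functions. -/

section UniformExpansion

open MeasureTheory Metric Set

/-- The local coordinate `-i v`, continued evenly to the left half-plane. -/
noncomputable def evenCoord (v : ℂ → ℂ) (z : ℂ) : ℂ :=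
  if 0 ≤ z.re then -I * v z else -I * v (-z)

lemma evenCoord_of_mem (v : ℂ → ℂ) {z : ℂ} (hz : z ∈ ball (1 : ℂ) (1 / 100)) :
    evenCoord v z = -I * v z :=
  if_pos (by linarith [re_pos_of_mem_ball hz])

lemma evenCoord_neg_of_mem (v : ℂ → ℂ) {z : ℂ} (hz : z ∈ ball (1 : ℂ) (1 / 100)) :
    evenCoord v (-z) = -I * v z := by
  rw [evenCoord, if_neg (by rw [neg_re]; linarith [re_pos_of_mem_ball hz]), neg_neg]

lemma norm_neg_I_mul (a : ℂ) : ‖-I * a‖ = ‖a‖ := by simp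

lemma mem_localDisks_evenCoord {v : ℂ → ℂ} {δ : ℝ} (hδ : δ ≤ 1 / 200) {z : ℂ} :
    z ∈ localDisks (evenCoord v) (rootDisk v (1 / 200)) δ ↔
      z ∈ rootDisk v δ ∨ -z ∈ rootDisk v δ := by
  constructor
  · rintro ⟨h1 | h1, h2⟩
    · rw [evenCoord_of_mem v h1.1, norm_neg_I_mul] at h2
      exact Or.inl ⟨h1.1, h2⟩
    · rw [← neg_neg z, evenCoord_neg_of_mem v h1.1, norm_neg_I_mul] at h2
      exact Or.inr ⟨h1.1, h2⟩
  · rintro (h1 | h1)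
    · refine ⟨Or.inl ⟨h1.1, h1.2.trans_le hδ⟩, ?_⟩
      rw [evenCoord_of_mem v h1.1, norm_neg_I_mul]
      exact h1.2
    · refine ⟨Or.inr ⟨h1.1, h1.2.trans_le hδ⟩, ?_⟩
      rw [← neg_neg z, evenCoord_neg_of_mem v h1.1, norm_neg_I_mul]
      exact h1.2

namespace LocalRoot

variable {φ v : ℂ → ℂ} (h : LocalRoot φ v)
include h

lemma isLocalCoord : IsLocalCoord φ (evenCoord v) (rootDisk v (1 / 200)) (1 / 200) where
  isOpen := h.isOpen_rootDisk _
  one_mem := ⟨one_mem_ball_one, by rw [h.at_one, norm_zero]; norm_num⟩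
  subset z hz := by
    have := re_pos_of_mem_ball hz.1
    exact (by norm_num : (1 : ℝ) / 2 < 99 / 100).trans this
  holo := by
    refine DifferentiableOn.congr (f := fun z => -I * v z) ?_ fun z hz => evenCoord_of_mem v hz.1
    exact (h.diff.mono (sep_subset _ _)).const_mul _
  inj := by
    intro a ha b hb hab
    rw [evenCoord_of_mem v ha.1, evenCoord_of_mem v hb.1] at hab
    have hv : v a = v b := mul_left_cancel₀ (neg_ne_zero.2 I_ne_zero) hab
    have := h.near a ha.1 b hb.1
    rw [hv, sub_self, zero_sub, norm_neg] at this
    have h0 : ‖a - b‖ = 0 := by linarith [norm_nonneg (a - b)]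
    exact sub_eq_zero.1 (norm_eq_zero.1 h0)
  image := by
    ext a
    simp only [mem_image]
    constructor
    · rintro ⟨z, hz, rfl⟩
      rw [evenCoord_of_mem v hz.1, mem_ball_zero_iff, norm_neg_I_mul]
      exact hz.2
    · intro ha
      rw [mem_ball_zero_iff] at ha
      have hIa : ‖I * a‖ < 1 / 200 := by rwa [norm_mul, norm_I, one_mul]
      obtain ⟨z, hz, hv⟩ := ball_subset_image_of_near_id h.at_one h.near (I * a)
        (by rwa [mem_ball_zero_iff])
      refine ⟨z, ⟨hz, by rwa [hv]⟩, ?_⟩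
      rw [evenCoord_of_mem v hz, hv]
      linear_combination -a * I_mul_I
  sq_eq z hz := by
    rw [evenCoord_of_mem v hz.1, mul_pow, h.sq z hz.1, neg_sq, I_sq]; ring
  branch := by
    have : evenCoord v =ᶠ[𝓝 1] fun z => -I * v z := by
      filter_upwards [isOpen_ball.mem_nhds one_mem_ball_one] with z hz
      exact evenCoord_of_mem v hz
    rw [this.deriv_eq, deriv_const_mul _
      (h.diff.differentiableAt (isOpen_ball.mem_nhds one_mem_ball_one)), h.deriv_one]
  even z hz := by rw [evenCoord_neg_of_mem v hz.1, evenCoord_of_mem v hz.1]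

end LocalRoot

open Classical in
/-- The residual error on the whole plane. -/
noncomputable def globalError (f φ v : ℂ → ℂ) (n : ℕ) (δ : ℝ) (z : ℂ) : ℂ :=
  if z ∈ rootDisk v δ then localError f n v z
  else if -z ∈ rootDisk v δ then localError f n v (-z)
  else if |z.re| < 1 then (Real.sqrt n : ℂ) * lineTransform f (2 * n) z - H0 φ z
  else (Real.sqrt n : ℂ) * outerPart f n z - H0 φ z

lemma neg_notMem_rootDisk {v : ℂ → ℂ} {δ : ℝ} {z : ℂ} (hz : z ∈ rootDisk v δ) :
    -z ∉ rootDisk v δ := by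
  intro h2
  have h3 := re_pos_of_mem_ball hz.1
  have h4 := re_pos_of_mem_ball h2.1
  rw [neg_re] at h4
  linarith

section

variable {f φ v : ℂ → ℂ} {n : ℕ} {δ : ℝ} {z : ℂ}

lemma globalError_of_mem (hz : z ∈ rootDisk v δ) :
    globalError f φ v n δ z = localError f n v z := if_pos hz

lemma globalError_of_neg_mem (hz : -z ∈ rootDisk v δ) :
    globalError f φ v n δ z = localError f n v (-z) := by
  have h1 : z ∉ rootDisk v δ := by
    have := neg_notMem_rootDisk hz
    rwa [neg_neg] at this
  rw [globalError, if_neg h1, if_pos hz]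

lemma globalError_of_lt (h1 : z ∉ rootDisk v δ) (h2 : -z ∉ rootDisk v δ) (h3 : |z.re| < 1) :
    globalError f φ v n δ z = (Real.sqrt n : ℂ) * lineTransform f (2 * n) z - H0 φ z := by
  rw [globalError, if_neg h1, if_neg h2, if_pos h3]

lemma globalError_of_le (h1 : z ∉ rootDisk v δ) (h2 : -z ∉ rootDisk v δ) (h3 : 1 ≤ |z.re|) :
    globalError f φ v n δ z = (Real.sqrt n : ℂ) * outerPart f n z - H0 φ z := by
  rw [globalError, if_neg h1, if_neg h2, if_neg (not_lt.2 h3)]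

lemma LocalRoot.le_norm_sub_one (h : LocalRoot φ v) (hδ : δ < 1 / 200) (hz : z ∉ rootDisk v δ) :
    δ / 2 ≤ ‖z - 1‖ := by
  by_contra hlt
  rw [not_le] at hlt
  have hn := norm_nonneg (z - 1)
  have hb : z ∈ ball (1 : ℂ) (1 / 100) := by rw [mem_ball_iff_norm]; linarith
  exact hz ⟨hb, by linarith [h.norm_le hb]⟩

end

/-- The uniform description of the Taylor polynomials of a normalised admissible function. -/
theorem exists_uniform_expansion (C₀ : ℝ) {δ : ℝ} (hδ0 : 0 < δ) (hδ : δ < 1 / 200) :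
    ∃ C : ℝ, ∀ (n : ℕ) (f φ v : ℂ → ℂ), n ≠ 0 → Admissible C₀ n f φ → LocalRoot φ v →
      ∀ B : Set ℂ, B = localDisks (evenCoord v) (rootDisk v (1 / 200)) δ → ∃ E : ℂ → ℂ,
        (∀ z, Expansion f n 1 φ (evenCoord v) B E (taylorPoly f (2 * n - 1) z) z) ∧
        AnalyticOnNhd ℂ E (({z : ℂ | |z.re| = 1} \ B) ∪ frontier B)ᶜ ∧
        (∀ z, ‖E z‖ ≤ C) ∧ (∀ z, z ∉ B → ‖E z‖ ≤ C / n) ∧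
        (∀ z ∈ B, z ≠ 1 → z ≠ -1 → ‖E z - (H0 φ z +
          1 / (2 * I * (Real.sqrt Real.pi : ℂ) * evenCoord v z))‖ ≤ C / n) := by
  -- Since ‖v z‖ ≤ (11/10)‖z - 1‖, a point outside the disks is at distance at least δ/2 from ±1.
  obtain ⟨C1, hC1, H1⟩ := exists_outer_inner_bound C₀ (c := δ / 2) (by positivity)
  obtain ⟨C2, hC2, H2⟩ := exists_local_bound C₀ hδ0 hδ
  refine ⟨C1 + 2 * C2, ?_⟩
  intro n f φ v hn h hv B hBdef
  have hB : ∀ z, z ∈ B ↔ z ∈ rootDisk v δ ∨ -z ∈ rootDisk v δ := fun z => by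
    rw [hBdef]; exact mem_localDisks_evenCoord hδ.le
  have hn1 : (1 : ℝ) ≤ n := by exact_mod_cast Nat.one_le_iff_ne_zero.2 hn
  have hn0 : (0 : ℝ) < n := by linarith
  have hsn : 0 < Real.sqrt n := Real.sqrt_pos.2 hn0
  have hsnc : (Real.sqrt n : ℂ) ≠ 0 := ofReal_ne_zero.2 hsn.ne'
  have hC1n : C1 / n ≤ C1 := div_le_self hC1 hn1
  have hC2n : C2 / n ≤ C2 := div_le_self hC2 hn1
  have hopen := hv.isOpen_rootDisk δ
  have hopen' : IsOpen {z | -z ∈ rootDisk v δ} := hopen.preimage continuous_neg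
  have hBopen : IsOpen B := by
    have : B = rootDisk v δ ∪ {z | -z ∈ rootDisk v δ} := by ext z; exact hB z
    rw [this]
    exact hopen.union hopen'
  have hout : ∀ z, z ∉ B → z ∉ rootDisk v δ ∧ -z ∉ rootDisk v δ := fun z hz => by
    rw [hB, not_or] at hz; exact hz
  have hdist : ∀ z, z ∉ B → δ / 2 ≤ ‖z - 1‖ ∧ δ / 2 ≤ ‖z + 1‖ := by
    intro z hz
    refine ⟨hv.le_norm_sub_one hδ (hout z hz).1, ?_⟩
    have := hv.le_norm_sub_one hδ (hout z hz).2
    rwa [show -z - 1 = -(z + 1) by ring, norm_neg] at this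
  have hne : ∀ z, z ∉ B → z ≠ 1 ∧ z ≠ -1 := by
    intro z hz
    obtain ⟨d1, d2⟩ := hdist z hz
    constructor
    · rintro rfl; simp at d1; linarith
    · rintro rfl; simp at d2; linarith
  have hlocal : ∀ z ∈ rootDisk v δ, ∀ T : ℂ, T = taylorPoly f (2 * n - 1) z →
      T = f z * (1 / 2 * erfc (I * (Real.sqrt n : ℂ) * (-I * v z)))
        - z ^ (2 * n) / (Real.sqrt n : ℂ) * localError f n v z := by
    intro z hz T hT
    have hz0 : z ≠ 0 := by
      rintro rfl
      have := re_pos_of_mem_ball hz.1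
      simp at this
      linarith
    have e1 : I * (Real.sqrt n : ℂ) * (-I * v z) = Real.sqrt n * v z := by
      linear_combination -(Real.sqrt n : ℂ) * v z * I_mul_I
    rw [e1, hT, localError, outerPart]
    have e2 := pow_mul_inv_pow hz0 (2 * n)
    generalize erfc (Real.sqrt n * v z) = e
    generalize z⁻¹ ^ (2 * n) = a at *
    generalize z ^ (2 * n) = b at *
    generalize taylorPoly f (2 * n - 1) z = t
    field_simp
    linear_combination (f z * e - 2 * t) * e2
  refine ⟨globalError f φ v n δ, ?_, ?_, ?_, ?_, ?_⟩
  · intro z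
    constructor
    · intro hz
      obtain ⟨d1, d2⟩ := hout z hz
      rw [ofReal_one, one_mul, h.map_one, mul_one]
      rcases lt_or_ge (|z.re|) 1 with hlt | hge
      · rw [globalError_of_lt d1 d2 hlt]
        have h1 := pow_mul_lineTransform h.entire h.decay h.even hn hlt.ne
        field_simp
        linear_combination (Real.sqrt n : ℂ) * h1
      -- The lines |Re z| = 1 belong to this case, in agreement with `chi` being zero on them.
      · have hz0 : z ≠ 0 := by rintro rfl; simp at hge; linarith
        have hchi : chi z = 0 := indicator_of_notMem (by simpa using hge) _
        have e2 := pow_mul_inv_pow hz0 (2 * n)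
        rw [globalError_of_le d1 d2 hge, hchi, outerPart]
        generalize z⁻¹ ^ (2 * n) = a at *
        generalize z ^ (2 * n) = b at *
        field_simp
        linear_combination -(Real.sqrt n : ℂ) * (taylorPoly f (2 * n - 1) z) * e2
    · intro hz
      rw [ofReal_one, one_mul, h.map_one, mul_one]
      rcases (hB z).1 hz with h1 | h1
      · rw [globalError_of_mem h1, evenCoord_of_mem v h1.1]
        exact hlocal z h1 _ rfl
      · rw [globalError_of_neg_mem h1, ← neg_neg z, evenCoord_neg_of_mem v h1.1, neg_neg]
        have := hlocal (-z) h1 _ rfl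
        rwa [h.even, taylorPoly_neg h.even, Even.neg_pow (even_two_mul n)] at this
  · intro z hz
    rw [mem_compl_iff, mem_union, not_or] at hz
    obtain ⟨hz1, hz2⟩ := hz
    by_cases hzB : z ∈ B
    · have hld := hv.differentiableOn_localError h.entire n
      rcases (hB z).1 hzB with h1 | h1
      · have ha : AnalyticAt ℂ (localError f n v) z :=
          hld.analyticAt (isOpen_ball.mem_nhds h1.1)
        refine ha.congr ?_
        filter_upwards [hopen.mem_nhds h1] with y hy
        exact (globalError_of_mem hy).symm
      · have ha : AnalyticAt ℂ (fun y => localError f n v (-y)) z := by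
          refine DifferentiableOn.analyticAt (s := {z | -z ∈ rootDisk v δ}) ?_
            (hopen'.mem_nhds h1)
          exact hld.comp (by fun_prop) fun y hy => hy.1
        refine ha.congr ?_
        filter_upwards [hopen'.mem_nhds h1] with y hy
        exact (globalError_of_neg_mem hy).symm
    · have hcl : z ∉ closure B := by
        intro hc
        exact hz2 ⟨hc, by rwa [hBopen.interior_eq]⟩
      have hre : |z.re| ≠ 1 := fun e => hz1 ⟨e, hzB⟩
      have hop : IsOpen (closure B)ᶜ := isClosed_closure.isOpen_compl
      have hsub : ∀ y ∈ (closure B)ᶜ, y ∉ B := fun y hy hyB => hy (subset_closure hyB)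
      rcases lt_or_gt_of_ne hre with hlt | hgt
      · have hop2 : IsOpen ((closure B)ᶜ ∩ {y : ℂ | |y.re| < 1}) :=
          hop.inter (isOpen_lt (by fun_prop) continuous_const)
        have ha : AnalyticAt ℂ
            (fun y => (Real.sqrt n : ℂ) * lineTransform f (2 * n) y - H0 φ y) z := by
          refine DifferentiableOn.analyticAt (s := (closure B)ᶜ ∩ {y : ℂ | |y.re| < 1}) ?_
            (hop2.mem_nhds ⟨hcl, hlt⟩)
          refine DifferentiableOn.sub (DifferentiableOn.const_mul ?_ _) ?_
          · exact (differentiableOn_lineTransform h.entire h.decay h.even hn).mono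
              fun y hy => hy.2.ne
          · intro y hy
            obtain ⟨n1, n2⟩ := hne y (hsub y hy.1)
            exact (differentiableAt_H0 φ n1 n2).differentiableWithinAt
        refine ha.congr ?_
        filter_upwards [hop2.mem_nhds ⟨hcl, hlt⟩] with y hy
        obtain ⟨o1, o2⟩ := hout y (hsub y hy.1)
        exact (globalError_of_lt o1 o2 hy.2).symm
      · have hop2 : IsOpen ((closure B)ᶜ ∩ {y : ℂ | 1 < |y.re|}) :=
          hop.inter (isOpen_lt continuous_const (by fun_prop))
        have ha : AnalyticAt ℂ (fun y => (Real.sqrt n : ℂ) * outerPart f n y - H0 φ y) z := by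
          refine DifferentiableOn.analyticAt (s := (closure B)ᶜ ∩ {y : ℂ | 1 < |y.re|}) ?_
            (hop2.mem_nhds ⟨hcl, hgt⟩)
          intro y hy
          obtain ⟨n1, n2⟩ := hne y (hsub y hy.1)
          have hy0 : y ≠ 0 := by
            rintro rfl
            have := hy.2
            simp at this
            linarith
          exact (((differentiableAt_outerPart f n hy0).const_mul _).sub
            (differentiableAt_H0 φ n1 n2)).differentiableWithinAt
        refine ha.congr ?_
        filter_upwards [hop2.mem_nhds ⟨hcl, hgt⟩] with y hy
        obtain ⟨o1, o2⟩ := hout y (hsub y hy.1)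
        exact (globalError_of_le o1 o2 (le_of_lt hy.2)).symm
  · intro z
    have hin : ∀ ζ ∈ rootDisk v δ, ‖localError f n v ζ‖ ≤ C1 + 2 * C2 := by
      intro ζ hζ
      obtain ⟨k1, k2⟩ := H2 n f φ v hn h hv ζ hζ
      have := norm_sub_norm_le (localError f n v ζ) (rootResidual φ v ζ)
      linarith
    by_cases hzB : z ∈ B
    · rcases (hB z).1 hzB with h1 | h1
      · rw [globalError_of_mem h1]; exact hin z h1
      · rw [globalError_of_neg_mem h1]; exact hin _ h1
    · obtain ⟨d1, d2⟩ := hdist z hzB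
      obtain ⟨o1, o2⟩ := hout z hzB
      obtain ⟨b1, -, b3⟩ := H1 n f φ hn h z d1 d2
      rcases lt_or_ge (|z.re|) 1 with hlt | hge
      · rw [globalError_of_lt o1 o2 hlt]; linarith [b3 hlt]
      · rw [globalError_of_le o1 o2 hge]; linarith [b1 hge]
  · intro z hzB
    obtain ⟨d1, d2⟩ := hdist z hzB
    obtain ⟨o1, o2⟩ := hout z hzB
    obtain ⟨b1, -, b3⟩ := H1 n f φ hn h z d1 d2
    have hle : C1 / n ≤ (C1 + 2 * C2) / n := by gcongr; linarith
    rcases lt_or_ge (|z.re|) 1 with hlt | hge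
    · rw [globalError_of_lt o1 o2 hlt]; linarith [b3 hlt]
    · rw [globalError_of_le o1 o2 hge]; linarith [b1 hge]
  · intro z hzB hz1 hz2
    have hle : C2 / n ≤ (C1 + 2 * C2) / n := by gcongr; linarith
    have hcoord : ∀ a : ℂ, 1 / (2 * I * (Real.sqrt Real.pi : ℂ) * (-I * a))
        = 1 / (2 * (Real.sqrt Real.pi : ℂ) * a) := by
      intro a
      congr 1
      linear_combination -(2 * (Real.sqrt Real.pi : ℂ) * a) * I_mul_I
    rcases (hB z).1 hzB with h1 | h1
    · rw [globalError_of_mem h1, evenCoord_of_mem v h1.1, hcoord,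
        ← hv.rootResidual_eq h.phase h1.1 hz1]
      exact (H2 n f φ v hn h hv z h1).1.trans hle
    · rw [globalError_of_neg_mem h1, ← H0_neg]
      have e : evenCoord v z = -I * v (-z) := by
        conv_lhs => rw [← neg_neg z]
        exact evenCoord_neg_of_mem v h1.1
      rw [e, hcoord, ← hv.rootResidual_eq h.phase h1.1
        (fun e => hz2 (by rw [← e, neg_neg]))]
      exact (H2 n f φ v hn h hv (-z) h1).1.trans hle

end UniformExpansion

end LTaylor

namespace LTaylor

/-! ### Bounds for the Gamma function on vertical lines and strips. -/

section GammaBounds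

open MeasureTheory Set

lemma norm_Gamma_le {z : ℂ} (hz : 0 < z.re) : ‖Complex.Gamma z‖ ≤ Real.Gamma z.re := by
  rw [Complex.Gamma_eq_integral hz, Real.Gamma_eq_integral hz, Complex.GammaIntegral]
  refine (norm_integral_le_integral_norm _).trans (le_of_eq ?_)
  refine setIntegral_congr_fun measurableSet_Ioi fun x hx => ?_
  rw [norm_mul, norm_real, Real.norm_of_nonneg (Real.exp_pos _).le,
    norm_cpow_eq_rpow_re_of_pos hx, sub_re, one_re]

lemma differentiableAt_Gamma_of_lt {z : ℂ} (hz : 0 < z.re) :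
    DifferentiableAt ℂ Complex.Gamma z :=
  Complex.differentiableAt_Gamma _ fun m e => by
    have h1 := congrArg re e
    have h2 : (0 : ℝ) ≤ m := m.cast_nonneg
    simp at h1
    linarith

lemma Gamma_ne_zero_of_lt {z : ℂ} (hz : 0 < z.re) : Complex.Gamma z ≠ 0 :=
  Complex.Gamma_ne_zero_of_re_pos hz

/-- Compactness bounds the ratio on [1, 2]. Under x ↦ x + 1 it is multiplied by x/|x + ib| ≤ 1, so
the bound persists. -/
lemma exists_Gamma_le_mul_norm (b : ℝ) :
    ∃ C : ℝ, 0 < C ∧ ∀ x : ℝ, 1 ≤ x → Real.Gamma x ≤ C * ‖Complex.Gamma (x + b * I)‖ := by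
  have hc : ContinuousOn (fun x : ℝ => Real.Gamma x / ‖Complex.Gamma (x + b * I)‖) (Icc 1 2) := by
    intro x hx
    have hx0 : 0 < x := by linarith [hx.1]
    have h1 : DifferentiableAt ℝ Real.Gamma x :=
      Real.differentiableAt_Gamma fun m => by
        have : (0 : ℝ) ≤ m := m.cast_nonneg
        linarith
    have h2 : ContinuousAt Complex.Gamma (x + b * I) :=
      (differentiableAt_Gamma_of_lt (by simpa using hx0)).continuousAt
    have h3 : ContinuousAt (fun x : ℝ => Complex.Gamma (x + b * I)) x :=
      ContinuousAt.comp (f := fun x : ℝ => (x + b * I : ℂ)) h2 (by fun_prop)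
    exact (h1.continuousAt.div h3.norm
      (norm_ne_zero_iff.2 (Gamma_ne_zero_of_lt (by simpa using hx0)))).continuousWithinAt
  obtain ⟨C, hC⟩ := isCompact_Icc.exists_bound_of_continuousOn hc
  have hpos : ∀ x : ℝ, 0 < x → 0 < ‖Complex.Gamma (x + b * I)‖ := fun x hx =>
    norm_pos_iff.2 (Gamma_ne_zero_of_lt (by simpa using hx))
  have key : ∀ k : ℕ, ∀ x ∈ Icc (1 : ℝ) 2,
      Real.Gamma (x + k) ≤ (|C| + 1) * ‖Complex.Gamma ((x + k : ℝ) + b * I)‖ := by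
    intro k x hx
    have hx0 : 0 < x := by linarith [hx.1]
    induction k with
    | zero =>
      have h1 := (le_abs_self _).trans (hC x hx)
      rw [div_le_iff₀ (hpos x hx0)] at h1
      simp only [Nat.cast_zero, add_zero]
      refine h1.trans ?_
      gcongr
      linarith [le_abs_self C]
    | succ k ih =>
      have hxk : 0 < x + k := by positivity
      have e1 : Real.Gamma (x + (k + 1 : ℕ)) = (x + k) * Real.Gamma (x + k) := by
        rw [← Real.Gamma_add_one hxk.ne']; congr 1; push_cast; ring
      have hne : ((x + k : ℝ) : ℂ) + b * I ≠ 0 := fun e => by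
        have := congrArg re e
        simp at this
        linarith
      have e2 : Complex.Gamma ((x + (k + 1 : ℕ) : ℝ) + b * I)
          = ((x + k : ℝ) + b * I) * Complex.Gamma ((x + k : ℝ) + b * I) := by
        rw [← Complex.Gamma_add_one _ hne]; congr 1; push_cast; ring
      have e3 : x + k ≤ ‖((x + k : ℝ) : ℂ) + b * I‖ := by
        refine le_trans (le_of_eq ?_) (re_le_norm _)
        simp
      rw [e1, e2, norm_mul]
      have h0 := hpos _ hxk
      calc (x + k) * Real.Gamma (x + k)
          ≤ (x + k) * ((|C| + 1) * ‖Complex.Gamma ((x + k : ℝ) + b * I)‖) := by gcongr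
        _ = (|C| + 1) * ((x + k) * ‖Complex.Gamma ((x + k : ℝ) + b * I)‖) := by ring
        _ ≤ _ := by gcongr
  refine ⟨|C| + 1, by positivity, fun x hx => ?_⟩
  have h1 : (1 : ℝ) ≤ x := hx
  have hfl := Nat.floor_le (show 0 ≤ x - 1 by linarith)
  have hfl2 := (Nat.lt_floor_add_one (x - 1)).le
  have := key ⌊x - 1⌋₊ (x - ⌊x - 1⌋₊) ⟨by linarith, by linarith⟩
  rwa [sub_add_cancel] at this

/-- Each use of Γ(z) = Γ(z + 1)/z gains 1/|y|, and after k of them the strip lies in the right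
half-plane, where Γ is bounded by its real values. Any power of decay is reached without Stirling's
formula. -/
lemma exists_norm_Gamma_le_div_pow (k : ℕ) (x₁ x₂ : ℝ) (h : 0 < x₁ + k) :
    ∃ C : ℝ, 0 ≤ C ∧ ∀ x y : ℝ, x₁ ≤ x → x ≤ x₂ → 1 ≤ |y| →
      ‖Complex.Gamma (x + y * I)‖ ≤ C / |y| ^ k := by
  induction k generalizing x₁ x₂ with
  | zero =>
    simp only [Nat.cast_zero, add_zero] at h
    have hc : ContinuousOn Real.Gamma (Icc x₁ x₂) := fun x hx =>
      (Real.differentiableAt_Gamma fun m => by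
        have : (0 : ℝ) ≤ m := m.cast_nonneg
        linarith [hx.1]).continuousAt.continuousWithinAt
    obtain ⟨C, hC⟩ := isCompact_Icc.exists_bound_of_continuousOn hc
    refine ⟨|C|, abs_nonneg _, fun x y h1 h2 _ => ?_⟩
    have h3 := norm_Gamma_le (z := x + y * I) (by simp; linarith)
    simp only [add_re, ofReal_re, mul_re, I_re, mul_zero, ofReal_im, I_im, mul_one, sub_self,
      add_zero] at h3
    rw [pow_zero, div_one]
    exact h3.trans ((le_abs_self _).trans ((hC x ⟨h1, h2⟩).trans (le_abs_self C)))
  | succ k ih =>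
    obtain ⟨C, hC0, hC⟩ := ih (x₁ + 1) (x₂ + 1) (by push_cast at h; linarith)
    refine ⟨C, hC0, fun x y h1 h2 hy => ?_⟩
    have hy0 : 0 < |y| := by linarith
    have h3 := hC (x + 1) y (by linarith) (by linarith) hy
    have him : |y| ≤ ‖(x : ℂ) + y * I‖ := by
      simpa using abs_im_le_norm ((x : ℂ) + y * I)
    have hne : (x : ℂ) + y * I ≠ 0 := norm_pos_iff.1 (hy0.trans_le him)
    rw [show ((x + 1 : ℝ) : ℂ) + y * I = (x + y * I) + 1 by push_cast; ring,
      Complex.Gamma_add_one _ hne, norm_mul] at h3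
    have hg := norm_nonneg (Complex.Gamma (x + y * I))
    have h4 : |y| * ‖Complex.Gamma (x + y * I)‖ ≤ C / |y| ^ k :=
      (mul_le_mul_of_nonneg_right him hg).trans h3
    rw [pow_succ, ← div_div, le_div_iff₀ hy0, mul_comm]
    exact h4

lemma exists_norm_Gamma_le_inv_pow (m : ℕ) (x₁ x₂ : ℝ) :
    ∃ C : ℝ, 0 ≤ C ∧ ∀ x y : ℝ, x₁ ≤ x → x ≤ x₂ → 1 ≤ |y| →
      ‖Complex.Gamma (x + y * I)‖ ≤ C / |y| ^ m := by
  obtain ⟨k, hk⟩ := exists_nat_gt (|x₁| + m)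
  have hm : m ≤ k := by
    have : (m : ℝ) ≤ k := by linarith [abs_nonneg x₁]
    exact_mod_cast this
  obtain ⟨C, hC0, hC⟩ := exists_norm_Gamma_le_div_pow k x₁ x₂ (by
    have : (0 : ℝ) ≤ m := m.cast_nonneg
    linarith [neg_abs_le x₁])
  refine ⟨C, hC0, fun x y h1 h2 hy => (hC x y h1 h2 hy).trans ?_⟩
  have : 0 < |y| := by linarith
  gcongr

end GammaBounds

/-! ### The digamma function as log z + O(1/Re z). -/

section Digamma

open Set

/-- The terms of the series for `digamma z - log z`. -/
noncomputable def digammaTerm (j : ℕ) (z : ℂ) : ℂ := Complex.log (1 + (z + j)⁻¹) - (z + j)⁻¹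

/-- The series for `digamma z - log z`. -/
noncomputable def digammaSeries (z : ℂ) : ℂ := ∑' j, digammaTerm j z

lemma sum_inv_sq_le {x : ℝ} (hx : 1 < x) (k : ℕ) :
    ∑ j ∈ Finset.range k, 1 / (x + j) ^ 2 ≤ 1 / (x - 1) := by
  have h : ∑ j ∈ Finset.range k, 1 / (x + j) ^ 2 ≤ 1 / (x - 1) - 1 / (x - 1 + k) := by
    induction k with
    | zero => simp
    | succ k ih =>
      rw [Finset.sum_range_succ]
      have hk : (0 : ℝ) ≤ k := k.cast_nonneg
      have h1 : 0 < x - 1 + k := by linarith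
      have h2 : 0 < x + k := by linarith
      have h3 : 1 / (x + k) ^ 2 ≤ 1 / (x - 1 + k) - 1 / (x - 1 + (k + 1 : ℕ)) := by
        push_cast
        rw [show x - 1 + (k + 1 : ℝ) = x + k by ring, div_sub_div _ _ h1.ne' h2.ne',
          div_le_div_iff₀ (by positivity) (by positivity)]
        nlinarith
      linarith
  have : 0 ≤ 1 / (x - 1 + k) := by
    have hk : (0 : ℝ) ≤ k := k.cast_nonneg
    have : 0 < x - 1 + k := by linarith
    positivity
  linarith

lemma summable_inv_sq_add {x : ℝ} (hx : 1 < x) : Summable fun j : ℕ => 1 / (x + j) ^ 2 :=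
  summable_of_sum_range_le (fun j => by positivity) (sum_inv_sq_le hx)

lemma tsum_inv_sq_add_le {x : ℝ} (hx : 2 ≤ x) : ∑' j : ℕ, 1 / (x + j) ^ 2 ≤ 2 / x := by
  refine (Real.tsum_le_of_sum_range_le (fun j => by positivity)
    (sum_inv_sq_le (by linarith))).trans ?_
  rw [div_le_div_iff₀ (by linarith) (by linarith)]
  linarith

lemma norm_digammaTerm_le {z : ℂ} (hz : 2 ≤ z.re) (j : ℕ) :
    ‖digammaTerm j z‖ ≤ 1 / (z.re + j) ^ 2 := by
  have hj : (0 : ℝ) ≤ j := j.cast_nonneg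
  have h1 : z.re + j ≤ ‖z + j‖ := by
    refine le_trans (le_of_eq ?_) (re_le_norm _); simp
  have h2 : ‖(z + j)⁻¹‖ ≤ 1 / (z.re + j) := by
    rw [norm_inv, ← one_div]
    have : 0 < z.re + j := by linarith
    gcongr
  have h3 : 1 / (z.re + j) ≤ 1 / 2 := by gcongr; linarith
  have h4 := Complex.norm_log_one_add_sub_self_le (z := (z + j)⁻¹) (by linarith)
  have h5 : (1 - ‖(z + j)⁻¹‖)⁻¹ ≤ 2 := by
    rw [inv_le_comm₀ (by linarith) (by norm_num)]; linarith
  calc ‖digammaTerm j z‖ ≤ ‖(z + j)⁻¹‖ ^ 2 * (1 - ‖(z + j)⁻¹‖)⁻¹ / 2 := h4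
    _ ≤ ‖(z + j)⁻¹‖ ^ 2 * 2 / 2 := by gcongr
    _ = ‖(z + j)⁻¹‖ ^ 2 := by ring
    _ ≤ (1 / (z.re + j)) ^ 2 := by gcongr
    _ = _ := by rw [one_div_pow]

lemma summable_digammaTerm {z : ℂ} (hz : 2 ≤ z.re) : Summable fun j => digammaTerm j z :=
  Summable.of_norm_bounded (summable_inv_sq_add (by linarith)) (norm_digammaTerm_le hz)

lemma norm_digammaSeries_le {z : ℂ} (hz : 2 ≤ z.re) : ‖digammaSeries z‖ ≤ 2 / z.re :=
  (tsum_of_norm_bounded (summable_inv_sq_add (by linarith)).hasSum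
    (norm_digammaTerm_le hz)).trans (tsum_inv_sq_add_le hz)

lemma digammaSeries_eq_add {z : ℂ} (hz : 2 ≤ z.re) :
    digammaSeries z = digammaTerm 0 z + digammaSeries (z + 1) := by
  rw [digammaSeries, (summable_digammaTerm hz).tsum_eq_zero_add, digammaSeries]
  congr 2
  ext j
  simp only [digammaTerm]
  rw [show z + ((j + 1 : ℕ) : ℂ) = z + 1 + j by push_cast; ring]

lemma isOpen_two_lt_re : IsOpen {z : ℂ | 2 < z.re} := isOpen_lt continuous_const continuous_re

lemma differentiableOn_digammaSeries : DifferentiableOn ℂ digammaSeries {z : ℂ | 2 < z.re} := by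
  refine differentiableOn_tsum_of_summable_norm (u := fun j : ℕ => 1 / ((2 : ℝ) + j) ^ 2)
    (summable_inv_sq_add (by norm_num)) (fun j z hz => ?_) isOpen_two_lt_re fun j z hz => ?_
  · have hz' : 2 < z.re := hz
    have hne : z + j ≠ 0 := fun e => by
      have h1 := congrArg re e
      have hj : (0 : ℝ) ≤ j := j.cast_nonneg
      simp at h1
      linarith
    have hpos : 0 < ((z + j)⁻¹).re := by
      rw [inv_re]
      refine div_pos ?_ (normSq_pos.2 hne)
      have hj : (0 : ℝ) ≤ j := j.cast_nonneg
      simp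
      linarith
    have h1 : DifferentiableAt ℂ (fun z : ℂ => (z + j)⁻¹) z := by
      fun_prop (disch := assumption)
    exact (((h1.const_add 1).clog (Or.inl (by simp only [add_re, one_re]; linarith))).sub
      h1).differentiableWithinAt
  · have hz' : 2 < z.re := hz
    refine (norm_digammaTerm_le hz'.le j).trans ?_
    gcongr

lemma digamma_ofReal {x : ℝ} (hx : 0 < x) :
    Complex.digamma x = (deriv (fun t => Real.log (Real.Gamma t)) x : ℝ) := by
  have hm : ∀ m : ℕ, x ≠ -m := fun m => by
    have : (0 : ℝ) ≤ m := m.cast_nonneg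
    linarith
  have h1 := (Real.differentiableAt_Gamma hm).hasDerivAt
  have h2 : HasDerivAt Complex.Gamma (deriv Complex.Gamma x) (x : ℂ) :=
    (differentiableAt_Gamma_of_lt (by simpa using hx)).hasDerivAt
  have h3 := h2.comp_ofReal
  have h4 := h1.ofReal_comp
  simp only [Complex.Gamma_ofReal] at h3
  rw [Complex.digamma_def, logDeriv_apply, h3.unique h4, Complex.Gamma_ofReal,
    (h1.log (Real.Gamma_pos_of_pos hx).ne').deriv, ofReal_div]

/-- By convexity of log Γ, its derivative at x lies between the slopes over [x - 1, x] and [x, x +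
1], which are log(x - 1) and log x. -/
lemma norm_digamma_ofReal_sub_log_le {x : ℝ} (hx : 2 ≤ x) :
    ‖Complex.digamma x - Real.log x‖ ≤ 2 / x := by
  set f : ℝ → ℝ := fun t => Real.log (Real.Gamma t) with hf
  have hc : ConvexOn ℝ (Ioi 0) f := Real.convexOn_log_Gamma
  have hd : ∀ t : ℝ, 0 < t → DifferentiableAt ℝ f t := fun t ht =>
    (Real.differentiableAt_Gamma fun m => by
      have : (0 : ℝ) ≤ m := m.cast_nonneg
      linarith).log (Real.Gamma_pos_of_pos ht).ne'
  have hrec : ∀ t : ℝ, 0 < t → f (t + 1) - f t = Real.log t := fun t ht => by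
    simp only [hf]
    rw [Real.Gamma_add_one ht.ne', Real.log_mul ht.ne' (Real.Gamma_pos_of_pos ht).ne']
    ring
  have hx0 : 0 < x := by linarith
  have hx1 : 0 < x - 1 := by linarith
  have hup : deriv f x ≤ Real.log x := by
    refine (hc.deriv_le_slope (y := x + 1) hx0 (show 0 < x + 1 by linarith) (by linarith)
      (hd x hx0)).trans (le_of_eq ?_)
    rw [slope_def_field, hrec x hx0]; simp
  have hlow : Real.log (x - 1) ≤ deriv f x := by
    refine (le_of_eq ?_).trans (hc.slope_le_deriv (x := x - 1) hx1 hx0 (by linarith) (hd x hx0))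
    have := hrec (x - 1) hx1
    rw [sub_add_cancel] at this
    rw [slope_def_field, this]; simp
  have hlog : Real.log x - Real.log (x - 1) ≤ 2 / x := by
    rw [← Real.log_div hx0.ne' hx1.ne']
    refine (Real.log_le_sub_one_of_pos (by positivity)).trans ?_
    rw [div_sub_one hx1.ne', div_le_div_iff₀ hx1 hx0]
    linarith
  rw [digamma_ofReal hx0, ← ofReal_sub, norm_real, Real.norm_eq_abs, abs_le]
  have : 0 ≤ 2 / x := by positivity
  constructor <;> linarith

/-- The difference of the two sides is invariant under x ↦ x + 1 and tends to 0, hence vanishes. The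
identity theorem then extends the formula from the real axis to the half-plane. -/
lemma digamma_eq_of_real {x : ℝ} (hx : 2 ≤ x) :
    Complex.digamma x = Complex.log x + digammaSeries x := by
  set Δ : ℝ → ℂ := fun t => Complex.digamma t - Complex.log t - digammaSeries t with hΔ
  have hstep : ∀ t : ℝ, 2 ≤ t → Δ (t + 1) = Δ t := by
    intro t ht
    have ht0 : 0 < t := by linarith
    have h1 := Complex.digamma_apply_add_one (t : ℂ) fun m e => by
      have h2 := congrArg re e
      have h3 : (0 : ℝ) ≤ m := m.cast_nonneg
      simp at h2
      linarith
    have h2 := digammaSeries_eq_add (z := (t : ℂ)) (by simpa using ht)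
    have h3 : Complex.log ((t : ℂ) + 1) = Complex.log t + Complex.log (1 + (t : ℂ)⁻¹) := by
      rw [← ofReal_one, ← ofReal_inv, ← ofReal_add, ← ofReal_add, ← ofReal_log (by linarith),
        ← ofReal_log ht0.le, ← ofReal_log (by positivity), ← ofReal_add,
        ← Real.log_mul ht0.ne' (by positivity)]
      congr 2
      field_simp
    simp only [hΔ]
    push_cast
    rw [h1, h2, h3, digammaTerm, Nat.cast_zero, add_zero]
    ring
  have hk : ∀ k : ℕ, Δ (x + k) = Δ x := by
    intro k
    induction k with
    | zero => simp
    | succ k ih =>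
      rw [← ih, ← hstep (x + k) (by linarith [(Nat.cast_nonneg k : (0 : ℝ) ≤ k)])]
      congr 1; push_cast; ring
  have hb : ∀ t : ℝ, 2 ≤ t → ‖Δ t‖ ≤ 4 / t := by
    intro t ht
    have h1 := norm_digamma_ofReal_sub_log_le ht
    have h2 := norm_digammaSeries_le (z := (t : ℂ)) (by simpa using ht)
    rw [ofReal_re] at h2
    simp only [hΔ]
    rw [← ofReal_log (by linarith)]
    refine (norm_sub_le _ _).trans ((add_le_add h1 h2).trans (le_of_eq ?_))
    ring
  have hlim : Tendsto (fun k : ℕ => 4 / (x + k)) atTop (𝓝 0) :=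
    (tendsto_atTop_add_const_left _ x tendsto_natCast_atTop_atTop).const_div_atTop 4
  have h0 : ‖Δ x‖ ≤ 0 := ge_of_tendsto' hlim fun k => by
    rw [← hk k]
    exact hb _ (by linarith [(Nat.cast_nonneg k : (0 : ℝ) ≤ k)])
  have h1 : Δ x = 0 := norm_le_zero_iff.1 h0
  simp only [hΔ] at h1
  linear_combination h1

lemma differentiableOn_digamma : DifferentiableOn ℂ Complex.digamma {z : ℂ | 2 < z.re} := by
  have hG : DifferentiableOn ℂ Complex.Gamma {z : ℂ | 2 < z.re} := fun z hz =>
    (differentiableAt_Gamma_of_lt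
      (show 0 < z.re from lt_trans two_pos hz)).differentiableWithinAt
  exact (hG.deriv isOpen_two_lt_re).div hG fun z hz =>
    Gamma_ne_zero_of_lt (lt_trans two_pos hz)

theorem digamma_eq_log_add {z : ℂ} (hz : 2 < z.re) :
    Complex.digamma z = Complex.log z + digammaSeries z := by
  have h1 : AnalyticOnNhd ℂ Complex.digamma {z : ℂ | 2 < z.re} :=
    differentiableOn_digamma.analyticOnNhd isOpen_two_lt_re
  have h2 : AnalyticOnNhd ℂ (fun z => Complex.log z + digammaSeries z) {z : ℂ | 2 < z.re} := by
    refine DifferentiableOn.analyticOnNhd (DifferentiableOn.add (fun z hz => ?_)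
      differentiableOn_digammaSeries) isOpen_two_lt_re
    exact (differentiableAt_log (Or.inl (lt_trans two_pos hz))).differentiableWithinAt
  have hpre : IsPreconnected {z : ℂ | 2 < z.re} :=
    (convex_halfSpace_re_gt 2).isPreconnected
  have hfreq : ∃ᶠ w in 𝓝[≠] (3 : ℂ), Complex.digamma w = Complex.log w + digammaSeries w := by
    have hu : Tendsto (fun k : ℕ => ((3 + 1 / ((k : ℝ) + 1) : ℝ) : ℂ)) atTop (𝓝[≠] 3) := by
      rw [tendsto_nhdsWithin_iff]
      constructor
      · have := (tendsto_one_div_add_atTop_nhds_zero_nat (𝕜 := ℝ)).const_add 3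
        rw [add_zero] at this
        exact (continuous_ofReal.tendsto' (3 : ℝ) 3 (by norm_num)).comp this
      · refine Eventually.of_forall fun k => ?_
        simp only [mem_compl_iff, mem_singleton_iff]
        intro e
        have h3 := congrArg re e
        have h4 : 0 < 1 / ((k : ℝ) + 1) := by positivity
        rw [ofReal_re] at h3
        norm_num at h3
        have h5 : (0 : ℝ) ≤ k := k.cast_nonneg
        linarith
    refine hu.frequently (Eventually.of_forall fun k => ?_).frequently
    have h4 : 0 < 1 / ((k : ℝ) + 1) := by positivity
    exact digamma_eq_of_real (by linarith)
  exact h1.eqOn_of_preconnected_of_frequently_eq h2 hpre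
    (show (3 : ℂ) ∈ {z : ℂ | 2 < z.re} by norm_num) hfreq hz

theorem norm_digamma_sub_log_le {z : ℂ} (hz : 2 < z.re) :
    ‖Complex.digamma z - Complex.log z‖ ≤ 2 / z.re := by
  rw [digamma_eq_log_add hz, add_sub_cancel_left]
  exact norm_digammaSeries_le hz.le

end Digamma

end LTaylor

namespace LTaylor

/-! ### Logarithmic derivatives of the factors, a class closed under products. -/

section LogAsymptotics

/-- Far to the right `g` is holomorphic without zeros, is dominated by its values on the real axis,
and has logarithmic derivative `p log z + c + O(1 / Re z)` in a sector. -/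
def LogAsymp (g : ℂ → ℂ) (p c : ℝ) : Prop :=
  ∃ X C : ℝ, 1 ≤ X ∧ 0 ≤ C ∧ ∀ z : ℂ, X ≤ z.re → DifferentiableAt ℂ g z ∧ g z ≠ 0 ∧
    ‖g z‖ ≤ C * ‖g z.re‖ ∧ (|z.im| ≤ z.re → ‖logDeriv g z - (p * log z + c)‖ ≤ C / z.re)

lemma LogAsymp.mul {f g : ℂ → ℂ} {p c q d : ℝ} (hf : LogAsymp f p c) (hg : LogAsymp g q d) :
    LogAsymp (fun z => f z * g z) (p + q) (c + d) := by
  obtain ⟨X, C, hX, hC, H⟩ := hf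
  obtain ⟨Y, D, hY, hD, K⟩ := hg
  refine ⟨max X Y, C * D + C + D, le_max_of_le_left hX, by positivity, fun z hz => ?_⟩
  obtain ⟨f1, f2, f3, f4⟩ := H z ((le_max_left _ _).trans hz)
  obtain ⟨g1, g2, g3, g4⟩ := K z ((le_max_right _ _).trans hz)
  have hz0 : 0 < z.re := by linarith [(le_max_left X Y).trans hz]
  refine ⟨f1.mul g1, mul_ne_zero f2 g2, ?_, fun hi => ?_⟩
  · rw [norm_mul, norm_mul]
    have hp : 0 ≤ ‖f z.re‖ * ‖g z.re‖ := by positivity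
    calc ‖f z‖ * ‖g z‖ ≤ (C * ‖f z.re‖) * (D * ‖g z.re‖) := by gcongr
      _ = C * D * (‖f z.re‖ * ‖g z.re‖) := by ring
      _ ≤ _ := by gcongr; linarith
  · rw [logDeriv_mul z f2 g2 f1 g1]
    have h1 := f4 hi
    have h2 := g4 hi
    rw [show logDeriv f z + logDeriv g z - (((p + q : ℝ) : ℂ) * log z + ((c + d : ℝ) : ℂ))
      = (logDeriv f z - (p * log z + c)) + (logDeriv g z - (q * log z + d)) by push_cast; ring]
    refine (norm_add_le _ _).trans ((add_le_add h1 h2).trans ?_)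
    rw [← add_div]
    gcongr
    nlinarith [mul_nonneg hC hD]

lemma LogAsymp.const {k : ℂ} (hk : k ≠ 0) : LogAsymp (fun _ => k) 0 0 := by
  refine ⟨1, 1, le_rfl, zero_le_one, fun z hz => ⟨by fun_prop, hk, by simp, fun _ => ?_⟩⟩
  have : 0 < z.re := by linarith
  simp [logDeriv_const]
  positivity

lemma LogAsymp.prod {ι : Type*} (s : Finset ι) {g : ι → ℂ → ℂ} {p c : ℝ}
    (h : ∀ i, LogAsymp (g i) p c) :
    LogAsymp (fun z => ∏ i ∈ s, g i z) (s.card * p) (s.card * c) := by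
  classical
  induction s using Finset.induction_on with
  | empty => simpa using LogAsymp.const one_ne_zero
  | insert a s ha ih =>
    have := (h a).mul ih
    simp only [Finset.prod_insert ha, Finset.card_insert_of_notMem ha]
    convert this using 1 <;> push_cast <;> ring

lemma LogAsymp.congr {f g : ℂ → ℂ} {p c : ℝ} (hf : LogAsymp f p c) {Y : ℝ}
    (h : ∀ z : ℂ, Y < z.re → g z = f z) : LogAsymp g p c := by
  obtain ⟨X, C, hX, hC, H⟩ := hf
  refine ⟨max X (Y + 1), C, le_max_of_le_left hX, hC, fun z hz => ?_⟩
  have hY : Y < z.re := by linarith [(le_max_right X (Y + 1)).trans hz]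
  obtain ⟨f1, f2, f3, f4⟩ := H z ((le_max_left _ _).trans hz)
  have he : g =ᶠ[𝓝 z] f := by
    filter_upwards [(isOpen_lt continuous_const continuous_re).mem_nhds hY] with w hw
    exact h w hw
  refine ⟨f1.congr_of_eventuallyEq he, by rwa [h z hY], ?_, fun hi => ?_⟩
  · rwa [h z hY, h z.re (by rwa [ofReal_re])]
  · rw [logDeriv_apply, he.deriv_eq, he.eq_of_nhds, ← logDeriv_apply]
    exact f4 hi

lemma LogAsymp.const_cpow {A : ℝ} (hA : 0 < A) (α : ℝ) (β : ℂ) :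
    LogAsymp (fun z => (A : ℂ) ^ (α * z + β)) 0 (α * Real.log A) := by
  have hA' : (A : ℂ) ≠ 0 := ofReal_ne_zero.2 hA.ne'
  refine ⟨1, 1, le_rfl, zero_le_one, fun z hz => ?_⟩
  have hz0 : 0 < z.re := by linarith
  have hd : HasDerivAt (fun z : ℂ => (A : ℂ) ^ (α * z + β))
      ((A : ℂ) ^ (α * z + β) * log A * (α * 1)) z :=
    HasDerivAt.const_cpow (((hasDerivAt_id z).const_mul _).add_const _) (Or.inl hA')
  have hne : (A : ℂ) ^ (α * z + β) ≠ 0 := by simp [cpow_eq_zero_iff, hA']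
  refine ⟨hd.differentiableAt, hne, ?_, fun _ => ?_⟩
  · rw [norm_cpow_eq_rpow_re_of_pos hA, norm_cpow_eq_rpow_re_of_pos hA]
    simp
  · have : logDeriv (fun z : ℂ => (A : ℂ) ^ (α * z + β)) z = ((α * Real.log A : ℝ) : ℂ) := by
      rw [logDeriv_apply, hd.deriv, ← ofReal_log hA.le]
      push_cast
      field_simp
    rw [this]
    simp
    positivity

lemma log_mul_of_re_pos {z w : ℂ} (hz : 0 < z.re) (hw : 0 < w.re) :
    log (z * w) = log z + log w := by
  have hz0 : z ≠ 0 := by rintro rfl; simp at hz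
  have hw0 : w ≠ 0 := by rintro rfl; simp at hw
  have h1 := abs_lt.1 (abs_arg_lt_pi_div_two_iff.2 (Or.inl hz))
  have h2 := abs_lt.1 (abs_arg_lt_pi_div_two_iff.2 (Or.inl hw))
  exact (Complex.log_mul_eq_add_log_iff hz0 hw0).2 ⟨by linarith, by linarith⟩

lemma LogAsymp.Gamma {a : ℝ} (ha : 0 < a) (b : ℂ) :
    LogAsymp (fun z => Complex.Gamma (a * z + b)) a (a * Real.log a) := by
  obtain ⟨C, hC0, hC⟩ := exists_Gamma_le_mul_norm b.im
  -- Far enough to the right that Re(az + b) is at least 6 and at least half of a Re z, and that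
  -- |b/(az)| ≤ 1/2.
  set X : ℝ := 1 + (6 + 2 * ‖b‖) / a with hX
  have hb := norm_nonneg b
  have hXa : a * X = a + 6 + 2 * ‖b‖ := by rw [hX]; field_simp; ring
  have hX1 : 1 ≤ X := by rw [hX]; linarith [show 0 ≤ (6 + 2 * ‖b‖) / a by positivity]
  refine ⟨X, C + 4 + 2 * ‖b‖, hX1, by positivity, fun z hz => ?_⟩
  have hz0 : 0 < z.re := by linarith
  have hbre := abs_le.1 (abs_re_le_norm b)
  have haz : a + 6 + 2 * ‖b‖ ≤ a * z.re := by
    rw [← hXa]; gcongr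
  have hre : ((a : ℂ) * z + b).re = a * z.re + b.re := by simp
  have hre6 : 6 ≤ ((a : ℂ) * z + b).re := by rw [hre]; linarith
  have hhalf : a * z.re / 2 ≤ ((a : ℂ) * z + b).re := by rw [hre]; linarith
  have hGd := differentiableAt_Gamma_of_lt (z := (a : ℂ) * z + b) (by linarith)
  have hlin : HasDerivAt (fun z : ℂ => (a : ℂ) * z + b) (a * 1) z :=
    ((hasDerivAt_id z).const_mul _).add_const _
  have hd : HasDerivAt (fun z : ℂ => Complex.Gamma (a * z + b))
      (deriv Complex.Gamma (a * z + b) * (a * 1)) z := hGd.hasDerivAt.comp z hlin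
  have hne := Gamma_ne_zero_of_lt (z := (a : ℂ) * z + b) (by linarith)
  refine ⟨hd.differentiableAt, hne, ?_, fun hi => ?_⟩
  · have h1 := norm_Gamma_le (z := (a : ℂ) * z + b) (by linarith)
    have h2 := hC (a * z.re + b.re) (by linarith)
    rw [hre] at h1
    have e : ((a * z.re + b.re : ℝ) : ℂ) + b.im * I = a * (z.re : ℂ) + b := by
      push_cast
      linear_combination re_add_im b
    rw [e] at h2
    refine h1.trans (h2.trans ?_)
    gcongr
    linarith
  · have hld : logDeriv (fun z : ℂ => Complex.Gamma (a * z + b)) z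
        = a * Complex.digamma (a * z + b) := by
      rw [logDeriv_apply, hd.deriv, Complex.digamma_def, logDeriv_apply]; ring
    have hz0' : z ≠ 0 := by rintro rfl; simp at hz0
    have hac : (a : ℂ) ≠ 0 := ofReal_ne_zero.2 ha.ne'
    set u : ℂ := b / (a * z) with hu
    have hnz : z.re ≤ ‖z‖ := re_le_norm z
    have hun : ‖u‖ ≤ ‖b‖ / (a * z.re) := by
      rw [hu, norm_div, norm_mul, norm_real, Real.norm_of_nonneg ha.le]
      gcongr
    have hu2 : ‖u‖ ≤ 1 / 2 := by
      refine hun.trans ?_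
      rw [div_le_div_iff₀ (by positivity) two_pos]
      linarith
    have hure : 0 < (1 + u).re := by
      have := (abs_le.1 ((abs_re_le_norm u).trans hu2)).1
      simp; linarith
    have hlog : log ((a : ℂ) * z + b) = Real.log a + log z + log (1 + u) := by
      have e : (a : ℂ) * z + b = a * (z * (1 + u)) := by rw [hu]; field_simp
      have h1 : z * (1 + u) ≠ 0 := mul_ne_zero hz0' fun e => by rw [e] at hure; simp at hure
      rw [e, log_ofReal_mul ha h1, log_mul_of_re_pos hz0 hure]; ring
    have hlu : ‖log (1 + u)‖ ≤ 2 * ‖u‖ := by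
      have h1 := norm_log_one_add_half_le_self hu2
      linarith [norm_nonneg u]
    have hdg := norm_digamma_sub_log_le (z := (a : ℂ) * z + b) (by linarith)
    rw [hlog] at hdg
    rw [hld, show (a : ℂ) * Complex.digamma (a * z + b) - (a * log z + ((a * Real.log a : ℝ) : ℂ))
      = a * ((Complex.digamma (a * z + b) - (Real.log a + log z + log (1 + u))) + log (1 + u)) by
        push_cast; ring, norm_mul, norm_real, Real.norm_of_nonneg ha.le]
    have h3 : 2 / ((a : ℂ) * z + b).re ≤ 4 / (a * z.re) := by
      rw [div_le_div_iff₀ (by linarith) (by positivity)]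
      linarith
    calc a * ‖(Complex.digamma (a * z + b) - (Real.log a + log z + log (1 + u))) + log (1 + u)‖
        ≤ a * (4 / (a * z.re) + 2 * (‖b‖ / (a * z.re))) := by
          gcongr
          exact (norm_add_le _ _).trans (add_le_add (hdg.trans h3) (hlu.trans (by gcongr)))
      _ = (4 + 2 * ‖b‖) / z.re := by field_simp
      _ ≤ _ := by gcongr; linarith

lemma LogAsymp.Gammaℝ (b : ℂ) :
    LogAsymp (fun z => Complex.Gammaℝ (1 / 2 + z + b)) (1 / 2)
      (-(1 / 2) * Real.log Real.pi + 1 / 2 * Real.log (1 / 2)) := by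
  have h := (LogAsymp.const_cpow Real.pi_pos (-(1 / 2)) (-(1 / 2 + b) / 2)).mul
    (LogAsymp.Gamma (a := 1 / 2) (by norm_num) ((1 / 2 + b) / 2))
  rw [zero_add] at h
  refine h.congr (Y := 0) fun z _ => ?_
  rw [Complex.Gammaℝ_def]
  congr 2 <;> (push_cast; ring)

lemma LogAsymp.Gammaℂ (b : ℂ) :
    LogAsymp (fun z => Complex.Gammaℂ (1 / 2 + z + b)) 1 (-Real.log (2 * Real.pi)) := by
  have h := ((LogAsymp.const (k := 2) two_ne_zero).mul
    (LogAsymp.const_cpow Real.two_pi_pos (-1) (-(1 / 2 + b)))).mul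
    (LogAsymp.Gamma (a := 1) one_pos (1 / 2 + b))
  have e1 : (0 : ℝ) + 0 + 1 = 1 := by norm_num
  have e2 : (0 : ℝ) + -1 * Real.log (2 * Real.pi) + 1 * Real.log 1
    = -Real.log (2 * Real.pi) := by simp
  rw [e1, e2] at h
  refine h.congr (Y := 0) fun z _ => ?_
  rw [Complex.Gammaℂ_def]
  congr 2
  · congr 1 <;> (push_cast; ring)
  · push_cast; ring

end LogAsymptotics

/-! ### Growth of the factors on vertical strips. -/

section StripGrowth

/-- `f` grows at most like `|y| ^ p` on the strip `x₁ ≤ x ≤ x₂`. -/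
def StripGrowth (x₁ x₂ : ℝ) (f : ℂ → ℂ) (p : ℝ) : Prop :=
  ∃ C Y : ℝ, 0 ≤ C ∧ 1 ≤ Y ∧ ∀ x y : ℝ, x₁ ≤ x → x ≤ x₂ → Y ≤ |y| →
    ‖f (x + y * I)‖ ≤ C * |y| ^ p

variable {x₁ x₂ : ℝ}

lemma StripGrowth.mul {f g : ℂ → ℂ} {p q : ℝ} (hf : StripGrowth x₁ x₂ f p)
    (hg : StripGrowth x₁ x₂ g q) : StripGrowth x₁ x₂ (fun z => f z * g z) (p + q) := by
  obtain ⟨C, X, hC, hX, H⟩ := hf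
  obtain ⟨D, Y, hD, hY, K⟩ := hg
  refine ⟨C * D, max X Y, by positivity, le_max_of_le_left hX, fun x y h1 h2 h3 => ?_⟩
  have hy : 0 < |y| := by linarith [(le_max_left X Y).trans h3]
  rw [norm_mul, Real.rpow_add hy]
  calc _ ≤ (C * |y| ^ p) * (D * |y| ^ q) := by
        gcongr
        · exact H x y h1 h2 ((le_max_left X Y).trans h3)
        · exact K x y h1 h2 ((le_max_right X Y).trans h3)
    _ = _ := by ring

lemma StripGrowth.const (k : ℂ) : StripGrowth x₁ x₂ (fun _ => k) 0 :=
  ⟨‖k‖, 1, norm_nonneg _, le_rfl, fun x y _ _ _ => by simp⟩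

lemma StripGrowth.prod {ι : Type*} (s : Finset ι) {g : ι → ℂ → ℂ} {p : ℝ}
    (h : ∀ i, StripGrowth x₁ x₂ (g i) p) :
    StripGrowth x₁ x₂ (fun z => ∏ i ∈ s, g i z) (s.card * p) := by
  classical
  induction s using Finset.induction_on with
  | empty => simpa using StripGrowth.const 1
  | insert a s ha ih =>
    have := (h a).mul ih
    simp only [Finset.prod_insert ha, Finset.card_insert_of_notMem ha]
    convert this using 1
    push_cast; ring

lemma StripGrowth.congr {f g : ℂ → ℂ} {p : ℝ} (hf : StripGrowth x₁ x₂ f p) {Y : ℝ}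
    (h : ∀ z : ℂ, Y < |z.im| → g z = f z) : StripGrowth x₁ x₂ g p := by
  obtain ⟨C, X, hC, hX, H⟩ := hf
  refine ⟨C, max X (Y + 1), hC, le_max_of_le_left hX, fun x y h1 h2 h3 => ?_⟩
  rw [h]
  · exact H x y h1 h2 ((le_max_left _ _).trans h3)
  · have := (le_max_right _ _).trans h3
    simp
    linarith

lemma StripGrowth.mono {f : ℂ → ℂ} {p q : ℝ} (hf : StripGrowth x₁ x₂ f p) (hpq : p ≤ q) :
    StripGrowth x₁ x₂ f q := by
  obtain ⟨C, X, hC, hX, H⟩ := hf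
  refine ⟨C, X, hC, hX, fun x y h1 h2 h3 => (H x y h1 h2 h3).trans ?_⟩
  have : 1 ≤ |y| := hX.trans h3
  gcongr

lemma StripGrowth.const_cpow {A : ℝ} (hA : 0 < A) (α : ℝ) (β : ℂ) :
    StripGrowth x₁ x₂ (fun z => (A : ℂ) ^ (α * z + β)) 0 := by
  refine ⟨Real.exp (|Real.log A| * (|α| * max |x₁| |x₂| + |β.re|)), 1, (Real.exp_pos _).le, le_rfl,
    fun x y h1 h2 _ => ?_⟩
  rw [norm_cpow_eq_rpow_re_of_pos hA, Real.rpow_zero, mul_one, Real.rpow_def_of_pos hA]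
  apply Real.exp_le_exp.2
  refine (le_abs_self _).trans ?_
  rw [abs_mul]
  have hx : |x| ≤ max |x₁| |x₂| := abs_le_max_abs_abs h1 h2
  have e : ((α : ℂ) * (x + y * I) + β).re = α * x + β.re := by simp
  rw [e]
  gcongr
  refine (abs_add_le _ _).trans ?_
  rw [abs_mul]
  gcongr

lemma StripGrowth.Gamma {a : ℝ} (ha : 0 < a) (b : ℂ) (m : ℕ) :
    StripGrowth x₁ x₂ (fun z => Complex.Gamma (a * z + b)) (-m) := by
  obtain ⟨C, hC0, hC⟩ := exists_norm_Gamma_le_inv_pow m (a * x₁ + b.re) (a * x₂ + b.re)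
  refine ⟨C * (2 / a) ^ m, 1 + (2 + 2 * |b.im|) / a, by positivity, ?_, fun x y h1 h2 h3 => ?_⟩
  · linarith [show 0 ≤ (2 + 2 * |b.im|) / a by positivity]
  · have h4 : a + (2 + 2 * |b.im|) ≤ a * |y| := by
      calc a + (2 + 2 * |b.im|) = a * (1 + (2 + 2 * |b.im|) / a) := by field_simp
        _ ≤ _ := by gcongr
    have h5 : a * |y| / 2 ≤ |a * y + b.im| := by
      have := abs_sub_abs_le_abs_sub (a * y) (-b.im)
      rw [abs_mul, abs_of_pos ha, abs_neg, sub_neg_eq_add] at this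
      linarith
    have h6 := hC (a * x + b.re) (a * y + b.im) (by gcongr) (by gcongr)
      (by linarith [abs_nonneg b.im])
    have e : ((a * x + b.re : ℝ) : ℂ) + (a * y + b.im : ℝ) * I = a * (x + y * I) + b := by
      push_cast
      linear_combination re_add_im b
    rw [e] at h6
    have hy : 0 < |y| := by
      by_contra hle
      have : a * |y| ≤ 0 := mul_nonpos_of_nonneg_of_nonpos ha.le (not_lt.1 hle)
      linarith [abs_nonneg b.im]
    rw [Real.rpow_neg hy.le, Real.rpow_natCast]
    calc _ ≤ C / |a * y + b.im| ^ m := h6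
      _ ≤ C / (a * |y| / 2) ^ m := by gcongr
      _ = _ := by rw [div_pow, div_pow, mul_pow]; field_simp

lemma StripGrowth.Gammaℝ (b : ℂ) (m : ℕ) :
    StripGrowth x₁ x₂ (fun z => Complex.Gammaℝ (1 / 2 + z + b)) (-m) := by
  have h := (StripGrowth.const_cpow (x₁ := x₁) (x₂ := x₂) Real.pi_pos (-(1 / 2))
    (-(1 / 2 + b) / 2)).mul (StripGrowth.Gamma (a := 1 / 2) (by norm_num) ((1 / 2 + b) / 2) m)
  rw [zero_add] at h
  refine h.congr (Y := 0) fun z _ => ?_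
  rw [Complex.Gammaℝ_def]
  congr 2 <;> (push_cast; ring)

lemma StripGrowth.Gammaℂ (b : ℂ) (m : ℕ) :
    StripGrowth x₁ x₂ (fun z => Complex.Gammaℂ (1 / 2 + z + b)) (-m) := by
  have h := ((StripGrowth.const (x₁ := x₁) (x₂ := x₂) 2).mul
    (StripGrowth.const_cpow Real.two_pi_pos (-1) (-(1 / 2 + b)))).mul
    (StripGrowth.Gamma (a := 1) one_pos (1 / 2 + b) m)
  rw [zero_add, zero_add] at h
  refine h.congr (Y := 0) fun z _ => ?_
  rw [Complex.Gammaℂ_def]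
  congr 2
  · congr 1 <;> (push_cast; ring)
  · push_cast; ring

end StripGrowth

end LTaylor

namespace LTaylor

/-! ### The Dirichlet series far to the right. -/

section DirichletSeries

open Metric

/-- Compared with its size at τ, each term with n ≥ 2 shrinks at least by 2^{τ - Re z}. The decay is
exponential, but O(1/Re z) is all that is needed. -/
lemma exists_norm_LSeries_sub_le {a : ℕ → ℝ} {L : ℂ → ℂ} {σ : ℝ}
    (h : ∀ z : ℂ, σ < z.re → LSeriesHasSum (fun n => (a n : ℂ)) z (L z)) :
    ∃ M Y : ℝ, 0 ≤ M ∧ 1 ≤ Y ∧ ∀ z : ℂ, Y ≤ z.re → ‖L z - a 1‖ ≤ M / z.re := by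
  set τ : ℝ := σ + 1 with hτ
  set t := LSeries.term (fun n => (a n : ℂ)) with ht
  have hs : Summable fun n => ‖t τ n‖ := (h τ (by simp [hτ])).summable.norm
  set S : ℝ := ∑' n, ‖t τ n‖ with hS
  have hS0 : 0 ≤ S := tsum_nonneg fun n => norm_nonneg _
  refine ⟨S * 2 ^ τ * 2, max τ 1, by positivity, le_max_right _ _, fun z hz => ?_⟩
  have hz1 : τ ≤ z.re := (le_max_left _ _).trans hz
  have hz2 : 1 ≤ z.re := (le_max_right _ _).trans hz
  have hb : ∀ n : ℕ, ‖(if n = 1 then 0 else t z n)‖ ≤ ‖t τ n‖ * 2 ^ (τ - z.re) := by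
    intro n
    split_ifs with h1
    · rw [norm_zero]; positivity
    · rw [ht, LSeries.norm_term_eq, LSeries.norm_term_eq]
      split_ifs with h0
      · simp
      · have hn : (2 : ℝ) ≤ n := by
          have : 2 ≤ n := by omega
          exact_mod_cast this
        have hn0 : (0 : ℝ) < n := by linarith
        rw [ofReal_re]
        have e : (n : ℝ) ^ z.re = n ^ τ * n ^ (z.re - τ) := by
          rw [← Real.rpow_add hn0]; congr 1; ring
        rw [e, ← div_div, div_eq_mul_inv (‖(a n : ℂ)‖ / (n : ℝ) ^ τ),
          show τ - z.re = -(z.re - τ) by ring, Real.rpow_neg two_pos.le]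
        have : (2 : ℝ) ^ (z.re - τ) ≤ (n : ℝ) ^ (z.re - τ) := by
          apply Real.rpow_le_rpow two_pos.le hn; linarith
        gcongr
  have hsum := hasSum_ite_sub_hasSum (h z (by linarith)) 1
  have h1 : t z 1 = a 1 := by simp [ht]
  have hle := tsum_of_norm_bounded (hs.hasSum.mul_right ((2 : ℝ) ^ (τ - z.re))) hb
  rw [hsum.tsum_eq, ← ht, h1, ← hS] at hle
  refine hle.trans ?_
  rw [sub_eq_add_neg τ, Real.rpow_add two_pos, Real.rpow_neg two_pos.le, ← mul_assoc,
    mul_div_assoc]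
  have h2 : z.re / 2 ≤ (2 : ℝ) ^ z.re := by
    rw [Real.rpow_def_of_pos two_pos]
    have h3 := Real.add_one_le_exp (Real.log 2 * z.re)
    nlinarith [Real.log_two_gt_d9]
  have h4 : ((2 : ℝ) ^ z.re)⁻¹ ≤ 2 / z.re := by
    rw [← inv_div]; gcongr
  gcongr

/-- L tends to a₁ ≠ 0, and Cauchy's estimate on unit circles makes L' small, so L contributes
nothing to the leading terms of F'/F. -/
lemma LogAsymp.LSeries {a : ℕ → ℝ} (ha : a 1 ≠ 0) {L : ℂ → ℂ} (hL : Differentiable ℂ L) {σ : ℝ}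
    (h : ∀ z : ℂ, σ < z.re → LSeriesHasSum (fun n => (a n : ℂ)) z (L z)) :
    LogAsymp (fun z => L (1 / 2 + z)) 0 0 := by
  obtain ⟨M, Y, hM, hY, H⟩ := exists_norm_LSeries_sub_le h
  set b : ℝ := |a 1| with hb
  have hb0 : 0 < b := abs_pos.2 ha
  have hnb : ‖(a 1 : ℂ)‖ = b := by rw [norm_real, Real.norm_eq_abs]
  have hH : ∀ z : ℂ, Y ≤ z.re → ‖L (1 / 2 + z) - a 1‖ ≤ M / z.re := by
    intro z hz
    have hre : (1 / 2 + z).re = 1 / 2 + z.re := by simp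
    refine (H (1 / 2 + z) (by rw [hre]; linarith)).trans ?_
    rw [hre]
    have : 0 < z.re := by linarith
    gcongr
    linarith
  have hX : ∀ z : ℂ, Y + 1 + 2 * M / b ≤ z.re → b / 2 ≤ ‖L (1 / 2 + z)‖ ∧
      ‖L (1 / 2 + z)‖ ≤ 3 * b / 2 := by
    intro z hz
    have hq : 0 ≤ 2 * M / b := by positivity
    have h1 := hH z (by linarith)
    have h2 : M / z.re ≤ b / 2 := by
      rw [div_le_div_iff₀ (by linarith) two_pos]
      have : 2 * M / b ≤ z.re := by linarith
      rw [div_le_iff₀ hb0] at this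
      linarith
    have h3 := norm_sub_norm_le (L (1 / 2 + z)) (a 1)
    have h4 := norm_sub_norm_le (a 1 : ℂ) (L (1 / 2 + z))
    rw [norm_sub_rev] at h4
    rw [hnb] at h3 h4
    constructor <;> linarith
  have hd : Differentiable ℂ fun z => L (1 / 2 + z) := by fun_prop
  refine ⟨Y + 1 + 2 * M / b, 3 + 4 * M / b, by linarith [show 0 ≤ 2 * M / b by positivity],
    by positivity, fun z hz => ?_⟩
  have hq : 0 ≤ 2 * M / b := by positivity
  obtain ⟨l1, l2⟩ := hX z hz
  refine ⟨hd z, ?_, ?_, fun _ => ?_⟩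
  · rw [← norm_pos_iff]; linarith
  · obtain ⟨l3, -⟩ := hX z.re (by rwa [ofReal_re])
    have : 3 * ‖L (1 / 2 + z.re)‖ ≤ (3 + 4 * M / b) * ‖L (1 / 2 + z.re)‖ := by
      gcongr
      linarith [show 0 ≤ 4 * M / b by positivity]
    linarith
  · have hder : ‖deriv (fun z => L (1 / 2 + z)) z‖ ≤ 2 * M / z.re := by
      have e : deriv (fun z => L (1 / 2 + z)) z = deriv (fun z => L (1 / 2 + z) - a 1) z := by
        rw [deriv_sub_const]
      rw [e]
      have := norm_deriv_le_of_forall_mem_sphere_norm_le (f := fun z => L (1 / 2 + z) - a 1)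
        (c := z) (R := 1) (C := 2 * M / z.re) one_pos (hd.sub_const _).diffContOnCl (by
          intro w hw
          have hw1 := (abs_le.1 ((abs_re_le_norm _).trans (mem_sphere_iff_norm.1 hw).le)).1
          rw [sub_re] at hw1
          refine (hH w (by linarith)).trans ?_
          rw [div_le_div_iff₀ (by linarith) (by linarith)]
          nlinarith)
      simpa using this
    have hz0 : 0 < z.re := by linarith
    rw [ofReal_zero, zero_mul, zero_add, sub_zero, logDeriv_apply, norm_div]
    calc _ ≤ (2 * M / z.re) / (b / 2) := by gcongr
      _ = (4 * M / b) / z.re := by field_simp; ring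
      _ ≤ _ := by gcongr; linarith

end DirichletSeries

/-! ### The completed function. -/

section CompletedFunction

/-- The properties of the completed function, centred at the symmetry point, on which the analysis
of its Taylor polynomials rests. -/
structure CompletedAsymp (F : ℂ → ℂ) (d c X C₀ : ℝ) : Prop where
  pos : 0 < d
  one_le : 1 ≤ X
  nonneg : 0 ≤ C₀
  entire : Differentiable ℂ F
  even : ∀ z, F (-z) = F z
  conj : ∀ z, F (starRingEnd ℂ z) = starRingEnd ℂ (F z)
  ne_zero : ∀ z : ℂ, X ≤ z.re → F z ≠ 0
  vertical : ∀ z : ℂ, X ≤ z.re → ‖F z‖ ≤ C₀ * ‖F z.re‖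
  logDeriv_le : ∀ z : ℂ, X ≤ z.re → |z.im| ≤ z.re →
    ‖logDeriv F z - (d / 2 * log z + c)‖ ≤ C₀ / z.re
  decay : ∀ R : ℝ, ∃ C Y : ℝ, 0 < Y ∧ ∀ x y : ℝ, |x| ≤ R → Y ≤ |y| → ‖F (x + y * I)‖ ≤ C / y ^ 2

/-- Logarithmic derivatives add: Γ_ℝ contributes (1/2) log z - (1/2) log 2π, Γ_ℂ contributes log z -
log 2π, and the power of N contributes (1/2) log N. -/
theorem exists_completedAsymp (a : ℕ → ℝ) (L : ℂ → ℂ) (ha : a 1 ≠ 0)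
    (hseries : ∃ σ : ℝ, ∀ z : ℂ, σ < z.re → LSeriesHasSum (fun n => (a n : ℂ)) z (L z))
    (hL : Differentiable ℂ L)
    (N : ℝ) (hN : 0 < N) (J K : ℕ) (hJK : 0 < J + K) (μ : Fin J → ℂ) (η : Fin K → ℂ)
    (Λ : ℂ → ℂ) (hΛ : Differentiable ℂ Λ)
    (hΛL : ∀ z : ℂ, (∀ j, ∀ m : ℕ, z + μ j ≠ -(2 * m)) → (∀ k, ∀ m : ℕ, z + η k ≠ -m) →
      Λ z = (N : ℂ) ^ (z / 2) * (∏ j, Complex.Gammaℝ (z + μ j)) *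
        (∏ k, Complex.Gammaℂ (z + η k)) * L z)
    (hΛreal : ∀ z : ℂ, Λ (starRingEnd ℂ z) = starRingEnd ℂ (Λ z))
    (hΛsymm : ∀ z : ℂ, Λ z = Λ (1 - z))
    (hgrowth : ∀ x₁ x₂ : ℝ, ∃ C A Y : ℝ, 0 < C ∧ 0 < A ∧ 0 < Y ∧
      ∀ x y : ℝ, x₁ ≤ x → x ≤ x₂ → Y ≤ |y| → ‖L (x + y * Complex.I)‖ ≤ C * |y| ^ A)
    (F : ℂ → ℂ) (hF : ∀ z : ℂ, F z = Λ (1 / 2 + z)) :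
    ∃ X C₀ : ℝ, CompletedAsymp F (J + 2 * K)
      (1 / 2 * Real.log N - (J + 2 * K) / 2 * Real.log (2 * Real.pi)) X C₀ := by
  obtain ⟨σ, hσ⟩ := hseries
  set G : ℂ → ℂ := fun z => (N : ℂ) ^ (((1 / 2 : ℝ) : ℂ) * z + 1 / 4) *
    (∏ j, Complex.Gammaℝ (1 / 2 + z + μ j)) * (∏ k, Complex.Gammaℂ (1 / 2 + z + η k)) *
    L (1 / 2 + z) with hG
  have hFG : ∀ z : ℂ, (∀ j, ∀ m : ℕ, 1 / 2 + z + μ j ≠ -(2 * m)) →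
      (∀ k, ∀ m : ℕ, 1 / 2 + z + η k ≠ -m) → F z = G z := by
    intro z h1 h2
    rw [hF, hΛL _ h1 h2, hG]
    congr 4
    push_cast; ring
  -- All poles of the shifted Gamma factors satisfy Re ≤ S and |Im| ≤ S, so the product formula for
  -- Λ is available beyond these bounds.
  set S : ℝ := (∑ j, ‖μ j‖) + ∑ k, ‖η k‖ with hS
  have hμ : ∀ j, ‖μ j‖ ≤ S := fun j =>
    (Finset.single_le_sum (fun i _ => norm_nonneg (μ i)) (Finset.mem_univ j)).trans
      (le_add_of_nonneg_right (Finset.sum_nonneg fun k _ => norm_nonneg _))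
  have hη : ∀ k, ‖η k‖ ≤ S := fun k =>
    (Finset.single_le_sum (fun i _ => norm_nonneg (η i)) (Finset.mem_univ k)).trans
      (le_add_of_nonneg_left (Finset.sum_nonneg fun k _ => norm_nonneg _))
  have hpole : ∀ b w : ℂ, ‖b‖ ≤ S → ∀ r : ℝ, 0 ≤ r → (S < w.re ∨ S < |w.im|) →
      1 / 2 + w + b ≠ -(r : ℂ) := by
    intro b w hb r hr hw e
    rcases hw with hw | hw
    · have h1 := congrArg re e
      have h2 := (abs_le.1 ((abs_re_le_norm b).trans hb)).1
      simp at h1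
      linarith
    · have h1 := congrArg im e
      have h2 := (abs_im_le_norm b).trans hb
      simp at h1
      have h3 : w.im = -b.im := by linarith
      rw [h3, abs_neg] at hw
      linarith
  have hFG' : ∀ z : ℂ, (S < z.re ∨ S < |z.im|) → F z = G z := by
    intro z hz
    refine hFG z (fun j m => ?_) fun k m => ?_
    · have := hpole (μ j) z (hμ j) (2 * m) (by positivity) hz
      push_cast at this
      exact this
    · have := hpole (η k) z (hη k) m (by positivity) hz
      push_cast at this
      exact this
  have hasymp : LogAsymp F ((J + 2 * K) / 2)
      (1 / 2 * Real.log N - (J + 2 * K) / 2 * Real.log (2 * Real.pi)) := by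
    have h1 := (((LogAsymp.const_cpow hN (1 / 2) (1 / 4)).mul
      (LogAsymp.prod Finset.univ fun j => LogAsymp.Gammaℝ (μ j))).mul
      (LogAsymp.prod Finset.univ fun k => LogAsymp.Gammaℂ (η k))).mul
      (LogAsymp.LSeries ha hL hσ)
    have h2 := h1.congr (g := F) (Y := S) fun z hz => hFG' z (Or.inl hz)
    convert h2 using 1
    · simp only [Finset.card_univ, Fintype.card_fin]; ring
    · simp only [Finset.card_univ, Fintype.card_fin]
      rw [Real.log_mul two_ne_zero Real.pi_ne_zero, one_div, Real.log_inv]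
      ring
  have hdecay : ∀ R : ℝ, StripGrowth (-R) R F (-2) := by
    intro R
    obtain ⟨C, A, Y, hC, hA, hY, hb⟩ := hgrowth (1 / 2 - R) (1 / 2 + R)
    -- Every Gamma factor supplies |y|^{-m}, and there is at least one, so the product is O(|y|^{A -
    -- m}), hence O(|y|^{-2}).
    obtain ⟨m, hm⟩ := exists_nat_ge (A + 2)
    have hLg : StripGrowth (-R) R (fun z => L (1 / 2 + z)) A := by
      refine ⟨C, max 1 Y, hC.le, le_max_left _ _, fun x y h1 h2 h3 => ?_⟩
      have := hb (1 / 2 + x) y (by linarith) (by linarith) ((le_max_right _ _).trans h3)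
      rwa [show ((1 / 2 + x : ℝ) : ℂ) + y * I = 1 / 2 + (x + y * I) by push_cast; ring] at this
    have h1 := (((StripGrowth.const_cpow (x₁ := -R) (x₂ := R) hN (1 / 2) (1 / 4)).mul
      (StripGrowth.prod Finset.univ fun j => StripGrowth.Gammaℝ (μ j) m)).mul
      (StripGrowth.prod Finset.univ fun k => StripGrowth.Gammaℂ (η k) m)).mul hLg
    have h2 := h1.congr (g := F) (Y := S) fun z hz => hFG' z (Or.inr hz)
    refine h2.mono ?_
    simp only [Finset.card_univ, Fintype.card_fin]
    have h3 : (1 : ℝ) ≤ J + K := by exact_mod_cast hJK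
    have hm0 : (0 : ℝ) ≤ m := m.cast_nonneg
    nlinarith
  obtain ⟨X, C, hX, hC, H⟩ := hasymp
  refine ⟨X, C, ?_⟩
  have hFeq : F = fun z => Λ (1 / 2 + z) := funext hF
  refine ⟨?_, hX, hC, ?_, ?_, ?_, fun z hz => (H z hz).2.1, fun z hz => (H z hz).2.2.1,
    fun z hz hi => ?_, fun R => ?_⟩
  · have : 0 < J + 2 * K := by omega
    exact_mod_cast this
  · rw [hFeq]; fun_prop
  · intro z
    rw [hF, hF, hΛsymm (1 / 2 + z)]
    congr 1; ring
  · intro z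
    rw [hF, hF, ← hΛreal, map_add, map_div₀, map_one, map_ofNat]
  · have := (H z hz).2.2.2 hi
    push_cast at this ⊢
    exact this
  · obtain ⟨C, Y, hC, hY, hb⟩ := hdecay R
    refine ⟨C, Y, by linarith, fun x y hx hy => (hb x y (abs_le.1 hx).1 (abs_le.1 hx).2 hy).trans ?_⟩
    have : 0 < |y| := by linarith
    rw [Real.rpow_neg this.le, Real.rpow_two, sq_abs, div_eq_mul_inv]

end CompletedFunction

end LTaylor

namespace LTaylor

/-! ### Existence, uniqueness and size of the scale λ. -/

section CriticalScale

open Metric Set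

lemma lambertW_spec {x : ℝ} (hx : 0 < x) :
    0 < lambertW x ∧ lambertW x * Real.exp (lambertW x) = x := by
  have hc : ContinuousOn (fun w : ℝ => w * Real.exp w) (Icc 0 x) := by fun_prop
  have hmem : x ∈ Icc ((fun w : ℝ => w * Real.exp w) 0) ((fun w : ℝ => w * Real.exp w) x) := by
    simp only [zero_mul, mem_Icc]
    exact ⟨hx.le, le_mul_of_one_le_right hx.le (Real.one_le_exp hx.le)⟩
  obtain ⟨w, hw, hwx⟩ := intermediate_value_Icc hx.le hc hmem
  have hex : ∃ a ∈ Ici (-1 : ℝ), a * Real.exp a = x := ⟨w, by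
    rw [mem_Ici]; linarith [hw.1], hwx⟩
  have h2 : lambertW x * Real.exp (lambertW x) = x := Function.invFunOn_eq hex
  refine ⟨?_, h2⟩
  by_contra hle
  have : lambertW x * Real.exp (lambertW x) ≤ 0 :=
    mul_nonpos_of_nonpos_of_nonneg (not_lt.1 hle) (Real.exp_pos _).le
  linarith

namespace CompletedAsymp

variable {F : ℂ → ℂ} {d c X C₀ : ℝ} (h : CompletedAsymp F d c X C₀)
include h

lemma logDeriv_conj (z : ℂ) :
    logDeriv F (starRingEnd ℂ z) = starRingEnd ℂ (logDeriv F z) := by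
  have hF : starRingEnd ℂ ∘ F ∘ starRingEnd ℂ = F := by
    ext w
    simp only [Function.comp_apply, h.conj, conj_conj]
  have h1 := congrFun (deriv_conj_conj (f := F)) z
  rw [hF] at h1
  simp only [Function.comp_apply] at h1
  rw [logDeriv_apply, logDeriv_apply, h.conj, map_div₀, h1, conj_conj]

lemma logDeriv_ofReal (x : ℝ) : logDeriv F x = ((logDeriv F x).re : ℂ) := by
  have := h.logDeriv_conj x
  rw [conj_ofReal] at this
  exact (conj_eq_iff_re.1 this.symm).symm

lemma isCriticalScale_iff {n : ℕ} (hn : n ≠ 0) (x : ℝ) :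
    IsCriticalScale F n x ↔ F x ≠ 0 ∧ x * (logDeriv F x).re = 2 * n := by
  rw [IsCriticalScale, ← logDeriv_apply, h.logDeriv_ofReal]
  refine and_congr_right fun _ => ?_
  have hn' : (n : ℂ) ≠ 0 := by exact_mod_cast hn
  rw [ofReal_re, sub_eq_zero]
  constructor
  · intro e
    have : ((x * (logDeriv F x).re : ℝ) : ℂ) = ((2 * n : ℝ) : ℂ) := by
      push_cast
      field_simp at e
      linear_combination -e
    exact_mod_cast this
  · intro e
    have : (x : ℂ) * ((logDeriv F x).re : ℂ) = 2 * n := by exact_mod_cast congrArg ofReal e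
    field_simp
    linear_combination -this

lemma abs_logDeriv_sub_le {x : ℝ} (hx : X ≤ x) :
    |(logDeriv F x).re - (d / 2 * Real.log x + c)| ≤ C₀ / x := by
  have hx0 : 0 < x := by linarith [h.one_le]
  have h1 := h.logDeriv_le x (by simpa using hx) (by simpa using hx0.le)
  rw [ofReal_re, h.logDeriv_ofReal, ← ofReal_log hx0.le] at h1
  rw [← Real.norm_eq_abs, ← norm_real]
  push_cast
  exact h1

lemma differentiableAt_logDeriv {z : ℂ} (hz : F z ≠ 0) : DifferentiableAt ℂ (logDeriv F) z :=
  (h.entire.deriv z).div (h.entire z) hz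

/-- Cauchy's estimate on the disc of radius x/4, which stays in the sector |Im| ≤ Re and in Re ≥
3x/4 ≥ X, where the error is at most 2C₀/x. -/
lemma norm_deriv_logDeriv_sub_le {x : ℝ} (hx : 2 * X ≤ x) :
    ‖deriv (logDeriv F) x - d / 2 * (x : ℂ)⁻¹‖ ≤ 8 * C₀ / x ^ 2 := by
  have hX := h.one_le
  have hx0 : 0 < x := by linarith
  have hC := h.nonneg
  have hball : ∀ w ∈ closedBall (x : ℂ) (x / 4), 3 / 4 * x ≤ w.re ∧ |w.im| ≤ w.re := by
    intro w hw
    rw [mem_closedBall_iff_norm] at hw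
    have h1 := (abs_le.1 ((abs_re_le_norm _).trans hw)).1
    have h2 := (abs_im_le_norm _).trans hw
    rw [sub_re, ofReal_re] at h1
    rw [sub_im, ofReal_im, sub_zero] at h2
    constructor <;> linarith
  have hda : ∀ w ∈ closedBall (x : ℂ) (x / 4), DifferentiableAt ℂ
      (fun z => logDeriv F z - (d / 2 * log z + c)) w := by
    intro w hw
    obtain ⟨h1, h2⟩ := hball w hw
    exact (h.differentiableAt_logDeriv (h.ne_zero w (by linarith))).sub
      (((differentiableAt_log (Or.inl (by linarith))).const_mul _).add_const _)
  have hd : DiffContOnCl ℂ (fun z => logDeriv F z - (d / 2 * log z + c)) (ball x (x / 4)) := by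
    apply DifferentiableOn.diffContOnCl
    rw [closure_ball _ (by positivity)]
    exact fun w hw => (hda w hw).differentiableWithinAt
  have h1 := norm_deriv_le_of_forall_mem_sphere_norm_le (C := 2 * C₀ / x)
    (by positivity) hd (fun w hw => by
      obtain ⟨h1, h2⟩ := hball w (sphere_subset_closedBall hw)
      refine (h.logDeriv_le w (by linarith) h2).trans ?_
      rw [div_le_div_iff₀ (by linarith) hx0]
      nlinarith)
  have hl : HasDerivAt (fun z : ℂ => d / 2 * log z + c) (d / 2 * (x : ℂ)⁻¹) x :=
    ((Complex.hasDerivAt_log (Or.inl (by simpa using hx0))).const_mul _).add_const _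
  have hg := (h.differentiableAt_logDeriv (h.ne_zero x (by rw [ofReal_re]; linarith))).hasDerivAt
  rw [(hg.fun_sub hl).deriv] at h1
  refine h1.trans (le_of_eq ?_)
  field_simp
  ring

lemma hasDerivAt_mul_logDeriv {x : ℝ} (hx : 2 * X ≤ x) :
    HasDerivAt (fun x : ℝ => x * (logDeriv F x).re)
      (1 * (logDeriv F x).re + x * (deriv (logDeriv F) x).re) x := by
  have hX := h.one_le
  have hg := (h.differentiableAt_logDeriv (h.ne_zero x (by rw [ofReal_re]; linarith))).hasDerivAt
  exact (hasDerivAt_id x).fun_mul hg.real_of_complex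

lemma tendsto_logDeriv_re : Tendsto (fun x : ℝ => (logDeriv F x).re) atTop atTop := by
  have h1 : Tendsto (fun x : ℝ => d / 2 * Real.log x + (c - C₀)) atTop atTop :=
    tendsto_atTop_add_const_right _ _ (Real.tendsto_log_atTop.const_mul_atTop (half_pos h.pos))
  refine tendsto_atTop_mono' _ ?_ h1
  filter_upwards [eventually_ge_atTop X] with x hx
  have h2 := (abs_le.1 (h.abs_logDeriv_sub_le hx)).1
  have h3 : C₀ / x ≤ C₀ := div_le_self h.nonneg (by linarith [h.one_le])
  linarith

lemma tendsto_mul_logDeriv : Tendsto (fun x : ℝ => x * (logDeriv F x).re) atTop atTop :=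
  tendsto_id.atTop_mul_atTop₀ h.tendsto_logDeriv_re

/-- The derivative is F'/F + x (F'/F)'. The first term tends to infinity and the second is at least
-8C₀. -/
lemma exists_strictMonoOn :
    ∃ Y : ℝ, StrictMonoOn (fun x : ℝ => x * (logDeriv F x).re) (Ici Y) := by
  obtain ⟨Y, hY⟩ := eventually_atTop.1 (h.tendsto_logDeriv_re.eventually_ge_atTop (8 * C₀ + 1))
  refine ⟨max Y (2 * X), strictMonoOn_of_deriv_pos (convex_Ici _) (fun x hx => ?_) fun x hx => ?_⟩
  · exact (h.hasDerivAt_mul_logDeriv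
      ((le_max_right _ _).trans hx)).continuousAt.continuousWithinAt
  · rw [interior_Ici] at hx
    have hx1 : Y ≤ x := (le_max_left _ _).trans (le_of_lt hx)
    have hx2 : 2 * X ≤ x := (le_max_right _ _).trans (le_of_lt hx)
    have hX := h.one_le
    have hx0 : 0 < x := by linarith
    rw [(h.hasDerivAt_mul_logDeriv hx2).deriv]
    have h1 := (abs_le.1 ((abs_re_le_norm _).trans (h.norm_deriv_logDeriv_sub_le hx2))).1
    have h2 : ((d : ℂ) / 2 * (x : ℂ)⁻¹).re = d / 2 * x⁻¹ := by
      rw [show (d : ℂ) / 2 * (x : ℂ)⁻¹ = ((d / 2 * x⁻¹ : ℝ) : ℂ) by push_cast; ring, ofReal_re]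
    rw [sub_re, h2] at h1
    have h3 : -(8 * C₀ / x ^ 2) ≤ (deriv (logDeriv F) x).re := by
      have : 0 ≤ d / 2 * x⁻¹ := mul_nonneg (half_pos h.pos).le (inv_nonneg.2 hx0.le)
      linarith
    have h4 : -(8 * C₀) ≤ x * (deriv (logDeriv F) x).re := by
      have h5 := mul_le_mul_of_nonneg_left h3 hx0.le
      have h6 : x * -(8 * C₀ / x ^ 2) = -(8 * C₀ / x) := by field_simp
      have h7 : 8 * C₀ / x ≤ 8 * C₀ := div_le_self (by linarith [h.nonneg]) (by linarith)
      linarith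
    linarith [hY x hx1]

variable {ℓ : ℝ} (hℓ : ∀ x : ℝ, ℓ ≤ x → F x ≠ 0)
include hℓ

lemma continuousOn_mul_logDeriv :
    ContinuousOn (fun x : ℝ => x * (logDeriv F x).re) (Ici ℓ) := by
  intro x hx
  have h1 := (h.differentiableAt_logDeriv (hℓ x hx)).continuousAt
  have h2 : ContinuousAt (fun x : ℝ => logDeriv F x) x :=
    ContinuousAt.comp (f := fun x : ℝ => (x : ℂ)) h1 continuous_ofReal.continuousAt
  exact (continuousAt_id.mul (continuous_re.continuousAt.comp h2)).continuousWithinAt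

lemma exists_mul_logDeriv_le (Y : ℝ) :
    ∃ B : ℝ, ∀ x : ℝ, ℓ ≤ x → x ≤ Y → x * (logDeriv F x).re ≤ B := by
  obtain ⟨B, hB⟩ := (isCompact_Icc (a := ℓ) (b := Y)).exists_bound_of_continuousOn
    ((h.continuousOn_mul_logDeriv hℓ).mono Icc_subset_Ici_self)
  exact ⟨B, fun x h1 h2 => (le_abs_self _).trans (hB x ⟨h1, h2⟩)⟩

/-- On any bounded part of [ℓ, ∞) the function x F'/F is bounded, so for large n every solution lies
in the region of strict monotonicity. -/
lemma existsUnique_criticalScale :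
    ∀ᶠ n : ℕ in atTop, ∃! x : ℝ, ℓ < x ∧ IsCriticalScale F n x := by
  obtain ⟨Y, hY⟩ := h.exists_strictMonoOn
  set Z : ℝ := max Y (ℓ + 1) with hZ
  have hZY : Y ≤ Z := le_max_left _ _
  have hZℓ : ℓ + 1 ≤ Z := le_max_right _ _
  obtain ⟨B, hB⟩ := h.exists_mul_logDeriv_le hℓ Z
  have hlarge : ∀ᶠ n : ℕ in atTop, B < 2 * n :=
    (tendsto_natCast_atTop_atTop.const_mul_atTop two_pos).eventually_gt_atTop B
  filter_upwards [hlarge, eventually_ne_atTop 0] with n hn hn0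
  obtain ⟨U, hU1, hU2⟩ := ((h.tendsto_mul_logDeriv.eventually_ge_atTop (2 * (n : ℝ))).and
    (eventually_ge_atTop Z)).exists
  have hBZ := hB Z (by linarith) le_rfl
  obtain ⟨x, hx, hxn⟩ := intermediate_value_Icc hU2
    ((h.continuousOn_mul_logDeriv hℓ).mono fun t ht => by
      rw [mem_Ici]; linarith [ht.1]) ⟨by linarith, hU1⟩
  have hxℓ : ℓ < x := by linarith [hx.1]
  have hxn' : x * (logDeriv F x).re = 2 * n := hxn
  refine ⟨x, ⟨hxℓ, (h.isCriticalScale_iff hn0 x).2 ⟨hℓ x hxℓ.le, hxn'⟩⟩, ?_⟩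
  rintro y ⟨hy1, hy2⟩
  have hyn := ((h.isCriticalScale_iff hn0 y).1 hy2).2
  have hyZ : Z ≤ y := by
    by_contra hlt
    linarith [hB y hy1.le (not_le.1 hlt).le]
  exact hY.injOn (hZY.trans hyZ) (hZY.trans hx.1) (hyn.trans hxn'.symm)

variable {lam : ℕ → ℝ} (hlam : ∀ᶠ n : ℕ in atTop, ℓ < lam n ∧ IsCriticalScale F n (lam n))
include hlam

lemma tendsto_criticalScale : Tendsto lam atTop atTop := by
  rw [Filter.tendsto_atTop]
  intro Y
  obtain ⟨B, hB⟩ := h.exists_mul_logDeriv_le hℓ Y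
  have hlarge : ∀ᶠ n : ℕ in atTop, B < 2 * n :=
    (tendsto_natCast_atTop_atTop.const_mul_atTop two_pos).eventually_gt_atTop B
  filter_upwards [hlarge, hlam, eventually_ne_atTop 0] with n hn hl hn0
  have := ((h.isCriticalScale_iff hn0 _).1 hl.2).2
  by_contra hlt
  linarith [hB _ hl.1.le (not_le.1 hlt).le]

/-- With q(x) = (d/2) log x + c, the Lambert expression l₀ solves l₀ q(l₀) = 2n exactly, while λ
satisfies |λ q(λ) - 2n| ≤ C₀. As q increases, |λ - l₀| is at most C₀ divided by q at the smaller of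
the two points, so the relative error is O(1/n). -/
lemma criticalScale_isBigO {N : ℝ} (hN : 0 < N)
    (hc : c = 1 / 2 * Real.log N - d / 2 * Real.log (2 * Real.pi)) :
    (fun n : ℕ => lam n / (4 * n / d *
      (lambertW (2 * n / (Real.pi * d) * N ^ (1 / d)))⁻¹) - 1) =O[atTop] fun n : ℕ => (n : ℝ)⁻¹ := by
  have hd := h.pos
  have hpi := Real.pi_pos
  have hC := h.nonneg
  refine Asymptotics.IsBigO.of_bound C₀ ?_
  filter_upwards [hlam, eventually_ne_atTop 0, eventually_ge_atTop ⌈C₀⌉₊,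
    (h.tendsto_criticalScale hℓ hlam).eventually_ge_atTop X] with n hl hn0 hnC hlX
  have hn : (0 : ℝ) < n := by positivity
  have hnC' : C₀ ≤ n := (Nat.le_ceil _).trans (by exact_mod_cast hnC)
  set l := lam n with hldef
  have hl0 : 0 < l := by linarith [h.one_le]
  have hln := ((h.isCriticalScale_iff hn0 _).1 hl.2).2
  have hx : 0 < 2 * n / (Real.pi * d) * N ^ (1 / d) := by positivity
  obtain ⟨hW0, hWe⟩ := lambertW_spec hx
  set W := lambertW (2 * n / (Real.pi * d) * N ^ (1 / d)) with hW
  set l0 : ℝ := 4 * n / d * W⁻¹ with hl0def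
  have hl00 : 0 < l0 := by positivity
  set q : ℝ → ℝ := fun x => d / 2 * Real.log x + c with hq
  have hq0 : q l0 = d / 2 * W := by
    have e1 : Real.log W + W = Real.log (2 * n / (Real.pi * d)) + 1 / d * Real.log N := by
      rw [← Real.log_rpow hN, ← Real.log_mul (by positivity) (by positivity), ← hWe,
        Real.log_mul hW0.ne' (Real.exp_pos _).ne', Real.log_exp]
    have e2 : Real.log l0 = Real.log (4 * n / d) - Real.log W := by
      rw [hl0def, Real.log_mul (by positivity) (by positivity), Real.log_inv]; ring
    have e3 : Real.log (4 * n / d) = Real.log (2 * Real.pi) + Real.log (2 * n / (Real.pi * d)) := by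
      rw [← Real.log_mul (by positivity) (by positivity)]
      congr 1
      field_simp
      norm_num
    simp only [hq]
    rw [e2, e3, hc]
    have e4 : d / 2 * (1 / d * Real.log N) = 1 / 2 * Real.log N := by field_simp
    linear_combination (-d / 2) * e1 - e4
  have hl0n : l0 * q l0 = 2 * n := by
    rw [hq0, hl0def]; field_simp; norm_num
  have hlq : |l * q l - 2 * n| ≤ C₀ := by
    have h1 := h.abs_logDeriv_sub_le hlX
    rw [← hln, ← mul_sub, abs_mul, abs_of_pos hl0, abs_sub_comm]
    calc l * _ ≤ l * (C₀ / l) := by gcongr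
      _ = C₀ := by field_simp
  have hlq' := abs_le.1 hlq
  rw [Real.norm_eq_abs, Real.norm_eq_abs, abs_of_pos (inv_pos.2 hn), ← div_eq_mul_inv]
  rcases le_total l0 l with hle | hle
  · have hqq : q l0 ≤ q l := by
      simp only [hq]; gcongr
    have h1 : (l - l0) * q l0 ≤ C₀ := by nlinarith
    have h2 : (l - l0) * (2 * n) ≤ C₀ * l0 := by
      rw [← hl0n]
      nlinarith
    rw [abs_of_nonneg (sub_nonneg.2 ((one_le_div hl00).2 hle)), div_sub_one hl00.ne',
      div_le_div_iff₀ hl00 hn]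
    nlinarith
  · have hqq : q l ≤ q l0 := by
      simp only [hq]; gcongr
    have h1 : (l0 - l) * q l ≤ C₀ := by nlinarith
    have h3 : (n : ℝ) ≤ l * q l := by linarith
    have h2 : (l0 - l) * n ≤ C₀ * l0 := by
      have h4 : (l0 - l) * n ≤ (l0 - l) * (l * q l) := by gcongr
      have h5 : (l0 - l) * (l * q l) ≤ C₀ * l := by nlinarith
      nlinarith
    rw [abs_sub_comm, abs_of_nonneg (sub_nonneg.2 ((div_le_one hl00).2 hle)),
      one_sub_div hl00.ne', div_le_div_iff₀ hl00 hn]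
    exact h2

end CompletedAsymp

end CriticalScale

end LTaylor

namespace LTaylor

/-! ### Holomorphic logarithms on convex domains. -/

section Logarithm

open Set

/-- Near z continuity keeps Im(f(w) - f(z)) in (-π, π), so f(w) = f(z) + log(g(w)/g(z)) with the
principal branch. -/
lemma differentiableOn_of_exp_eq {U : Set ℂ} (hU : IsOpen U) {f g : ℂ → ℂ}
    (hf : ContinuousOn f U) (hg : DifferentiableOn ℂ g U) (h : ∀ z ∈ U, cexp (f z) = g z) :
    DifferentiableOn ℂ f U := by
  intro z hz
  have hgz : DifferentiableAt ℂ g z := hg.differentiableAt (hU.mem_nhds hz)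
  have hgz0 : g z ≠ 0 := by rw [← h z hz]; exact exp_ne_zero _
  have hc : ContinuousAt (fun w => (f w - f z).im) z :=
    continuous_im.continuousAt.comp ((hf.continuousAt (hU.mem_nhds hz)).sub continuousAt_const)
  have hpi := Real.pi_pos
  have h1 : ∀ᶠ w in 𝓝 z, (f w - f z).im ∈ Ioo (-Real.pi) Real.pi :=
    hc.eventually_mem (Ioo_mem_nhds (by simp [hpi]) (by simp [hpi]))
  have h2 : f =ᶠ[𝓝 z] fun w => f z + log (g w / g z) := by
    filter_upwards [h1, hU.mem_nhds hz] with w hw hwU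
    rw [← h w hwU, ← h z hz, ← Complex.exp_sub, log_exp hw.1 hw.2.le]
    ring
  have h3 : DifferentiableAt ℂ (fun w => f z + log (g w / g z)) z := by
    refine (DifferentiableAt.clog (hgz.div_const _) ?_).const_add _
    rw [div_self hgz0]
    exact one_mem_slitPlane
  exact (h3.congr_of_eventuallyEq h2).differentiableWithinAt

lemma exists_holomorphic_log {U : Set ℂ} (hU : IsOpen U) (hconv : Convex ℝ U) (hne : U.Nonempty)
    {g : ℂ → ℂ} (hg : DifferentiableOn ℂ g U) (h0 : ∀ z ∈ U, g z ≠ 0) :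
    ∃ f : ℂ → ℂ, DifferentiableOn ℂ f U ∧ ∀ z ∈ U, cexp (f z) = g z := by
  have := hconv.contractibleSpace hne
  obtain ⟨f, hf, hfg⟩ := exists_continuousOn_eqOn_exp_comp
    (SimplyConnectedSpace.ofContractible (Y := U)) hU hg.continuousOn (by rintro ⟨z, hz, hz0⟩; exact h0 z hz hz0)
  exact ⟨f, differentiableOn_of_exp_eq hU hf hg fun z hz => hfg hz, fun z hz => hfg hz⟩

end Logarithm

/-! ### Construction of the phase and its control near 1. -/

section Phase

open Metric Set

lemma norm_neg_two_div_sq_add_two_le {z : ℂ} (hz : z ∈ ball (1 : ℂ) (1 / 100)) :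
    ‖-(2 / z ^ 2) + 2‖ ≤ 21 / 500 := by
  rw [mem_ball_iff_norm] at hz
  have h1 : 99 / 100 ≤ ‖z‖ := by
    have := norm_sub_norm_le (1 : ℂ) (1 - z)
    rw [sub_sub_cancel, norm_one, norm_sub_rev] at this
    linarith
  have h2 : ‖z + 1‖ ≤ 201 / 100 := by
    have := norm_add_le (z - 1) 2
    rw [show z - 1 + 2 = z + 1 by ring, RCLike.norm_ofNat] at this
    linarith
  have hz0 : z ≠ 0 := norm_pos_iff.1 (by linarith)
  rw [show -(2 / z ^ 2) + 2 = 2 * ((z - 1) * (z + 1)) / z ^ 2 by field_simp; ring, norm_div,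
    norm_mul, norm_mul, norm_pow, RCLike.norm_ofNat]
  rw [div_le_iff₀ (by positivity)]
  have h3 : ‖z - 1‖ * ‖z + 1‖ ≤ 1 / 100 * (201 / 100) := by gcongr
  nlinarith

namespace CompletedAsymp

variable {F : ℂ → ℂ} {d c X C₀ : ℝ} (h : CompletedAsymp F d c X C₀)
include h

/-- log(lw) - log l = log w does not involve l, so F'/F changes only by a bounded amount on the
scale l. -/
lemma norm_logDeriv_sub_le {l : ℝ} (hl : 2 * X ≤ l) {w : ℂ} (hw : ‖w - 1‖ ≤ 7 / 20) :
    ‖logDeriv F (l * w) - logDeriv F l‖ ≤ d / 2 + 3 * C₀ := by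
  have hX := h.one_le
  have hl0 : 0 < l := by linarith
  have hC := h.nonneg
  have h1 := (abs_le.1 ((abs_re_le_norm _).trans hw)).1
  have h2 := (abs_im_le_norm _).trans hw
  rw [sub_re, one_re] at h1
  rw [sub_im, one_im, sub_zero] at h2
  have hre : (l * w : ℂ).re = l * w.re := re_ofReal_mul _ _
  have him : (l * w : ℂ).im = l * w.im := im_ofReal_mul _ _
  have hw0 : w ≠ 0 := by rintro rfl; simp at h1; linarith
  have h3 : l / 2 ≤ l * w.re := by nlinarith
  have a1 := h.logDeriv_le (l * w) (by rw [hre]; linarith) (by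
    rw [hre, him, abs_mul, abs_of_pos hl0]
    gcongr
    linarith)
  have a2 := h.logDeriv_le l (by rw [ofReal_re]; linarith) (by
    rw [ofReal_re, ofReal_im, abs_zero]; exact hl0.le)
  rw [hre] at a1
  rw [ofReal_re] at a2
  have a1' : C₀ / (l * w.re) ≤ 2 * C₀ := by
    rw [div_le_iff₀ (by linarith)]
    nlinarith
  have a2' : C₀ / l ≤ C₀ := div_le_self hC (by linarith)
  have hlog : log (l * w) = Real.log l + log w := log_ofReal_mul hl0 hw0
  have hlw : ‖log w‖ ≤ 1 := by
    have := norm_log_one_add_half_le_self (z := w - 1) (by linarith)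
    rw [add_sub_cancel] at this
    linarith
  have e : logDeriv F (l * w) - logDeriv F l
      = (logDeriv F (l * w) - (d / 2 * log (l * w) + c))
        - (logDeriv F l - (d / 2 * log l + c)) + d / 2 * log w := by
    rw [hlog, ← ofReal_log hl0.le]; ring
  rw [e]
  have hd2 : ‖(d / 2 * log w : ℂ)‖ ≤ d / 2 := by
    rw [norm_mul, show ((d : ℂ) / 2) = ((d / 2 : ℝ) : ℂ) by push_cast; ring, norm_real,
      Real.norm_of_nonneg (half_pos h.pos).le]
    exact mul_le_of_le_one_right (half_pos h.pos).le hlw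
  refine (norm_add_le _ _).trans ?_
  have := norm_sub_le (logDeriv F (l * w) - (d / 2 * log (l * w) + c))
    (logDeriv F l - (d / 2 * log l + c))
  linarith

/-- The derivative `2 / z - (l / n) (F' / F) (l z)` of the phase satisfies the requirements at `1`
once `(F' / F) l` is large. -/
lemma localPhase_of_hasDerivAt {n : ℕ} (hn : n ≠ 0) {l : ℝ} (hl : 2 * X ≤ l)
    (hcrit : l * (logDeriv F l).re = 2 * n)
    (hlarge : 1000 * (d / 2 + 3 * C₀) ≤ (logDeriv F l).re) {φ : ℂ → ℂ} (hφ1 : φ 1 = 0)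
    (hφ : ∀ z : ℂ, 1 / 2 < z.re →
      HasDerivAt φ (2 / z - (l / n : ℂ) * logDeriv F (l * z)) z) : LocalPhase φ := by
  have hX := h.one_le
  have hl0 : 0 < l := by linarith
  have hC := h.nonneg
  have hn' : (0 : ℝ) < n := by positivity
  have hnc : (n : ℂ) ≠ 0 := by exact_mod_cast hn
  set m := (logDeriv F l).re with hm
  have hmc : logDeriv F l = (m : ℂ) := h.logDeriv_ofReal l
  have hln : (l / n : ℂ) * m = 2 := by
    have : (l : ℂ) * m = 2 * n := by exact_mod_cast congrArg ofReal hcrit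
    field_simp
    linear_combination this
  set ψ : ℂ → ℂ := fun z => 2 / z - (l / n : ℂ) * logDeriv F (l * z) with hψ
  have hopen : IsOpen {z : ℂ | 1 / 2 < z.re} := isOpen_lt continuous_const continuous_re
  have hder : ∀ z : ℂ, 1 / 2 < z.re → deriv φ =ᶠ[𝓝 z] ψ := fun z hz => by
    filter_upwards [hopen.mem_nhds hz] with w hw
    exact (hφ w hw).deriv
  have hsub : ∀ z ∈ ball (1 : ℂ) (1 / 100), 1 / 2 < z.re := fun z hz => by
    linarith [re_pos_of_mem_ball hz]
  have h1re : 1 / 2 < (1 : ℂ).re := by norm_num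
  have hconj : starRingEnd ℂ ∘ ψ ∘ starRingEnd ℂ = ψ := by
    ext z
    have e : (l : ℂ) * starRingEnd ℂ z = starRingEnd ℂ (l * z) := by simp
    simp only [Function.comp_apply, hψ]
    rw [e, h.logDeriv_conj]
    simp only [map_sub, map_div₀, map_mul, conj_conj, conj_ofReal, map_natCast, map_ofNat]
  refine ⟨fun z hz => (hφ z (hsub z hz)).differentiableAt.differentiableWithinAt, hφ1, ?_, ?_, ?_⟩
  · rw [(hφ 1 h1re).deriv, mul_one, hmc, hln]
    norm_num
  · intro z hz
    rw [(hder z (hsub z hz)).deriv_eq]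
    have hz' := mem_ball_iff_norm.1 hz
    have hball : ∀ w ∈ closedBall z (1 / 3), ‖w - 1‖ ≤ 7 / 20 := by
      intro w hw
      rw [mem_closedBall_iff_norm] at hw
      have := norm_add_le (w - z) (z - 1)
      rw [sub_add_sub_cancel] at this
      linarith
    have hne : ∀ w : ℂ, ‖w - 1‖ ≤ 7 / 20 → w ≠ 0 := by
      rintro w hw rfl
      simp at hw
      norm_num at hw
    have hFd : ∀ w : ℂ, ‖w - 1‖ ≤ 7 / 20 →
        DifferentiableAt ℂ (fun w : ℂ => logDeriv F (l * w)) w := by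
      intro w hw
      have h1 := (abs_le.1 ((abs_re_le_norm _).trans hw)).1
      rw [sub_re, one_re] at h1
      have h2 : F (l * w) ≠ 0 := h.ne_zero _ (by rw [re_ofReal_mul]; nlinarith)
      exact DifferentiableAt.comp (f := fun w : ℂ => (l : ℂ) * w) w
        (h.differentiableAt_logDeriv h2) (by fun_prop)
    -- The deviation of φ' from 2/w - 2. As (l/n)(F'/F)(l) = 2, it is at most 2/1000, and Cauchy's
    -- estimate with radius 1/3 gives κ' ≤ 3/500; added to 21/500 this is below 1/20.
    set κ : ℂ → ℂ := fun w => (l / n : ℂ) * (logDeriv F l - logDeriv F (l * w)) with hκ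
    have hκd : ∀ w : ℂ, ‖w - 1‖ ≤ 7 / 20 → DifferentiableAt ℂ κ w := fun w hw =>
      ((hFd w hw).const_sub _).const_mul _
    have hdc : DiffContOnCl ℂ κ (ball z (1 / 3)) := by
      apply DifferentiableOn.diffContOnCl
      rw [closure_ball _ (by norm_num)]
      exact fun w hw => (hκd w (hball w hw)).differentiableWithinAt
    have hlnn : ‖(l / n : ℂ)‖ * m = 2 := by
      have : ‖(l / n : ℂ)‖ = l / n := by
        rw [norm_div, norm_real, Real.norm_of_nonneg hl0.le, norm_natCast]
      rw [this]
      field_simp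
      linarith
    have hk := norm_deriv_le_of_forall_mem_sphere_norm_le (C := 1 / 500) (by norm_num) hdc
      (fun w hw => by
        have h3 := h.norm_logDeriv_sub_le hl (hball w (sphere_subset_closedBall hw))
        rw [hκ, norm_mul, norm_sub_rev]
        have h4 : 0 ≤ ‖(l / n : ℂ)‖ := norm_nonneg _
        have h5 : ‖(l / n : ℂ)‖ * ‖logDeriv F (l * w) - logDeriv F l‖
            ≤ ‖(l / n : ℂ)‖ * (d / 2 + 3 * C₀) := by gcongr
        have h6 := mul_le_mul_of_nonneg_left hlarge h4
        linarith)
    have hz2 : ‖z - 1‖ ≤ 7 / 20 := by linarith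
    have hz0 := hne z hz2
    have hψκ : ψ = fun w => (2 * w⁻¹ - 2) + κ w := by
      ext w
      simp only [hψ, hκ]
      rw [hmc, mul_sub, hln]
      ring
    have hinv : HasDerivAt (fun w : ℂ => 2 * w⁻¹ - 2) (2 * -(z ^ 2)⁻¹) z :=
      ((hasDerivAt_inv hz0).const_mul 2).sub_const 2
    rw [hψκ, (hinv.fun_add (hκd z hz2).hasDerivAt).deriv]
    have := norm_neg_two_div_sq_add_two_le hz
    rw [show 2 * -(z ^ 2)⁻¹ + deriv κ z + 2 = (-(2 / z ^ 2) + 2) + deriv κ z by ring]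
    refine (norm_add_le _ _).trans ?_
    linarith
  · have h2 : iteratedDeriv 2 φ 1 = deriv ψ 1 := by
      rw [iteratedDeriv_succ, iteratedDeriv_one, (hder 1 h1re).deriv_eq]
    have h3 := congrFun (deriv_conj_conj (f := ψ)) 1
    rw [hconj] at h3
    simp only [Function.comp_apply, map_one] at h3
    rw [h2]
    exact conj_eq_iff_im.1 h3.symm

/-- The phase and its properties for a critical scale `l`. -/
theorem exists_phase {n : ℕ} (hn : n ≠ 0) {l : ℝ} (hl : 2 * X < l)
    (hcrit : l * (logDeriv F l).re = 2 * n)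
    (hlarge : 1000 * (d / 2 + 3 * C₀) ≤ (logDeriv F l).re) :
    ∃ φ : ℂ → ℂ, IsPhase F n l φ ∧ Admissible C₀ n (fun z => F (l * z) / F l) φ := by
  have hX := h.one_le
  have hl0 : 0 < l := by linarith
  have hnc : (n : ℂ) ≠ 0 := by exact_mod_cast hn
  have hopen : ∀ a : ℝ, IsOpen {z : ℂ | a < z.re} := fun a =>
    isOpen_lt continuous_const continuous_re
  -- A logarithm of F on Re > X. Since l > 2X, multiplication by l sends Re z > 1/2 into this
  -- half-plane.
  obtain ⟨g, hg, hgF⟩ := exists_holomorphic_log (hopen X) (convex_halfSpace_re_gt X)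
    ⟨((X + 1 : ℝ) : ℂ), show X < (((X + 1 : ℝ) : ℂ)).re by rw [ofReal_re]; linarith⟩
    h.entire.differentiableOn fun z hz => h.ne_zero z (le_of_lt hz)
  have hFl : F l ≠ 0 := h.ne_zero l (by rw [ofReal_re]; linarith)
  have hmem : ∀ z : ℂ, 1 / 2 < z.re → X < ((l : ℂ) * z).re := fun z hz => by
    rw [re_ofReal_mul]; nlinarith
  set φ₀ : ℂ → ℂ := fun z => 2 * log z - (g (l * z) - g l) / n with hφ₀
  set φ : ℂ → ℂ := fun z => if 1 / 2 < z.re then φ₀ z else if 1 / 2 < -z.re then φ₀ (-z) else 0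
    with hφ
  have hφpos : ∀ z : ℂ, 1 / 2 < z.re → φ z = φ₀ z := fun z hz => if_pos hz
  have hφneg : ∀ z : ℂ, 1 / 2 < -z.re → φ z = φ₀ (-z) := fun z hz => by
    simp only [hφ]
    rw [if_neg (by linarith), if_pos hz]
  have hder₀ : ∀ z : ℂ, 1 / 2 < z.re →
      HasDerivAt φ₀ (2 / z - (l / n : ℂ) * logDeriv F (l * z)) z := by
    intro z hz
    have hw := hmem z hz
    have hgd := (hg.differentiableAt ((hopen X).mem_nhds hw)).hasDerivAt
    have hgeq : (fun w => cexp (g w)) =ᶠ[𝓝 ((l : ℂ) * z)] F := by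
      filter_upwards [(hopen X).mem_nhds hw] with w hw using hgF w hw
    have hgval : deriv g (l * z) = logDeriv F (l * z) := by
      have h1 := (hgd.cexp.congr_of_eventuallyEq hgeq.symm).deriv
      rw [logDeriv_apply, h1, hgF _ hw, mul_div_cancel_left₀ _ (h.ne_zero _ hw.le)]
    rw [hgval] at hgd
    have h2 : HasDerivAt (fun z : ℂ => g (l * z)) (logDeriv F (l * z) * (l * 1)) z :=
      hgd.comp z ((hasDerivAt_id z).const_mul (l : ℂ))
    have h3 := (hasDerivAt_log (Or.inl (by linarith) : z ∈ slitPlane)).const_mul 2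
    refine (h3.fun_sub ((h2.sub_const (g l)).div_const (n : ℂ))).congr_deriv ?_
    ring
  have hder : ∀ z : ℂ, 1 / 2 < z.re →
      HasDerivAt φ (2 / z - (l / n : ℂ) * logDeriv F (l * z)) z := fun z hz =>
    (hder₀ z hz).congr_of_eventuallyEq (by
      filter_upwards [(hopen (1 / 2)).mem_nhds hz] with w hw using hφpos w hw)
  have hφ1 : φ 1 = 0 := by
    rw [hφpos 1 (by norm_num)]; simp [hφ₀]
  have heven : ∀ z, φ (-z) = φ z := by
    intro z
    rcases lt_or_ge (1 / 2) z.re with h1 | h1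
    · rw [hφpos z h1, hφneg (-z) (by rwa [neg_re, neg_neg]), neg_neg]
    · rcases lt_or_ge (1 / 2) (-z.re) with h2 | h2
      · rw [hφneg z h2, hφpos (-z) (by rwa [neg_re])]
      · simp only [hφ, neg_re, neg_neg]
        rw [if_neg (not_lt.2 h2), if_neg (not_lt.2 h1), if_neg (not_lt.2 h1), if_neg (not_lt.2 h2)]
  have hexp : ∀ z : ℂ, 1 / 2 < z.re → F (l * z) ≠ 0 ∧
      cexp (n * φ z) = z ^ (2 * n) * F l / F (l * z) := by
    intro z hz
    have hz0 : z ≠ 0 := by rintro rfl; norm_num at hz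
    refine ⟨h.ne_zero _ (hmem z hz).le, ?_⟩
    rw [hφpos z hz, hφ₀]
    have e : (n : ℂ) * (2 * log z - (g (l * z) - g l) / n)
        = (2 * n : ℕ) * log z + g l - g (l * z) := by
      push_cast; field_simp; ring
    rw [e, Complex.exp_sub, Complex.exp_add, Complex.exp_nat_mul, exp_log hz0,
      hgF _ (hmem z hz), hgF l (by rw [mem_ofPred_eq, ofReal_re]; linarith)]
  refine ⟨φ, ⟨?_, heven, hφ1, ?_⟩, ⟨?_, ?_, ?_, ?_, ?_, ?_⟩⟩
  · intro z hz
    rcases lt_abs.1 (show 1 / 2 < |z.re| from hz) with h1 | h1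
    · exact (hder z h1).differentiableAt.differentiableWithinAt
    · have h2 : DifferentiableAt ℂ (fun z => φ (-z)) z :=
        DifferentiableAt.comp (f := fun z : ℂ => -z) z
          (hder (-z) (by rwa [neg_re])).differentiableAt (by fun_prop)
      simp only [heven] at h2
      exact h2.differentiableWithinAt
  · intro z hz
    rcases lt_abs.1 hz with h1 | h1
    · exact hexp z h1
    · have := hexp (-z) (by rwa [neg_re])
      rwa [mul_neg, h.even, heven, Even.neg_pow (even_two_mul n)] at this
  · exact h.localPhase_of_hasDerivAt hn hl.le hcrit hlarge hφ1 hder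
  · exact (h.entire.comp (by fun_prop : Differentiable ℂ fun z : ℂ => (l : ℂ) * z)).div_const _
  · intro z
    rw [mul_neg, h.even]
  · obtain ⟨C, Y, hY, hb⟩ := h.decay l
    refine ⟨C / l ^ 2 / ‖F l‖, Y / l, by positivity, fun x y hx hy => ?_⟩
    have h1 := hb (l * x) (l * y) (by
      rw [abs_mul, abs_of_pos hl0]; exact mul_le_of_le_one_right hl0.le hx) (by
      rw [abs_mul, abs_of_pos hl0]
      rwa [div_le_iff₀ hl0, mul_comm] at hy)
    rw [show ((l * x : ℝ) : ℂ) + (l * y : ℝ) * I = l * (x + y * I) by push_cast; ring] at h1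
    have hFl' : 0 < ‖F l‖ := norm_pos_iff.2 hFl
    rw [norm_div]
    calc _ ≤ C / (l * y) ^ 2 / ‖F l‖ := by gcongr
      _ = _ := by rw [mul_pow]; field_simp
  · intro z hz
    obtain ⟨h1, h2⟩ := hexp z hz
    rw [h2]
    field_simp
  · intro x y hx
    have h1 := h.vertical (l * (x + y * I)) (by rw [re_ofReal_mul]; simp; nlinarith)
    rw [re_ofReal_mul] at h1
    simp only [add_re, ofReal_re, mul_re, I_re, mul_zero, ofReal_im, I_im, mul_one, sub_self,
      add_zero] at h1
    push_cast at h1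
    rw [norm_div, norm_div, ← mul_div_assoc]
    gcongr

end CompletedAsymp

end Phase

/-! ### Scaling back to F. -/

section Scaling

lemma taylorPoly_scale {F : ℂ → ℂ} (hF : Differentiable ℂ F) {l : ℂ} (hl : F l ≠ 0) (m : ℕ)
    (z : ℂ) : taylorPoly F m (l * z) = F l * taylorPoly (fun z => F (l * z) / F l) m z := by
  unfold taylorPoly
  rw [Finset.mul_sum]
  refine Finset.sum_congr rfl fun k _ => ?_
  have h1 : iteratedDeriv k (fun z => F (l * z) / F l) 0 = (F l)⁻¹ * (l ^ k * iteratedDeriv k F 0) := by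
    have e : (fun z => F (l * z) / F l) = fun z => (F l)⁻¹ * F (l * z) := by
      ext z; rw [div_eq_inv_mul]
    rw [e, iteratedDeriv_const_mul_field, iteratedDeriv_comp_const_mul hF.contDiff]
    simp
  rw [h1, mul_pow]
  field_simp

/-- The two polynomials differ by the term of odd degree 2n - 1, which vanishes for an even
function. -/
lemma taylorPoly_even_succ {F : ℂ → ℂ} (he : ∀ z, F (-z) = F z) {n : ℕ} (hn : n ≠ 0) (z : ℂ) :
    taylorPoly F (2 * n - 2) z = taylorPoly F (2 * n - 1) z := by
  unfold taylorPoly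
  have e : 2 * n - 1 + 1 = (2 * n - 2 + 1) + 1 := by omega
  rw [e, Finset.sum_range_succ _ (2 * n - 2 + 1)]
  have h1 := iteratedDeriv_comp_neg (2 * n - 2 + 1) F 0
  have hodd : Odd (2 * n - 2 + 1) := by
    obtain ⟨k, rfl⟩ := Nat.exists_eq_succ_of_ne_zero hn
    exact ⟨k, by omega⟩
  simp only [he, neg_zero, hodd.neg_one_pow, smul_eq_mul] at h1
  have h2 : iteratedDeriv (2 * n - 2 + 1) F 0 = 0 := by linear_combination (1 / 2) * h1
  rw [h2]
  simp

lemma Expansion.scale {F : ℂ → ℂ} {n : ℕ} {l : ℝ} (hl : F l ≠ 0) {φ w E : ℂ → ℂ} {B : Set ℂ}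
    {T z : ℂ} (h : Expansion (fun z => F (l * z) / F l) n 1 φ w B E T z) :
    Expansion F n l φ w B E (F l * T) z := by
  obtain ⟨h1, h2⟩ := h
  simp only [ofReal_one, one_mul, mul_one, div_self hl] at h1 h2
  refine ⟨fun hz => ?_, fun hz => ?_⟩
  · rw [h1 hz]; field_simp
  · rw [h2 hz]; field_simp

end Scaling

end LTaylor

/-! ### The main theorem. -/

theorem theorem6p2
    -- the Dirichlet series and its entire continuation
    (a : ℕ → ℝ) (L : ℂ → ℂ) (ha : a 1 ≠ 0)
    (hseries : ∃ σ : ℝ, ∀ z : ℂ, σ < z.re → LSeriesHasSum (fun n => (a n : ℂ)) z (L z))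
    (hL : Differentiable ℂ L)
    -- the completed function and its functional equation
    (N : ℝ) (hN : 0 < N) (J K : ℕ) (hJK : 0 < J + K) (μ : Fin J → ℂ) (η : Fin K → ℂ)
    (Λ : ℂ → ℂ) (hΛ : Differentiable ℂ Λ)
    (hΛL : ∀ z : ℂ, (∀ j, ∀ m : ℕ, z + μ j ≠ -(2 * m)) → (∀ k, ∀ m : ℕ, z + η k ≠ -m) →
      Λ z = (N : ℂ) ^ (z / 2) * (∏ j, Complex.Gammaℝ (z + μ j)) *
        (∏ k, Complex.Gammaℂ (z + η k)) * L z)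
    (hΛreal : ∀ z : ℂ, Λ (starRingEnd ℂ z) = starRingEnd ℂ (Λ z))
    (hΛsymm : ∀ z : ℂ, Λ z = Λ (1 - z))
    -- polynomial growth in the imaginary part, on vertical strips
    (hgrowth : ∀ x₁ x₂ : ℝ, ∃ C A Y : ℝ, 0 < C ∧ 0 < A ∧ 0 < Y ∧
      ∀ x y : ℝ, x₁ ≤ x → x ≤ x₂ → Y ≤ |y| → ‖L (x + y * Complex.I)‖ ≤ C * |y| ^ A)
    (F : ℂ → ℂ) (hF : ∀ z : ℂ, F z = Λ (1 / 2 + z)) :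
    -- `F` has no real zeros far to the right
    (∃ ℓ : ℝ, 1 / 2 ≤ ℓ ∧ ∀ x : ℝ, ℓ ≤ x → F x ≠ 0) ∧
    ∀ ℓ : ℝ, 1 / 2 ≤ ℓ → (∀ x : ℝ, ℓ ≤ x → F x ≠ 0) →
      -- the scale exists and is unique
      (∀ᶠ n : ℕ in atTop, ∃! x : ℝ, ℓ < x ∧ LTaylor.IsCriticalScale F n x) ∧
      ∀ lam : ℕ → ℝ, (∀ᶠ n : ℕ in atTop, ℓ < lam n ∧ LTaylor.IsCriticalScale F n (lam n)) →
        -- its asymptotics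
        ((fun n : ℕ => lam n / (4 * n / (J + 2 * K) *
            (LTaylor.lambertW (2 * n / (Real.pi * (J + 2 * K)) *
              N ^ (1 / (J + 2 * K : ℝ))))⁻¹) - 1) =O[atTop] fun n : ℕ => (n : ℝ)⁻¹) ∧
        -- the phase and the local coordinate, and the uniform expansion
        ∃ δ₀ : ℝ, 0 < δ₀ ∧ ∃ (φ w : ℕ → ℂ → ℂ) (D : ℕ → Set ℂ),
          (∀ᶠ n : ℕ in atTop, LTaylor.IsPhase F n (lam n) (φ n) ∧
            LTaylor.IsLocalCoord (φ n) (w n) (D n) δ₀) ∧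
          ∀ δ : ℝ, 0 < δ → δ < δ₀ → ∃ (E : ℕ → ℂ → ℂ) (C : ℝ), ∀ᶠ n : ℕ in atTop,
            (∀ z : ℂ,
              LTaylor.taylorPoly F (2 * n - 2) (lam n * z) =
                LTaylor.taylorPoly F (2 * n - 1) (lam n * z) ∧
              LTaylor.Expansion F n (lam n) (φ n) (w n) (LTaylor.localDisks (w n) (D n) δ) (E n)
                (LTaylor.taylorPoly F (2 * n - 2) (lam n * z)) z) ∧
            AnalyticOnNhd ℂ (E n)
              (({z : ℂ | |z.re| = 1} \ LTaylor.localDisks (w n) (D n) δ) ∪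
                frontier (LTaylor.localDisks (w n) (D n) δ))ᶜ ∧
            (∀ z : ℂ, ‖E n z‖ ≤ C) ∧
            (∀ z : ℂ, z ∉ LTaylor.localDisks (w n) (D n) δ → ‖E n z‖ ≤ C / n) ∧
            (∀ z ∈ LTaylor.localDisks (w n) (D n) δ, z ≠ 1 → z ≠ -1 →
              ‖E n z - (LTaylor.H0 (φ n) z +
                1 / (2 * Complex.I * (Real.sqrt Real.pi : ℂ) * w n z))‖ ≤ C / n) := by
  obtain ⟨X, C₀, h⟩ := LTaylor.exists_completedAsymp a L ha hseries hL N hN J K hJK μ η Λ hΛ hΛL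
    hΛreal hΛsymm hgrowth F hF
  have hX := h.one_le
  refine ⟨⟨X, by linarith, fun x hx => h.ne_zero x (by rwa [ofReal_re])⟩, fun ℓ _ hℓ =>
    ⟨h.existsUnique_criticalScale hℓ, fun lam hlam => ⟨?_, 1 / 200, by norm_num, ?_⟩⟩⟩
  · exact h.criticalScale_isBigO hℓ hlam hN rfl
  have hlim := h.tendsto_criticalScale hℓ hlam
  have hphase : ∀ᶠ n : ℕ in atTop, n ≠ 0 ∧ F (lam n) ≠ 0 ∧ ∃ φ v : ℂ → ℂ,
      LTaylor.IsPhase F n (lam n) φ ∧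
      LTaylor.Admissible C₀ n (fun z => F (lam n * z) / F (lam n)) φ ∧ LTaylor.LocalRoot φ v := by
    filter_upwards [eventually_ne_atTop 0, hlam, hlim.eventually_gt_atTop (2 * X),
      (h.tendsto_logDeriv_re.comp hlim).eventually_ge_atTop
        (1000 * ((J + 2 * K : ℝ) / 2 + 3 * C₀))] with n hn hl hlX hlarge
    obtain ⟨φ, h1, h2⟩ := h.exists_phase hn hlX ((h.isCriticalScale_iff hn _).1 hl.2).2 hlarge
    obtain ⟨v, v1, v2, v3, v4, v5⟩ := h2.phase.exists_sqrt
    exact ⟨hn, hℓ _ hl.1.le, φ, v, h1, h2, ⟨v1, v2, v3, v4, v5⟩⟩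
  obtain ⟨n₀, hn₀⟩ := eventually_atTop.1 hphase
  -- Below n₀ the chosen functions are arbitrary; only eventual statements are made about them.
  choose! hne hF0 φ v hφ hadm hv using hn₀
  have hge := eventually_ge_atTop n₀
  refine ⟨φ, fun n => LTaylor.evenCoord (v n), fun n => LTaylor.rootDisk (v n) (1 / 200),
    hge.mono fun n hn => ⟨hφ n hn, (hv n hn).isLocalCoord⟩, fun δ hδ0 hδ => ?_⟩
  -- The constant is fixed before n and depends only on C₀ and δ: this is the uniformity claimed.
  obtain ⟨C, hC⟩ := LTaylor.exists_uniform_expansion C₀ hδ0 hδ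
  have hE : ∀ n, n₀ ≤ n → _ := fun n hn =>
    hC n _ (φ n) (v n) (hne n hn) (hadm n hn) (hv n hn) _ rfl
  choose! E hE1 hE2 hE3 hE4 hE5 using hE
  refine ⟨E, C, hge.mono fun n hn => ⟨fun z => ⟨?_, ?_⟩, hE2 n hn, hE3 n hn, hE4 n hn, hE5 n hn⟩⟩
  · exact LTaylor.taylorPoly_even_succ h.even (hne n hn) _
  · rw [LTaylor.taylorPoly_even_succ h.even (hne n hn),
      LTaylor.taylorPoly_scale h.entire (hF0 n hn)]
    exact LTaylor.Expansion.scale (hF0 n hn) (hE1 n hn z)
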